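/- Let $d\in\mathbb N$, $T>0$, and for $n\ge 0$ and multi-indices $\alpha\in\mathbb N_0^d$ with $|\alpha|\le 2$ let $a_{\alpha,n}:[0,T]\times\mathbb R^d\to\mathbb R$ be continuous functions such that $a_{\alpha,n}(t,\cdot)$ is a polynomial whose degree is bounded uniformly in $t\in[0,T]$, and such that $a_{\alpha,0}(t,\cdot)=a_{\alpha,0}(t)$ does not depend on $x$. Put $\mathcal A_n=\sum_{|\alpha|\le 2}a_{\alpha,n}(t,x)D_x^\alpha$ and write $$\mathcal A_0=\tfrac12\sum_{i,j=1}^d C_{ij}(t)\partial_{x_ix_j}+\langle m(t),\nabla_x\rangle+\gamma(t),$$ where the symmetric matrix $C(t)$ is assumed positive definite, uniformly in $t\in[0,T]$. Let $\varphi:\mathbb R^d\to\mathbb R$ be measurable with at most exponential growth, $|\varphi(x)|\le Ke^{\kappa|x|}$ (for instance bounded and measurable). The terms $u_n$ of the formal expansion $u=\sum_{n\ge0}u_n$ are defined by the nested Cauchy problems $$(\partial_t+\mathcal A_0)u_0=0,\quad u_0(T,\cdot)=\varphi,\qquad\qquad (\partial_t+\mathcal A_0)u_n=-\sum_{h=1}^n\mathcal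 A_hu_{n-h},\quad u_n(T,\cdot)=0\quad(n\ge1),$$ on $[0,T)\times\mathbb R^d$. Here a solution is a function of class $C^{1,2}$ on $[0,T)\times\mathbb R^d$ (with the right derivative in $t$ at $t=0$) that satisfies the equation there, is bounded by $Ke^{\kappa|x|}$ for some constants $K,\kappa$ independent of $t$ (which may depend on $n$), and attains its terminal datum as the limit $t\uparrow T$ for almost every $x$. For $t\le s$ set $\mathbf C(t,s)=\int_t^sC(r)\,dr$, $\mathbf m(t,s)=\int_t^sm(r)\,dr$, and for $t<T$ let $\Gamma_0(t,x;T,\cdot)$ be the $d$-dimensional Gaussian density with mean $x+\mathbf m(t,T)$ and covariance matrix $\mathbf C(t,T)$. Set $$\mathcal M^x(t,s)=x+\mathbf m(t,s)+\mathbf C(t,s)\nabla_x,\qquad \mathcal G^x_n(t,s)=\sum_{|\alpha|\le2}a_{\alpha,n}\big(s,\mathcal M^x(t,s)\big)D_x^\alpha,$$ $$I_{n,h}=\{(i_1,\dots,i_h)\in\mathbb N^h: i_k\ge1,\ i_1+\dots+i_h=n\},$$ $$\mathcal L^x_n(t,T)=\sum_{h=1}^n\int_t^Tds_1\int_{s_1}^Tds_2\cdots\int_{s_{h-1}}^Tds_h\sum_{i\in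 I_{n,h}}\mathcal G^x_{i_1}(t,s_1)\cdots\mathcal G^x_{i_h}(t,s_h).$$ Then the nested Cauchy problems have a unique sequence of solutions $(u_n)_{n\ge0}$, and it is given, for all $t\in[0,T)$ and $x\in\mathbb R^d$, by $$u_0(t,x)=e^{\int_t^T\gamma(s)\,ds}\int_{\mathbb R^d}\Gamma_0(t,x;T,y)\varphi(y)\,dy,\qquad u_n(t,x)=\mathcal L^x_n(t,T)\,u_0(t,x)\quad(n\ge1).$$ -/

import Mathlib

open MeasureTheory Filter Topology Set

noncomputable section

namespace GaussianExpansion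

/-- The space `ℝ^d` with its Euclidean norm and Lebesgue measure. -/
abbrev Rd (d : ℕ) := EuclideanSpace ℝ (Fin d)

/-- The multi-indices `α ∈ ℕ₀^d` with `|α| ≤ 2`. -/
def multiIdx (d : ℕ) : Finset (Fin d → ℕ) :=
  (Fintype.piFinset fun _ => Finset.range 3).filter fun α => ∑ i, α i ≤ 2

/-- For operators `A₁, …, A_d` on functions and a multi-index `β`, the ordered composition
`A₁^{β₁} ∘ ⋯ ∘ A_d^{β_d}` applied to `f`. -/
def opPow {d : ℕ} (A : Fin d → (Rd d → ℝ) → (Rd d → ℝ)) (β : Fin d → ℕ) (f : Rd d → ℝ) :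
    Rd d → ℝ :=
  (List.finRange d).foldr (fun i g => (A i)^[β i] g) f

/-- The partial derivative `∂_{x_i} f`. -/
def pd {d : ℕ} (i : Fin d) (f : Rd d → ℝ) : Rd d → ℝ :=
  fun x => fderiv ℝ f x (EuclideanSpace.single i 1)

/-- `D^α f = ∂_{x_1}^{α_1} ⋯ ∂_{x_d}^{α_d} f`. -/
def D {d : ℕ} (α : Fin d → ℕ) (f : Rd d → ℝ) : Rd d → ℝ :=
  opPow pd α f

/-- The operator `p(A₁, …, A_d)` for a polynomial `p = ∑_β c_β X^β`. -/
def polyOp {d : ℕ} (p : MvPolynomial (Fin d) ℝ) (A : Fin d → (Rd d → ℝ) → (Rd d → ℝ))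
    (f : Rd d → ℝ) : Rd d → ℝ :=
  fun x => ∑ β ∈ p.support, p.coeff β * opPow A (⇑β) f x

/-- A family of coefficients: `a α n t` is the polynomial `x ↦ a_{α,n}(t,x)`
(only `|α| ≤ 2` matters). -/
abbrev Coeffs (d : ℕ) := (Fin d → ℕ) → ℕ → ℝ → MvPolynomial (Fin d) ℝ

/-- The value `a_{α,n}(t,x)`. -/
def Coeffs.val {d : ℕ} (a : Coeffs d) (α : Fin d → ℕ) (n : ℕ) (t : ℝ) (x : Rd d) : ℝ :=
  MvPolynomial.eval (fun i => x i) (a α n t)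

/-- The value of the order-zero coefficient `a_{α,0}(t)`, which does not depend on `x`. -/
def Coeffs.zeroth {d : ℕ} (a : Coeffs d) (α : Fin d → ℕ) (t : ℝ) : ℝ :=
  a.val α 0 t 0

/-- The matrix `C(t)` in `𝓐₀ = ½ ∑ C_{ij}(t) ∂_{ij} + ⟨m(t), ∇⟩ + γ(t)`. -/
def Coeffs.diffusion {d : ℕ} (a : Coeffs d) (t : ℝ) : Matrix (Fin d) (Fin d) ℝ :=
  Matrix.of fun i j => (if i = j then 2 else 1) * a.zeroth (Pi.single i 1 + Pi.single j 1) t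

/-- The vector `m(t)`. -/
def Coeffs.drift {d : ℕ} (a : Coeffs d) (t : ℝ) (i : Fin d) : ℝ :=
  a.zeroth (Pi.single i 1) t

/-- The scalar `γ(t)`. -/
def Coeffs.potential {d : ℕ} (a : Coeffs d) (t : ℝ) : ℝ :=
  a.zeroth 0 t

/-- Polynomial expansions on `[0,T]`: the functions `a_{α,n}` are continuous on `[0,T] × ℝ^d`,
polynomial in `x` with degree bounded in `t`, `a_{α,0}` does not depend on `x`, and `𝓐₀` is
uniformly elliptic. -/
structure IsPolynomialExpansion {d : ℕ} (a : Coeffs d) (T : ℝ) : Prop where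
  continuousOn_val : ∀ α ∈ multiIdx d, ∀ n : ℕ,
    ContinuousOn (fun p : ℝ × Rd d => a.val α n p.1 p.2) (Icc 0 T ×ˢ univ)
  degree_le : ∀ α ∈ multiIdx d, ∀ n : ℕ,
    ∃ k : ℕ, ∀ t ∈ Icc 0 T, (a α n t).totalDegree ≤ k
  zeroth_const : ∀ α ∈ multiIdx d, ∀ t ∈ Icc 0 T, ∃ c : ℝ, a α 0 t = MvPolynomial.C c
  elliptic : ∃ l : ℝ, 0 < l ∧ ∀ t ∈ Icc 0 T, ∀ ξ : Fin d → ℝ,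
    l * ∑ i, ξ i ^ 2 ≤ ∑ i, ∑ j, a.diffusion t i j * ξ i * ξ j

/-- `𝓐_n(t) f (x) = ∑_{|α| ≤ 2} a_{α,n}(t,x) D^α f(x)`. -/
def Coeffs.op {d : ℕ} (a : Coeffs d) (n : ℕ) (t : ℝ) (f : Rd d → ℝ) (x : Rd d) : ℝ :=
  ∑ α ∈ multiIdx d, a.val α n t x * D α f x

/-- Growth at most exponential. -/
def ExpGrowth {d : ℕ} (f : Rd d → ℝ) : Prop :=
  ∃ K κ : ℝ, ∀ x, |f x| ≤ K * Real.exp (κ * ‖x‖)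

/-- `v` is a classical (`C^{1,2}`) solution on `[0,T) × ℝ^d` of
`(∂_t + 𝓐₀) v = -g`, `v(T,·) = ψ`, with at most exponential growth in `x`, uniformly in `t`.
The time derivative at `t = 0` is the right derivative; its continuity follows from the equation
when `g` is continuous. The terminal datum, which need not be continuous, is attained as the limit
`t ↑ T` at almost every `x`. -/
structure IsSolution {d : ℕ} (a : Coeffs d) (T : ℝ) (g : ℝ → Rd d → ℝ) (ψ : Rd d → ℝ)
    (v : ℝ → Rd d → ℝ) : Prop where
  contDiff : ∀ t ∈ Ico 0 T, ContDiff ℝ 2 (v t)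
  continuousOn : ∀ α ∈ multiIdx d,
    ContinuousOn (fun p : ℝ × Rd d => D α (v p.1) p.2) (Ico 0 T ×ˢ univ)
  pde : ∀ t ∈ Ico 0 T, ∀ x,
    HasDerivWithinAt (fun s => v s x) (-g t x - a.op 0 t (v t) x) (Ico 0 T) t
  growth : ∃ K κ : ℝ, ∀ t ∈ Ico 0 T, ∀ x, |v t x| ≤ K * Real.exp (κ * ‖x‖)
  terminal : ∀ᵐ x, Tendsto (fun t => v t x) (𝓝[<] T) (𝓝 (ψ x))

/-- `(u_n)` are the terms of the formal expansion `u = ∑ u_n`: they solve the nested problems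
`(∂_t + 𝓐₀) u₀ = 0`, `u₀(T,·) = φ`, and, for `n ≥ 1`,
`(∂_t + 𝓐₀) u_n = -∑_{h=1}^n 𝓐_h u_{n-h}`, `u_n(T,·) = 0`. -/
def IsFormalExpansion {d : ℕ} (a : Coeffs d) (T : ℝ) (φ : Rd d → ℝ)
    (u : ℕ → ℝ → Rd d → ℝ) : Prop :=
  IsSolution a T (fun _ _ => 0) φ (u 0) ∧
  ∀ n : ℕ, 1 ≤ n →
    IsSolution a T (fun t x => ∑ h ∈ Finset.Icc 1 n, a.op h t (u (n - h) t) x) (fun _ => 0) (u n)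

/-- `𝐂(t,s) = ∫_t^s C(r) dr`. -/
def Coeffs.cov {d : ℕ} (a : Coeffs d) (t s : ℝ) : Matrix (Fin d) (Fin d) ℝ :=
  Matrix.of fun i j => ∫ r in t..s, a.diffusion r i j

/-- `𝐦(t,s) = ∫_t^s m(r) dr`. -/
def Coeffs.mean {d : ℕ} (a : Coeffs d) (t s : ℝ) (i : Fin d) : ℝ :=
  ∫ r in t..s, a.drift r i

/-- The Gaussian density `Γ₀(t,x;T,y)` in `y`, with mean `x + 𝐦(t,T)` and covariance `𝐂(t,T)`. -/
def Coeffs.gauss {d : ℕ} (a : Coeffs d) (t : ℝ) (x : Rd d) (T : ℝ) (y : Rd d) : ℝ :=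
  1 / Real.sqrt ((2 * Real.pi) ^ d * (a.cov t T).det) *
    Real.exp (-(1 / 2) * ∑ i, ∑ j, (a.cov t T)⁻¹ i j *
      (y i - x i - a.mean t T i) * (y j - x j - a.mean t T j))

/-- `u₀(t,x) = e^{∫_t^T γ(s) ds} ∫ Γ₀(t,x;T,y) φ(y) dy`. -/
def Coeffs.u₀ {d : ℕ} (a : Coeffs d) (T : ℝ) (φ : Rd d → ℝ) (t : ℝ) (x : Rd d) : ℝ :=
  Real.exp (∫ s in t..T, a.potential s) * ∫ y : Rd d, a.gauss t x T y * φ y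

/-- The components of `𝓜(t,s) = x + 𝐦(t,s) + 𝐂(t,s) ∇_x`. -/
def Coeffs.M {d : ℕ} (a : Coeffs d) (t s : ℝ) (i : Fin d) (f : Rd d → ℝ) : Rd d → ℝ :=
  fun x => (x i + a.mean t s i) * f x + ∑ j, a.cov t s i j * pd j f x

/-- `𝓖_n(t,s) = ∑_{|α| ≤ 2} a_{α,n}(s, 𝓜(t,s)) D^α`. -/
def Coeffs.G {d : ℕ} (a : Coeffs d) (n : ℕ) (t s : ℝ) (f : Rd d → ℝ) : Rd d → ℝ :=
  fun x => ∑ α ∈ multiIdx d, polyOp (a α n s) (a.M t s) (D α f) x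

/-- `I_{n,h}`: the `h`-tuples of positive integers with sum `n`. -/
def compositions (n h : ℕ) : Finset (Fin h → ℕ) :=
  (Finset.piAntidiag Finset.univ n).filter fun i => ∀ k, 1 ≤ i k

/-- `∫_s^T ds₁ ∫_{s₁}^T ds₂ ⋯ ∫_{s_{h-1}}^T ds_h F(s₁, …, s_h)`. -/
def iterInt (T : ℝ) : (h : ℕ) → ℝ → ((Fin h → ℝ) → ℝ) → ℝ
  | 0, _, F => F Fin.elim0
  | h + 1, s, F => ∫ r in s..T, iterInt T h r fun v => F (Fin.cons r v)

/-- `𝓖_{i₁}(t,s₁) ⋯ 𝓖_{i_h}(t,s_h) f` (the rightmost operator acts first). -/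
def Coeffs.prodG {d : ℕ} (a : Coeffs d) (t : ℝ) {h : ℕ} (i : Fin h → ℕ) (s : Fin h → ℝ)
    (f : Rd d → ℝ) : Rd d → ℝ :=
  (List.finRange h).foldr (fun k g => a.G (i k) t (s k) g) f

/-- `𝓛_n(t,T) f (x) = ∑_{h=1}^n ∫_t^T ds₁ ⋯ ∫_{s_{h-1}}^T ds_h
∑_{i ∈ I_{n,h}} 𝓖_{i₁}(t,s₁) ⋯ 𝓖_{i_h}(t,s_h) f (x)`. -/
def Coeffs.L {d : ℕ} (a : Coeffs d) (n : ℕ) (t T : ℝ) (f : Rd d → ℝ) (x : Rd d) : ℝ :=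
  ∑ h ∈ Finset.Icc 1 n, iterInt T h t fun s =>
    ∑ i ∈ compositions n h, a.prodG t i s f x

end GaussianExpansion

end

open GaussianExpansion

/-! # Solution of the nested Cauchy problems of a polynomial expansion

The theorem has two halves: the functions given by the formula solve the nested problems, and each
of these problems has at most one solution of exponential growth. Only times in `[0,T]` matter, so
the coefficients are first frozen outside `[0,T]` (`Coeffs.regular_clamp`), after which `𝓐₀` is a
uniformly parabolic operator on the whole line with bounded coefficients (`HeatData`).

**The Gaussian solution.** `u₀` is the integral of `φ` against a Gaussian kernel. A derivative
`∂^L` of this kernel is a kernel of order `|L|` (`Kern`), and therefore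
`∂^L u₀ = O((T-t)^{-|L|/2})` with the exponential growth of `φ` in `x` (`growth_pdL_sol`). Since `φ`
is only measurable, its terminal value is attained at the Lebesgue points of `φ`; at these points
one also has `(T-t)^{|L|/2} ∂^L u₀ → 0` for `L ≠ []`, because `∂^L Γ₀` has mean zero
(`tendsto_pdL_sol`).

**The higher terms.** The operators `x_i + 𝐦_i(t,r) + ∑_j 𝐂_{ij}(t,r) ∂_j` commute with `∂_t + 𝓐₀`
(`Solves.shift`), and so do the `∂_i`. Hence, for fixed `r`, the operator `𝓖_k(t,r)` maps solutions
of the homogeneous equation to solutions (`Rep.G`). The part of the `n`-th term with `h + 1`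
integrals is `∫_r^T ∑_k 𝓖_k(t,s) (part with h integrals, starting at s) ds` at `r = t`
(`part_succ`). Differentiating along `r = t`, the integrand contributes only through `𝓐₀`, while
the lower limit gives the boundary term `-𝓖_k(t,t) = -𝓐_k` applied to the preceding terms; this is
the equation for the `n`-th term (`hasDerivAt_expansion`).

Growth and terminal values are a matter of counting: in every summand of the `n`-th term, `∂^L u₀`
comes with a coefficient of size `(T-t)^e` with `e ≥ 1` and `|L| ≤ 2e`, since every `𝐂_{ij}` pays
for the one derivative that accompanies it, and every integration pays for the two derivatives
`D^α` of the operator under it (`Rep`). So the terms are bounded in `t` and vanish as `t ↑ T` at the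
Lebesgue points of `φ`.

**Uniqueness.** The difference `v` of two solutions of one of the problems solves the homogeneous
problem with terminal value `0`. For a continuous `ρ` with compact support, the solution `w` of the
adjoint forward equation with `w(t₀) = ρ` is again a Gaussian integral, and it decays faster than
any exponential. Therefore `∫ v(s) w(s)` does not depend on `s` (`integral_mul_dual_const`), tends to
`0` as `s ↑ T` and to `∫ v(t₀) ρ` as `s ↓ t₀`, so that `v(t₀) = 0` (`eq_zero`).
-/

open scoped ContDiff

namespace GaussianExpansion

variable {d : ℕ}

/-! ### Partial derivatives -/

/-- The iterated partial derivative `∂_{i₁} ⋯ ∂_{i_b} f` along a list `[i₁, …, i_b]`. -/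
noncomputable def pdL (L : List (Fin d)) (f : Rd d → ℝ) : Rd d → ℝ := L.foldr pd f

@[simp] lemma pdL_nil (f : Rd d → ℝ) : pdL [] f = f := rfl

@[simp] lemma pdL_cons (i : Fin d) (L : List (Fin d)) (f : Rd d → ℝ) :
    pdL (i :: L) f = pd i (pdL L f) := rfl

lemma pdL_append (L L' : List (Fin d)) (f : Rd d → ℝ) :
    pdL (L ++ L') f = pdL L (pdL L' f) := by
  simp [pdL]

lemma pd_iterate (i : Fin d) (n : ℕ) (f : Rd d → ℝ) :
    (pd i)^[n] f = pdL (List.replicate n i) f := by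
  induction n with
  | zero => rfl
  | succ n ih => rw [Function.iterate_succ_apply', ih, List.replicate_succ, pdL_cons]

/-- `D α` differentiates along some list of directions in which `i` occurs `α i` times; only this,
and not the order of the list, matters for smooth functions. -/
lemma exists_list_D (α : Fin d → ℕ) :
    ∃ L : List (Fin d), (∀ i, L.count i = α i) ∧ ∀ f, D α f = pdL L f := by
  suffices h : ∀ l : List (Fin d), l.Nodup → ∃ L : List (Fin d),
      (∀ i, L.count i = if i ∈ l then α i else 0) ∧
        ∀ f, l.foldr (fun i g => (pd i)^[α i] g) f = pdL L f by
    obtain ⟨L, h1, h2⟩ := h _ (List.nodup_finRange d)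
    exact ⟨L, fun i => by simpa using h1 i, h2⟩
  intro l
  induction l with
  | nil => exact fun _ => ⟨[], by simp, fun f => rfl⟩
  | cons j l ih =>
    intro hl
    obtain ⟨L, h1, h2⟩ := ih (List.nodup_cons.1 hl).2
    have hj := (List.nodup_cons.1 hl).1
    refine ⟨List.replicate (α j) j ++ L, fun i => ?_, fun f => ?_⟩
    · rw [List.count_append, h1, List.count_replicate]
      by_cases hij : i = j
      · subst hij; simp [hj]
      · simp [hij, Ne.symm hij]
    · rw [List.foldr_cons, h2, pd_iterate, pdL_append]

lemma list_length_eq {L : List (Fin d)} {α : Fin d → ℕ} (h : ∀ i, L.count i = α i) :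
    L.length = ∑ i, α i := by
  rw [← Finset.sum_congr rfl fun i _ => h i]
  have := Multiset.sum_count_eq_card (s := Finset.univ) (m := (L : Multiset (Fin d)))
    fun a _ => Finset.mem_univ a
  simpa using this.symm

lemma contDiff_pd {f : Rd d → ℝ} {n m : WithTop ℕ∞} (hf : ContDiff ℝ n f) (hm : m + 1 ≤ n)
    (i : Fin d) : ContDiff ℝ m (pd i f) :=
  (hf.fderiv_right hm).clm_apply contDiff_const

lemma _root_.ContDiff.pd_smooth {f : Rd d → ℝ} (hf : ContDiff ℝ ∞ f) (i : Fin d) :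
    ContDiff ℝ ∞ (pd i f) :=
  contDiff_pd hf (by simp) i

lemma _root_.ContDiff.pdL_smooth {f : Rd d → ℝ} (hf : ContDiff ℝ ∞ f) (L : List (Fin d)) :
    ContDiff ℝ ∞ (pdL L f) := by
  induction L with
  | nil => exact hf
  | cons i L ih => exact ContDiff.pd_smooth ih i

lemma smooth_differentiable {f : Rd d → ℝ} (hf : ContDiff ℝ ∞ f) : Differentiable ℝ f :=
  hf.differentiable (by simp)

lemma pd_add {f g : Rd d → ℝ} (hf : Differentiable ℝ f) (hg : Differentiable ℝ g) (i : Fin d) :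
    pd i (fun x => f x + g x) = fun x => pd i f x + pd i g x := by
  ext x; simp only [pd]; rw [fderiv_fun_add (hf x) (hg x)]; rfl

lemma pd_sub {f g : Rd d → ℝ} (hf : Differentiable ℝ f) (hg : Differentiable ℝ g) (i : Fin d) :
    pd i (fun x => f x - g x) = fun x => pd i f x - pd i g x := by
  ext x; simp only [pd]; rw [fderiv_fun_sub (hf x) (hg x)]; rfl

lemma pd_const (c : ℝ) (i : Fin d) : pd i (fun _ : Rd d => c) = fun _ => 0 := by
  ext x; simp [pd]

lemma pd_const_mul {f : Rd d → ℝ} (c : ℝ) (i : Fin d) :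
    pd i (fun x => c * f x) = fun x => c * pd i f x := by
  ext x; simp only [pd]
  have := congrFun (fderiv_const_smul_field (𝕜 := ℝ) (f := f) c) x
  simp only [Pi.smul_def, smul_eq_mul] at this
  rw [this]; rfl

lemma pd_mul {f g : Rd d → ℝ} (hf : Differentiable ℝ f) (hg : Differentiable ℝ g) (i : Fin d) :
    pd i (fun x => f x * g x) = fun x => pd i f x * g x + f x * pd i g x := by
  ext x; simp only [pd]; rw [fderiv_fun_mul (hf x) (hg x)]
  simp; ring

lemma pd_sum {ι : Type*} (s : Finset ι) {f : ι → Rd d → ℝ}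
    (hf : ∀ j ∈ s, Differentiable ℝ (f j)) (i : Fin d) :
    pd i (fun x => ∑ j ∈ s, f j x) = fun x => ∑ j ∈ s, pd i (f j) x := by
  ext x; simp only [pd]; rw [fderiv_fun_sum fun j hj => hf j hj x]; simp

lemma pd_coord (i j : Fin d) : pd i (fun x : Rd d => x j) = fun _ => if i = j then 1 else 0 := by
  ext x
  have : (fun x : Rd d => x j) = EuclideanSpace.proj (𝕜 := ℝ) j := rfl
  simp only [pd, this, ContinuousLinearMap.fderiv]
  simp [eq_comm]

lemma contDiff_coord (j : Fin d) : ContDiff ℝ ∞ (fun x : Rd d => x j) :=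
  (EuclideanSpace.proj (𝕜 := ℝ) j).contDiff

lemma pd_coord_mul {f : Rd d → ℝ} (hf : Differentiable ℝ f) (i j : Fin d) :
    pd i (fun x => x j * f x) = fun x => (if i = j then 1 else 0) * f x + x j * pd i f x := by
  rw [pd_mul (smooth_differentiable (contDiff_coord j)) hf, pd_coord]

lemma fderiv_eq_sum_pd (f : Rd d → ℝ) (x v : Rd d) :
    fderiv ℝ f x v = ∑ i, v i * pd i f x := by
  have hv : v = ∑ i, v i • EuclideanSpace.single i (1 : ℝ) := by
    ext j; simp [Finset.sum_apply, Pi.single_apply]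
  conv_lhs => rw [hv]
  simp [pd]

lemma pd_comm {f : Rd d → ℝ} (hf : ContDiff ℝ 2 f) (i j : Fin d) :
    pd i (pd j f) = pd j (pd i f) := by
  ext x
  have hd : DifferentiableAt ℝ (fderiv ℝ f) x :=
    (hf.fderiv_right (m := 1) (by norm_num)).differentiable (by norm_num) x
  have key : ∀ i j : Fin d, pd i (pd j f) x =
      fderiv ℝ (fderiv ℝ f) x (EuclideanSpace.single i 1) (EuclideanSpace.single j 1) := by
    intro i j
    have h1 : pd j f = fun y => fderiv ℝ f y (EuclideanSpace.single j 1) := rfl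
    rw [h1]
    simp only [pd]
    rw [fderiv_clm_apply hd (differentiableAt_const _)]
    simp
  rw [key, key]
  exact (hf.contDiffAt.isSymmSndFDerivAt (by simp)) _ _

/-- A family of differentiable functions that is stable under partial derivatives consists of
smooth functions. -/
lemma contDiff_of_pd_stable (F : Set (Rd d → ℝ)) (hd : ∀ f ∈ F, Differentiable ℝ f)
    (hpd : ∀ f ∈ F, ∀ i, pd i f ∈ F) : ∀ f ∈ F, ContDiff ℝ ∞ f := by
  have key : ∀ n : ℕ, ∀ f ∈ F, ContDiff ℝ n f := by
    intro n
    induction n with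
    | zero => exact fun f hf => by simpa using (hd f hf).continuous
    | succ n ih =>
      intro f hf
      have h : ContDiff ℝ ((n : WithTop ℕ∞) + 1) f := by
        rw [contDiff_succ_iff_fderiv]
        refine ⟨hd f hf, by simp, ?_⟩
        rw [contDiff_clm_apply_iff]
        intro v
        simp_rw [fderiv_eq_sum_pd]
        exact ContDiff.sum fun i _ => contDiff_const.mul (ih _ (hpd f hf i))
      exact_mod_cast h
  intro f hf
  exact contDiff_infty.2 fun n => key n f hf

/-! ### The operators of order at most two -/

lemma D_zero (f : Rd d → ℝ) : D 0 f = f := by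
  obtain ⟨L, h1, h2⟩ := exists_list_D (0 : Fin d → ℕ)
  have : L = [] := List.eq_nil_of_length_eq_zero (by simp [list_length_eq h1])
  rw [h2, this, pdL_nil]

lemma D_single (i : Fin d) (f : Rd d → ℝ) : D (Pi.single i 1) f = pd i f := by
  obtain ⟨L, h1, h2⟩ := exists_list_D (Pi.single i 1 : Fin d → ℕ)
  have : L.Perm [i] := by
    rw [List.perm_iff_count]; intro k
    rw [h1, List.count_singleton, Pi.single_apply]
    by_cases h : k = i <;> simp [h, Ne.symm]
  rw [h2, List.perm_singleton.1 this]; rfl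

lemma count_pair (i j k : Fin d) :
    [i, j].count k = (Pi.single i 1 + Pi.single j 1 : Fin d → ℕ) k := by
  simp only [List.count_cons, List.count_nil, Pi.add_apply, Pi.single_apply, beq_iff_eq, zero_add]
  rw [add_comm, if_congr (eq_comm (a := i)) rfl rfl, if_congr (eq_comm (a := j)) rfl rfl]

lemma D_pair {f : Rd d → ℝ} (hf : ContDiff ℝ 2 f) (i j : Fin d) :
    D (Pi.single i 1 + Pi.single j 1) f = pd i (pd j f) := by
  obtain ⟨L, h1, h2⟩ := exists_list_D (Pi.single i 1 + Pi.single j 1 : Fin d → ℕ)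
  have hp : L.Perm [i, j] := by
    rw [List.perm_iff_count]; intro k
    rw [h1, count_pair]
  rw [h2]
  rcases List.perm_pair.1 hp with h | h
  · rw [h]; rfl
  · rw [h]; exact pd_comm hf j i

lemma single_pair_eq_iff (i j k l : Fin d) :
    (Pi.single i 1 + Pi.single j 1 : Fin d → ℕ) = Pi.single k 1 + Pi.single l 1 ↔
      (i = k ∧ j = l) ∨ (i = l ∧ j = k) := by
  have : (Pi.single i 1 + Pi.single j 1 : Fin d → ℕ) = Pi.single k 1 + Pi.single l 1 ↔
      [i, j].Perm [k, l] := by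
    rw [List.perm_iff_count, funext_iff]
    exact forall_congr' fun x => by rw [count_pair, count_pair]
  rw [this, List.perm_pair]
  simp

lemma sum_single (i : Fin d) : ∑ k, (Pi.single i 1 : Fin d → ℕ) k = 1 := by
  simp

lemma exists_single_of_sum_eq_succ {α : Fin d → ℕ} {n : ℕ} (h : ∑ i, α i = n + 1) :
    ∃ (i : Fin d) (β : Fin d → ℕ), ∑ i, β i = n ∧ α = Pi.single i 1 + β := by
  obtain ⟨i, -, hi⟩ := Finset.exists_ne_zero_of_sum_ne_zero
    (s := Finset.univ) (f := α) (by omega)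
  have hle : Pi.single i 1 ≤ α := by
    intro j; by_cases hj : j = i
    · subst hj; simp; omega
    · simp [hj]
  refine ⟨i, α - Pi.single i 1, ?_, (add_tsub_cancel_of_le hle).symm⟩
  have h2 : ∑ k, α k = ∑ k, ((Pi.single i 1 : Fin d → ℕ) k + (α - Pi.single i 1 : Fin d → ℕ) k) :=
    Finset.sum_congr rfl fun k _ => congrFun (add_tsub_cancel_of_le hle).symm k
  rw [Finset.sum_add_distrib, sum_single, h] at h2
  omega

lemma mem_multiIdx {α : Fin d → ℕ} : α ∈ multiIdx d ↔ ∑ i, α i ≤ 2 := by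
  simp only [multiIdx, Finset.mem_filter, Fintype.mem_piFinset, Finset.mem_range, and_iff_right_iff_imp]
  intro h i
  have := Finset.single_le_sum (f := α) (fun i _ => Nat.zero_le _) (Finset.mem_univ i)
  omega

lemma sum_single_pair (i j : Fin d) :
    ∑ k, (Pi.single i 1 + Pi.single j 1 : Fin d → ℕ) k = 2 := by
  simp [Finset.sum_add_distrib]

lemma multiIdx_cases {α : Fin d → ℕ} (h : α ∈ multiIdx d) :
    α = 0 ∨ (∃ i, α = Pi.single i 1) ∨ ∃ i j, α = Pi.single i 1 + Pi.single j 1 := by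
  rw [mem_multiIdx] at h
  have h0 : ∀ {β : Fin d → ℕ}, ∑ i, β i = 0 → β = 0 := fun {β} hβ => by
    ext i; exact Finset.sum_eq_zero_iff.1 hβ i (Finset.mem_univ i)
  interval_cases hs : ∑ i, α i
  · exact Or.inl (h0 hs)
  · obtain ⟨i, β, hβ, rfl⟩ := exists_single_of_sum_eq_succ hs
    rw [h0 hβ]; exact Or.inr (Or.inl ⟨i, by simp⟩)
  · obtain ⟨i, β, hβ, rfl⟩ := exists_single_of_sum_eq_succ hs
    obtain ⟨j, β', hβ', rfl⟩ := exists_single_of_sum_eq_succ hβ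
    rw [h0 hβ']; exact Or.inr (Or.inr ⟨i, j, by simp⟩)

/-- Every unordered pair of indices occurs twice among the ordered pairs, except for the diagonal
ones; this is what the weight `if i = j then 2 else 1` compensates. -/
lemma sum_multiIdx (F : (Fin d → ℕ) → ℝ) :
    ∑ α ∈ multiIdx d, F α = F 0 + ∑ i, F (Pi.single i 1) +
      1 / 2 * ∑ i, ∑ j, (if i = j then 2 else 1) * F (Pi.single i 1 + Pi.single j 1) := by
  classical
  have h1 : ∑ i : Fin d, F (Pi.single i 1) =
      ∑ α ∈ multiIdx d, ∑ i, if α = Pi.single i 1 then F α else 0 := by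
    rw [Finset.sum_comm]
    refine Finset.sum_congr rfl fun i _ => ?_
    rw [Finset.sum_ite_eq', if_pos (mem_multiIdx.2 (by rw [sum_single]; norm_num))]
  have h2 : ∑ i : Fin d, ∑ j, (if i = j then (2:ℝ) else 1) * F (Pi.single i 1 + Pi.single j 1) =
      ∑ α ∈ multiIdx d, ∑ i, ∑ j,
        if α = Pi.single i 1 + Pi.single j 1 then (if i = j then 2 else 1) * F α else 0 := by
    conv_rhs => rw [Finset.sum_comm]
    refine Finset.sum_congr rfl fun i _ => ?_
    conv_rhs => rw [Finset.sum_comm]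
    refine Finset.sum_congr rfl fun j _ => ?_
    rw [Finset.sum_ite_eq', if_pos (mem_multiIdx.2 (by rw [sum_single_pair]))]
  have h0 : F 0 = ∑ α ∈ multiIdx d, if α = (0 : Fin d → ℕ) then F α else 0 := by
    rw [Finset.sum_ite_eq', if_pos (mem_multiIdx.2 (by simp))]
  rw [h0, h1, h2, Finset.mul_sum, ← Finset.sum_add_distrib, ← Finset.sum_add_distrib]
  refine Finset.sum_congr rfl fun α hα => ?_
  have ne1 : ∀ i : Fin d, (0 : Fin d → ℕ) ≠ Pi.single i 1 := fun i h => by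
    have := congrFun h i; simp at this
  have ne2 : ∀ i j : Fin d, (0 : Fin d → ℕ) ≠ Pi.single i 1 + Pi.single j 1 := fun i j h => by
    have := congrFun h i
    simp only [Pi.zero_apply, Pi.add_apply, Pi.single_eq_same] at this
    omega
  have ne3 : ∀ i j k : Fin d, (Pi.single k 1 : Fin d → ℕ) ≠ Pi.single i 1 + Pi.single j 1 :=
    fun i j k h => by
      have := congrArg (fun β : Fin d → ℕ => ∑ x : Fin d, β x) h
      simp only [sum_single, sum_single_pair] at this
      omega
  rcases multiIdx_cases hα with rfl | ⟨k, rfl⟩ | ⟨k, l, rfl⟩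
  · simp [ne1, ne2]
  · have : ∀ i : Fin d, ((Pi.single k 1 : Fin d → ℕ) = Pi.single i 1) ↔ k = i := fun i => by
      constructor
      · intro h; by_contra hne
        have := congrFun h k; simp [hne] at this
      · rintro rfl; rfl
    simp [(ne1 _).symm, ne3, this]
  · simp only [(ne2 _ _).symm, (ne3 _ _ _).symm, if_false, Finset.sum_const_zero, zero_add,
      single_pair_eq_iff]
    by_cases hkl : k = l
    · subst hkl
      have : ∀ i j : Fin d, (if k = i ∧ k = j ∨ k = j ∧ k = i then
          (if i = j then (2:ℝ) else 1) * F (Pi.single k 1 + Pi.single k 1) else 0) =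
          if k = i then if k = j then 2 * F (Pi.single k 1 + Pi.single k 1) else 0 else 0 := by
        intro i j; grind
      simp_rw [this]
      simp
    · have : ∀ i j : Fin d, (if k = i ∧ l = j ∨ k = j ∧ l = i then
          (if i = j then (2:ℝ) else 1) * F (Pi.single k 1 + Pi.single l 1) else 0) =
          (if k = i then if l = j then F (Pi.single k 1 + Pi.single l 1) else 0 else 0) +
          (if l = i then if k = j then F (Pi.single k 1 + Pi.single l 1) else 0 else 0) := by
        intro i j; grind
      simp_rw [this, Finset.sum_add_distrib]
      simp; ring

/-! ### Positive definite matrices and their Gaussian integrals -/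

section Matrix

open Matrix
open scoped MatrixOrder

/-- The quadratic form `ξ ↦ ξᵀ S ξ`. -/
def qform (S : Matrix (Fin d) (Fin d) ℝ) (ξ : Fin d → ℝ) : ℝ := ∑ i, ∑ j, S i j * ξ i * ξ j

lemma qform_eq_dotProduct (S : Matrix (Fin d) (Fin d) ℝ) (ξ : Fin d → ℝ) :
    qform S ξ = ξ ⬝ᵥ S *ᵥ ξ := by
  simp only [qform, dotProduct, mulVec, Finset.mul_sum]
  exact Finset.sum_congr rfl fun i _ => Finset.sum_congr rfl fun j _ => by ring

lemma qform_sub_smul {S : Matrix (Fin d) (Fin d) ℝ} (hS : S.IsSymm) (z q : Fin d → ℝ) (c : ℝ) :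
    qform S (z - c • q) = qform S z - 2 * c * (q ⬝ᵥ S *ᵥ z) + c ^ 2 * qform S q := by
  have h : z ⬝ᵥ S *ᵥ q = q ⬝ᵥ S *ᵥ z := by
    rw [dotProduct_mulVec, ← mulVec_transpose, hS.eq, dotProduct_comm]
  simp only [qform_eq_dotProduct, mulVec_sub, mulVec_smul, dotProduct_sub, sub_dotProduct,
    smul_dotProduct, dotProduct_smul, smul_eq_mul, h]
  ring

/-- The symmetric matrix `S` has its spectrum in `[l, b]`, where `0 < l`. -/
structure SpectralBounds (S : Matrix (Fin d) (Fin d) ℝ) (l b : ℝ) : Prop where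
  symm : S.IsSymm
  l_pos : 0 < l
  b_pos : 0 < b
  lower : ∀ ξ, l * ∑ i, ξ i ^ 2 ≤ qform S ξ
  upper : ∀ ξ, qform S ξ ≤ b * ∑ i, ξ i ^ 2

variable {S : Matrix (Fin d) (Fin d) ℝ} {l b : ℝ}

lemma sum_sq_eq_dotProduct (ξ : Fin d → ℝ) : ∑ i, ξ i ^ 2 = ξ ⬝ᵥ ξ := by
  simp [dotProduct, sq]

lemma SpectralBounds.posDef (h : SpectralBounds S l b) : S.PosDef := by
  refine Matrix.PosDef.of_dotProduct_mulVec_pos (by simpa [IsHermitian, IsSymm] using h.symm) ?_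
  intro ξ hξ
  have h1 := h.lower ξ
  rw [qform_eq_dotProduct] at h1
  refine lt_of_lt_of_le (mul_pos h.l_pos ?_) h1
  obtain ⟨i, hi⟩ := Function.ne_iff.1 hξ
  exact Finset.sum_pos' (fun i _ => sq_nonneg _) ⟨i, Finset.mem_univ i, by
    have : ξ i ≠ 0 := hi
    positivity⟩

lemma SpectralBounds.det_pos (h : SpectralBounds S l b) : 0 < S.det := h.posDef.det_pos

lemma SpectralBounds.isUnit_det (h : SpectralBounds S l b) : IsUnit S.det :=
  isUnit_iff_ne_zero.2 h.det_pos.ne'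

lemma SpectralBounds.mulVec_inv (h : SpectralBounds S l b) (q : Fin d → ℝ) :
    S *ᵥ (S⁻¹ *ᵥ q) = q := by
  rw [mulVec_mulVec, mul_nonsing_inv _ h.isUnit_det, one_mulVec]

lemma SpectralBounds.qform_inv (h : SpectralBounds S l b) (q : Fin d → ℝ) :
    qform S⁻¹ q = qform S (S⁻¹ *ᵥ q) := by
  rw [qform_eq_dotProduct, qform_eq_dotProduct, h.mulVec_inv, dotProduct_comm]

/-- With `z = S⁻¹ e_j` one has `l |z|² ≤ zᵀ S z = z_j`, which bounds `z_j` and then all of `z`. -/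
lemma SpectralBounds.abs_inv_le (h : SpectralBounds S l b) (i j : Fin d) :
    |S⁻¹ i j| ≤ 1 / l := by
  have hl := h.l_pos
  set z : Fin d → ℝ := S⁻¹ *ᵥ Pi.single j 1 with hz
  have hzi : ∀ i, z i = S⁻¹ i j := fun i => by simp [hz]
  have h1 : l * ∑ k, z k ^ 2 ≤ z j := by
    refine (h.lower z).trans (le_of_eq ?_)
    rw [qform_eq_dotProduct, hz, h.mulVec_inv]
    simp
  have h2 : ∀ k, l * z k ^ 2 ≤ z j := fun k => le_trans (mul_le_mul_of_nonneg_left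
    (Finset.single_le_sum (f := fun k => z k ^ 2) (fun i _ => sq_nonneg _) (Finset.mem_univ k))
    hl.le) h1
  have h3 : z j ≤ 1 / l := by
    rw [le_div_iff₀ hl]
    by_contra! hc
    have := h2 j
    nlinarith [sq_nonneg (z j)]
  rw [← hzi, ← abs_of_pos (one_div_pos.2 hl)]
  refine sq_le_sq.1 ?_
  have := (h2 i).trans h3
  rw [le_div_iff₀ hl] at this
  rw [div_pow, le_div_iff₀ (by positivity)]
  nlinarith

/-- Obtained from `0 ≤ qform S (S⁻¹ q - b⁻¹ q)`. -/
lemma SpectralBounds.le_qform_inv (h : SpectralBounds S l b) (q : Fin d → ℝ) :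
    1 / b * ∑ i, q i ^ 2 ≤ qform S⁻¹ q := by
  have hb := h.b_pos
  set z := S⁻¹ *ᵥ q with hz
  have h1 := qform_sub_smul h.symm z q (1 / b)
  have h0 : 0 ≤ qform S (z - (1 / b) • q) :=
    le_trans (mul_nonneg h.l_pos.le (Finset.sum_nonneg fun i _ => sq_nonneg _)) (h.lower _)
  have h2 := mul_le_mul_of_nonneg_left (h.upper q) (by positivity : 0 ≤ (1 / b) ^ 2)
  rw [h.qform_inv, ← hz]
  have h3 : q ⬝ᵥ S *ᵥ z = ∑ i, q i ^ 2 := by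
    rw [hz, h.mulVec_inv, sum_sq_eq_dotProduct]
  rw [h1, h3] at h0
  have h4 : (1 / b) ^ 2 * (b * ∑ i, q i ^ 2) = 1 / b * ∑ i, q i ^ 2 := by field_simp
  linarith

lemma SpectralBounds.qform_inv_le (h : SpectralBounds S l b) (q : Fin d → ℝ) :
    qform S⁻¹ q ≤ 1 / l * ∑ i, q i ^ 2 := by
  have hl := h.l_pos
  set z := S⁻¹ *ᵥ q with hz
  have h1 := h.lower z
  have h2 : qform S z = z ⬝ᵥ q := by rw [qform_eq_dotProduct, hz, h.mulVec_inv]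
  have h3 : 0 ≤ ∑ i, (l * z i - q i) ^ 2 := Finset.sum_nonneg fun i _ => sq_nonneg _
  have h4 : ∑ i, (l * z i - q i) ^ 2 = l ^ 2 * ∑ i, z i ^ 2 - 2 * l * (z ⬝ᵥ q) + ∑ i, q i ^ 2 := by
    simp only [dotProduct, Finset.mul_sum, ← Finset.sum_sub_distrib, ← Finset.sum_add_distrib]
    exact Finset.sum_congr rfl fun i _ => by ring
  rw [h.qform_inv, ← hz, h2, one_div, ← div_eq_inv_mul, le_div_iff₀ hl]
  rw [h2] at h1
  nlinarith

lemma integral_exp_neg_mul_sum_sq {c : ℝ} (hc : 0 < c) :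
    ∫ q : Rd d, Real.exp (-c * ∑ i, q i ^ 2) = √(Real.pi / c) ^ d := by
  have h := GaussianFourier.integral_rexp_neg_mul_sq_norm (V := Rd d) hc
  simp only [EuclideanSpace.real_norm_sq_eq, finrank_euclideanSpace, Fintype.card_fin] at h
  rw [h, Real.sqrt_eq_rpow, ← Real.rpow_natCast, ← Real.rpow_mul (by positivity)]
  congr 1; ring

lemma integrable_exp_neg_mul_sum_sq {c : ℝ} (hc : 0 < c) :
    Integrable fun q : Rd d => Real.exp (-c * ∑ i, q i ^ 2) := by
  by_contra h
  have := integral_undef h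
  rw [integral_exp_neg_mul_sum_sq hc] at this
  have h2 : 0 < √(Real.pi / c) ^ d := by positivity
  exact h2.ne' this

/-- Writing `S⁻¹ = Bᵀ B`, the substitution `q ↦ B q` reduces the integral to a standard one. -/
lemma integral_exp_neg_qform_inv (h : SpectralBounds S l b) :
    ∫ q : Rd d, Real.exp (-(1 / 2) * qform S⁻¹ q) = √((2 * Real.pi) ^ d * S.det) := by
  obtain ⟨B, hB⟩ := CStarAlgebra.nonneg_iff_eq_star_mul_self.1 h.posDef.inv.posSemidef.nonneg
  have hB' : S⁻¹ = Bᵀ * B := by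
    rw [hB, star_eq_conjTranspose, conjTranspose_eq_transpose_of_trivial]
  have hdet : S.det = (B.det ^ 2)⁻¹ := by
    have := congrArg Matrix.det hB'
    rw [det_nonsing_inv, det_mul, det_transpose, Ring.inverse_eq_inv'] at this
    rw [sq, ← this, inv_inv]
  have hB0 : B.det ≠ 0 := by
    intro h0; have := h.det_pos; rw [hdet, h0] at this; simp at this
  have hq : ∀ q : Rd d, qform S⁻¹ q = ∑ i, (toEuclideanLin B q) i ^ 2 := by
    intro q
    rw [qform_eq_dotProduct, hB', ← mulVec_mulVec, dotProduct_mulVec, vecMul_transpose,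
      sum_sq_eq_dotProduct]
    rfl
  have hLdet : LinearMap.det (toEuclideanLin B) = B.det := by
    change LinearMap.det (toLpLin 2 2 B) = _
    rw [toLpLin_eq_toLin, LinearMap.det_toLin]
  have hmap := Measure.map_linearMap_addHaar_eq_smul_addHaar (volume : Measure (Rd d))
    (f := toEuclideanLin B) (by rw [hLdet]; exact hB0)
  have hcont : Continuous (toEuclideanLin B) := LinearMap.continuous_of_finiteDimensional _
  have h1 : ∫ q : Rd d, Real.exp (-(1 / 2) * ∑ i, (toEuclideanLin B q) i ^ 2) =
      ∫ q, Real.exp (-(1 / 2) * ∑ i, q i ^ 2) ∂(Measure.map (toEuclideanLin B) volume) := by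
    rw [integral_map hcont.measurable.aemeasurable]
    exact (by fun_prop : Continuous fun q : Rd d =>
      Real.exp (-(1 / 2) * ∑ i, q i ^ 2)).aestronglyMeasurable
  simp_rw [hq]
  rw [h1, hmap, integral_smul_measure, integral_exp_neg_mul_sum_sq (by norm_num), hLdet, hdet,
    Real.sqrt_mul (by positivity), Real.sqrt_inv, Real.sqrt_sq_eq_abs, smul_eq_mul, abs_inv,
    ENNReal.toReal_ofReal (by positivity), mul_comm]
  congr 1
  rw [eq_comm, Real.sqrt_eq_iff_mul_self_eq (by positivity) (by positivity), ← mul_pow,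
    Real.mul_self_sqrt (by positivity)]
  congr 1; field_simp

/-- A lower bound for the determinant without eigenvalues: the right-hand side is the integral of
`exp (-qform S⁻¹ q / 2)`, and `qform S⁻¹ q ≤ |q|² / l`. -/
lemma SpectralBounds.le_sqrt_det (h : SpectralBounds S l b) :
    √l ^ d ≤ √((2 * Real.pi) ^ d * S.det) := by
  have hl := h.l_pos
  rw [← integral_exp_neg_qform_inv h]
  have h1 : √l ^ d ≤ ∫ q : Rd d, Real.exp (-(1 / (2 * l)) * ∑ i, q i ^ 2) := by
    rw [integral_exp_neg_mul_sum_sq (by positivity)]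
    gcongr
    rw [div_div_eq_mul_div, div_one]
    nlinarith [Real.pi_gt_three]
  refine h1.trans (integral_mono_of_nonneg (Eventually.of_forall fun q => (Real.exp_pos _).le) ?_ ?_)
  · refine (integrable_exp_neg_mul_sum_sq (d := d) (c := 1 / (2 * b))
      (by have := h.b_pos; positivity)).mono' ?_ ?_
    · exact (by unfold qform; fun_prop : Continuous fun q : Rd d =>
        Real.exp (-(1 / 2) * qform S⁻¹ q)).aestronglyMeasurable
    · refine Eventually.of_forall fun q => ?_
      rw [Real.norm_eq_abs, Real.abs_exp, Real.exp_le_exp]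
      have := h.le_qform_inv q
      have e : 1 / (2 * b) = 1 / 2 * (1 / b) := by field_simp
      rw [e]; nlinarith
  · refine Eventually.of_forall fun q => ?_
    simp only [Real.exp_le_exp]
    have := h.qform_inv_le q
    have e : 1 / (2 * l) = 1 / 2 * (1 / l) := by field_simp
    rw [e]; nlinarith

/-! ### Differentiating determinants and inverses -/

lemma differentiableAt_det {M : ℝ → Matrix (Fin d) (Fin d) ℝ} {t : ℝ}
    (hM : ∀ i j, DifferentiableAt ℝ (fun s => M s i j) t) :
    DifferentiableAt ℝ (fun s => (M s).det) t := by
  simp only [det_apply]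
  refine DifferentiableAt.fun_sum fun σ _ => DifferentiableAt.const_smul ?_ _
  exact DifferentiableAt.fun_finsetProd fun i _ => hM _ _

/-- Jacobi's formula. By the chain rule the derivative depends only on `M t` and `M'`, so the path may
be replaced by `r ↦ M t (1 + r (M t)⁻¹ M')`, whose determinant is a polynomial in `r`. -/
lemma hasDerivAt_det {M : ℝ → Matrix (Fin d) (Fin d) ℝ} {M' : Matrix (Fin d) (Fin d) ℝ} {t : ℝ}
    (hM : ∀ i j, HasDerivAt (fun s => M s i j) (M' i j) t) (hu : IsUnit (M t).det) :
    HasDerivAt (fun s => (M s).det) ((M t).det * ((M t)⁻¹ * M').trace) t := by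
  -- matrices carry no global norm, so the chain rule is applied on `Fin d → Fin d → ℝ`
  have hdiff : Differentiable ℝ fun N : Fin d → Fin d → ℝ => (Matrix.of N).det := by
    simp only [det_apply]
    refine ContDiff.differentiable (n := 1) (ContDiff.sum fun σ _ => ContDiff.const_smul _ ?_)
      one_ne_zero
    refine contDiff_prod fun i _ => ?_
    simp only [Matrix.of_apply]
    fun_prop
  have key : ∀ {P : ℝ → Fin d → Fin d → ℝ} {s : ℝ}, P s = M t →
      (∀ i j, HasDerivAt (fun s => P s i j) (M' i j) s) →
      HasDerivAt (fun s => (Matrix.of (P s)).det)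
        (fderiv ℝ (fun N : Fin d → Fin d → ℝ => (Matrix.of N).det) (M t) M') s := by
    intro P s hs hP
    have h1 : HasDerivAt P M' s :=
      hasDerivAt_pi.2 fun i => hasDerivAt_pi.2 fun j => hP i j
    have h2 := (hdiff (P s)).hasFDerivAt.comp_hasDerivAt s h1
    rw [hs] at h2
    exact h2
  have h1 := key (P := fun s => M s) rfl hM
  have h2 := key (P := fun r => (M t) + r • M') (s := 0) (by simp; rfl) (fun i j => by
    have := ((hasDerivAt_id (0:ℝ)).mul_const (M' i j)).const_add (M t i j)
    simpa using! this)
  have h3 : ∀ r : ℝ, (Matrix.of (fun i => (M t + r • M') i)).det =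
      (M t).det * (det (1 + (Polynomial.X : Polynomial ℝ) •
        ((M t)⁻¹ * M').map Polynomial.C)).eval r := by
    intro r
    have e : (M t + r • M') = M t * (1 + r • ((M t)⁻¹ * M')) := by
      rw [mul_add, mul_one, mul_smul_comm, ← Matrix.mul_assoc, mul_nonsing_inv _ hu, one_mul]
    change (M t + r • M').det = _
    rw [e, det_mul, ← Polynomial.coe_evalRingHom, RingHom.map_det]
    congr 2
    ext i j
    by_cases hij : i = j <;>
    simp [hij, -Matrix.map_mul, mul_comm r]
  have h4 : HasDerivAt (fun r : ℝ => (M t).det * (det (1 + (Polynomial.X : Polynomial ℝ) •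
        ((M t)⁻¹ * M').map Polynomial.C)).eval r) ((M t).det * ((M t)⁻¹ * M').trace) 0 := by
    rw [← derivative_det_one_add_X_smul]
    exact (Polynomial.hasDerivAt _ _).const_mul _
  have h5 : HasDerivAt (fun r : ℝ => (Matrix.of (fun i => (M t + r • M') i)).det)
      ((M t).det * ((M t)⁻¹ * M').trace) 0 := by
    simp_rw [h3]; exact h4
  have h6 := h2.unique h5
  rw [← h6]
  exact h1

/-- Cramer's rule gives differentiability; the derivative then comes from `M⁻¹ M = 1`. -/
lemma hasDerivAt_inv {M : ℝ → Matrix (Fin d) (Fin d) ℝ} {M' : Matrix (Fin d) (Fin d) ℝ} {t : ℝ}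
    (hM : ∀ i j, HasDerivAt (fun s => M s i j) (M' i j) t)
    (hu : ∀ᶠ s in 𝓝 t, IsUnit (M s).det) (i j : Fin d) :
    HasDerivAt (fun s => (M s)⁻¹ i j) (-((M t)⁻¹ * M' * (M t)⁻¹) i j) t := by
  have hut := hu.self_of_nhds
  have hd : ∀ i j, DifferentiableAt ℝ (fun s => (M s)⁻¹ i j) t := by
    intro i j
    simp only [inv_def, Ring.inverse_eq_inv', Matrix.smul_apply, smul_eq_mul]
    refine DifferentiableAt.fun_mul ((differentiableAt_det fun i j =>
      (hM i j).differentiableAt).fun_inv hut.ne_zero) ?_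
    simp only [adjugate_apply]
    refine differentiableAt_det fun k l => ?_
    by_cases hk : k = j
    · subst hk; simp
    · simpa [updateRow_ne hk] using (hM k l).differentiableAt
  set A' : Matrix (Fin d) (Fin d) ℝ := Matrix.of fun i j => deriv (fun s => (M s)⁻¹ i j) t with hA'
  have h1 : A' * M t + (M t)⁻¹ * M' = 0 := by
    ext i k
    have h2 : HasDerivAt (fun s => ∑ j, (M s)⁻¹ i j * M s j k)
        (∑ j, (A' i j * M t j k + (M t)⁻¹ i j * M' j k)) t :=
      HasDerivAt.fun_sum fun j _ => (hd i j).hasDerivAt.mul (hM j k)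
    have h3 : (fun s => ∑ j, (M s)⁻¹ i j * M s j k) =ᶠ[𝓝 t]
        fun _ => (1 : Matrix (Fin d) (Fin d) ℝ) i k := by
      filter_upwards [hu] with s hs
      rw [← nonsing_inv_mul _ hs, mul_apply]
    have h4 := (h2.congr_of_eventuallyEq h3.symm).unique (hasDerivAt_const _ _)
    simpa [mul_apply, Finset.sum_add_distrib] using h4
  have h2 : A' = -((M t)⁻¹ * M' * (M t)⁻¹) := by
    have := congrArg (· * (M t)⁻¹) h1
    simp only [add_mul, zero_mul] at this
    rw [Matrix.mul_assoc A', mul_nonsing_inv _ hut, mul_one] at this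
    exact eq_neg_of_add_eq_zero_left this
  have := (hd i j).hasDerivAt
  have e : deriv (fun s => (M s)⁻¹ i j) t = A' i j := rfl
  rw [e, h2] at this
  exact this

end Matrix

/-! ### Homogeneous polynomials -/

/-- Homogeneous polynomial functions of degree `n` on `ℝ^d`. -/
inductive HomPoly : ℕ → (Rd d → ℝ) → Prop
  | const (c : ℝ) : HomPoly 0 fun _ => c
  | coord {n : ℕ} {p : Rd d → ℝ} (i : Fin d) : HomPoly n p → HomPoly (n + 1) fun x => x i * p x
  | add {n : ℕ} {p q : Rd d → ℝ} : HomPoly n p → HomPoly n q → HomPoly n fun x => p x + q x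
  | zero (n : ℕ) : HomPoly n fun _ => 0

namespace HomPoly

variable {n : ℕ} {p : Rd d → ℝ}

lemma const_mul (h : HomPoly n p) (c : ℝ) : HomPoly n fun x => c * p x := by
  induction h with
  | const a => exact const (c * a)
  | coord i _ ih => simpa only [mul_left_comm] using coord i ih
  | add _ _ ih ih' => simpa only [mul_add] using add ih ih'
  | zero n => simpa using zero n

lemma contDiff (h : HomPoly n p) : ContDiff ℝ ∞ p := by
  induction h with
  | const a => exact contDiff_const
  | coord i _ ih => exact (contDiff_coord i).mul ih
  | add _ _ ih ih' => exact ih.add ih'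
  | zero n => exact contDiff_const

/-- A derivative lowers the degree by one; in degree `0` it vanishes. -/
lemma pd (h : HomPoly n p) (i : Fin d) :
    (n = 0 ∧ pd i p = fun _ => 0) ∨ ∃ m, n = m + 1 ∧ HomPoly m (GaussianExpansion.pd i p) := by
  induction h with
  | const a => exact Or.inl ⟨rfl, pd_const a i⟩
  | @coord n p j h ih =>
    refine Or.inr ⟨n, rfl, ?_⟩
    rw [pd_coord_mul (smooth_differentiable h.contDiff)]
    refine add (h.const_mul _) ?_
    rcases ih with ⟨-, h0⟩ | ⟨m, rfl, hm⟩
    · rw [h0]; simpa using zero n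
    · exact coord j hm
  | add h h' ih ih' =>
    rw [pd_add (smooth_differentiable h.contDiff) (smooth_differentiable h'.contDiff)]
    rcases ih with ⟨h0, h1⟩ | ⟨m, hm, h1⟩ <;> rcases ih' with ⟨h0', h1'⟩ | ⟨m', hm', h1'⟩
    · left; simp [h0, h1, h1']
    · omega
    · omega
    · obtain rfl : m = m' := by omega
      exact Or.inr ⟨m, hm, add h1 h1'⟩
  | zero n =>
    rw [pd_const]
    rcases n with _ | n
    · exact Or.inl ⟨rfl, rfl⟩
    · exact Or.inr ⟨n, rfl, zero n⟩

lemma bound (h : HomPoly n p) : ∃ K : ℝ, 0 ≤ K ∧ ∀ x, |p x| ≤ K * ‖x‖ ^ n := by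
  induction h with
  | const a => exact ⟨|a|, abs_nonneg _, fun x => by simp⟩
  | coord i _ ih =>
    obtain ⟨K, hK, h⟩ := ih
    refine ⟨K, hK, fun x => ?_⟩
    rw [abs_mul, pow_succ', mul_left_comm]
    exact mul_le_mul (PiLp.norm_apply_le x i) (h x) (abs_nonneg _) (norm_nonneg _)
  | add _ _ ih ih' =>
    obtain ⟨K, hK, h⟩ := ih
    obtain ⟨K', hK', h'⟩ := ih'
    exact ⟨K + K', add_nonneg hK hK', fun x => (abs_add_le _ _).trans (by
      rw [add_mul]; exact add_le_add (h x) (h' x))⟩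
  | zero n => exact ⟨0, le_rfl, fun x => by simp⟩

end HomPoly

/-! ### Parabolic operators with coefficients independent of the space variable -/

/-- The coefficients of a uniformly parabolic operator
`∂_t + ½ ∑ C_{ij}(t) ∂_{ij} + ⟨m(t), ∇⟩ + γ(t)`, continuous and bounded on all of `ℝ`. -/
structure HeatData (d : ℕ) where
  /-- The diffusion matrix. -/
  C : ℝ → Matrix (Fin d) (Fin d) ℝ
  /-- The drift. -/
  m : ℝ → Fin d → ℝ
  /-- The potential. -/
  γ : ℝ → ℝ
  /-- The ellipticity constant. -/
  l : ℝ
  /-- A common bound for all the coefficients. -/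
  Λ : ℝ
  contC : ∀ i j, Continuous fun t => C t i j
  contm : ∀ i, Continuous fun t => m t i
  contγ : Continuous γ
  symm : ∀ t i j, C t i j = C t j i
  l_pos : 0 < l
  Λ_pos : 0 < Λ
  boundC : ∀ t i j, |C t i j| ≤ Λ
  boundm : ∀ t i, |m t i| ≤ Λ
  boundγ : ∀ t, |γ t| ≤ Λ
  elliptic : ∀ t ξ, l * ∑ i, ξ i ^ 2 ≤ qform (C t) ξ

namespace HeatData

variable (H : HeatData d) (T : ℝ)

/-- The covariance matrix `∫_t^T C(r) dr`. -/
noncomputable def cov (t : ℝ) : Matrix (Fin d) (Fin d) ℝ := Matrix.of fun i j => ∫ r in t..T, H.C r i j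

/-- The mean displacement `∫_t^T m(r) dr`. -/
noncomputable def mean (t : ℝ) : Rd d := WithLp.toLp 2 fun i => ∫ r in t..T, H.m r i

/-- The centred Gaussian density with covariance `H.cov T t`. -/
noncomputable def gauss (t : ℝ) (q : Rd d) : ℝ :=
  1 / √((2 * Real.pi) ^ d * (H.cov T t).det) * Real.exp (-(1 / 2) * qform (H.cov T t)⁻¹ q)

lemma abs_integral_le {f : ℝ → ℝ} {K : ℝ} (hf : ∀ t, |f t| ≤ K) {t : ℝ} (ht : t ≤ T) :
    |∫ r in t..T, f r| ≤ K * (T - t) := by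
  have := intervalIntegral.norm_integral_le_of_norm_le_const (a := t) (b := T) (f := f) (C := K)
    fun x _ => hf x
  rwa [Real.norm_eq_abs, abs_of_nonneg (sub_nonneg.2 ht)] at this

lemma norm_mean_le {t : ℝ} (ht : t ≤ T) : ‖H.mean T t‖ ≤ d * H.Λ * (T - t) := by
  have hv : H.mean T t = ∑ i, (H.mean T t) i • EuclideanSpace.single i (1 : ℝ) := by
    ext j; simp [Finset.sum_apply, Pi.single_apply]
  rw [hv]
  refine (norm_sum_le _ _).trans ?_
  have : ∀ i ∈ Finset.univ, ‖(H.mean T t) i • (EuclideanSpace.single i (1 : ℝ) : Rd d)‖ ≤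
      H.Λ * (T - t) := by
    intro i _
    rw [norm_smul, PiLp.norm_single, norm_one, mul_one]
    exact abs_integral_le T (fun r => H.boundm r i) ht
  refine (Finset.sum_le_card_nsmul _ _ _ this).trans ?_
  simp [mul_assoc]

lemma qform_cov (t : ℝ) (ξ : Fin d → ℝ) : qform (H.cov T t) ξ = ∫ r in t..T, qform (H.C r) ξ := by
  simp only [qform, cov, Matrix.of_apply]
  rw [intervalIntegral.integral_finsetSum]
  · refine Finset.sum_congr rfl fun i _ => ?_
    rw [intervalIntegral.integral_finsetSum]
    · refine Finset.sum_congr rfl fun j _ => ?_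
      rw [intervalIntegral.integral_mul_const, intervalIntegral.integral_mul_const]
    · exact fun j _ => (((H.contC i j).mul_const _).mul_const _).intervalIntegrable _ _
  · exact fun i _ => (continuous_finsetSum _ fun j _ =>
      ((H.contC i j).mul_const _).mul_const _).intervalIntegrable _ _

lemma continuous_qform (ξ : Fin d → ℝ) : Continuous fun r => qform (H.C r) ξ :=
  continuous_finsetSum _ fun i _ => continuous_finsetSum _ fun j _ =>
      ((H.contC i j).mul_const _).mul_const _

lemma qform_le (t : ℝ) (ξ : Fin d → ℝ) : qform (H.C t) ξ ≤ ((d + 1) * H.Λ) * ∑ i, ξ i ^ 2 := by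
  have hΛ := H.Λ_pos
  have h1 : qform (H.C t) ξ ≤ ∑ i, ∑ j, H.Λ * ((ξ i ^ 2 + ξ j ^ 2) / 2) := by
    refine Finset.sum_le_sum fun i _ => Finset.sum_le_sum fun j _ => ?_
    rw [mul_assoc]
    refine (le_abs_self _).trans ?_
    rw [abs_mul]
    refine mul_le_mul (H.boundC t i j) ?_ (abs_nonneg _) hΛ.le
    rw [abs_le]; constructor <;> nlinarith [sq_nonneg (ξ i + ξ j), sq_nonneg (ξ i - ξ j)]
  have h2 : ∑ i, ∑ j, H.Λ * ((ξ i ^ 2 + ξ j ^ 2) / 2) = d * H.Λ * ∑ i, ξ i ^ 2 := by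
    simp only [← Finset.mul_sum, ← Finset.sum_div, Finset.sum_add_distrib, Finset.sum_const,
      Finset.card_univ, Fintype.card_fin, nsmul_eq_mul]
    ring
  have h3 : 0 ≤ ∑ i, ξ i ^ 2 := Finset.sum_nonneg fun i _ => sq_nonneg _
  nlinarith

lemma cov_symm (t : ℝ) : (H.cov T t).IsSymm := by
  ext i j; simp only [cov, Matrix.transpose_apply, Matrix.of_apply, H.symm _ j i]

/-- The covariance matrix is comparable to `(T - t)` times the identity. -/
lemma spectralBounds {t : ℝ} (ht : t < T) :
    SpectralBounds (H.cov T t) (H.l * (T - t)) ((d + 1) * H.Λ * (T - t)) where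
  symm := H.cov_symm T t
  l_pos := mul_pos H.l_pos (sub_pos.2 ht)
  b_pos := mul_pos (mul_pos (by positivity) H.Λ_pos) (sub_pos.2 ht)
  lower ξ := by
    rw [qform_cov]
    have := intervalIntegral.integral_mono_on (μ := volume) ht.le
      (f := fun _ => H.l * ∑ i, ξ i ^ 2) (g := fun r => qform (H.C r) ξ)
      (continuous_const.intervalIntegrable _ _)
      ((H.continuous_qform ξ).intervalIntegrable _ _) fun r _ => H.elliptic r ξ
    rw [intervalIntegral.integral_const, smul_eq_mul] at this
    linarith
  upper ξ := by
    rw [qform_cov]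
    have := intervalIntegral.integral_mono_on (μ := volume) ht.le
      (g := fun _ => ((d + 1) * H.Λ) * ∑ i, ξ i ^ 2) (f := fun r => qform (H.C r) ξ)
      ((H.continuous_qform ξ).intervalIntegrable _ _)
      (continuous_const.intervalIntegrable _ _) fun r _ => H.qform_le r ξ
    rw [intervalIntegral.integral_const, smul_eq_mul] at this
    linarith

lemma inv_symm (t : ℝ) (i j : Fin d) : (H.cov T t)⁻¹ i j = (H.cov T t)⁻¹ j i := by
  have := (H.cov_symm T t)
  have h2 : ((H.cov T t)⁻¹).transpose = (H.cov T t)⁻¹ := by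
    rw [Matrix.transpose_nonsing_inv, this.eq]
  exact congrFun (congrFun h2.symm i) j

lemma hasDerivAt_cov (t : ℝ) (i j : Fin d) :
    HasDerivAt (fun s => H.cov T s i j) ((-H.C t) i j) t := by
  simp only [cov, Matrix.of_apply, Matrix.neg_apply]
  exact intervalIntegral.integral_hasDerivAt_left ((H.contC i j).intervalIntegrable _ _)
    ((H.contC i j).stronglyMeasurableAtFilter _ _) (H.contC i j).continuousAt

lemma hasDerivAt_mean (t : ℝ) (i : Fin d) :
    HasDerivAt (fun s => H.mean T s i) (-H.m t i) t := by
  simp only [mean]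
  exact intervalIntegral.integral_hasDerivAt_left ((H.contm i).intervalIntegrable _ _)
    ((H.contm i).stronglyMeasurableAtFilter _ _) (H.contm i).continuousAt

lemma continuous_mean : Continuous (H.mean T) := by
  refine (PiLp.continuous_toLp 2 _).comp (continuous_pi fun i => ?_)
  exact continuous_iff_continuousAt.2 fun t => (H.hasDerivAt_mean T t i).continuousAt

lemma eventually_isUnit_det {t : ℝ} (ht : t < T) : ∀ᶠ s in 𝓝 t, IsUnit (H.cov T s).det := by
  filter_upwards [gt_mem_nhds ht] with s hs using (H.spectralBounds T hs).isUnit_det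

lemma hasDerivAt_inv {t : ℝ} (ht : t < T) (i j : Fin d) :
    HasDerivAt (fun s => (H.cov T s)⁻¹ i j) (((H.cov T t)⁻¹ * H.C t * (H.cov T t)⁻¹) i j) t := by
  have := GaussianExpansion.hasDerivAt_inv (H.hasDerivAt_cov T t) (H.eventually_isUnit_det T ht) i j
  simpa using this

/-- The normalising factor of the Gaussian density. -/
noncomputable def norml (t : ℝ) : ℝ := 1 / √((2 * Real.pi) ^ d * (H.cov T t).det)

/-- The derivative involves `C(t)` through a trace, which is what the second derivatives of the
exponential in `hasDerivAt_gauss` produce as well. -/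
lemma hasDerivAt_norml {t : ℝ} (ht : t < T) :
    HasDerivAt (H.norml T) (1 / 2 * ((H.cov T t)⁻¹ * H.C t).trace * H.norml T t) t := by
  have hS := H.spectralBounds T ht
  have h1 := (hasDerivAt_det (H.hasDerivAt_cov T t) hS.isUnit_det).const_mul ((2 * Real.pi) ^ d)
  have hp : 0 < (2 * Real.pi) ^ d * (H.cov T t).det := mul_pos (by positivity) hS.det_pos
  have h2 := (h1.sqrt hp.ne').inv (Real.sqrt_pos.2 hp).ne'
  have e : H.norml T = fun s => (√((2 * Real.pi) ^ d * (H.cov T s).det))⁻¹ := by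
    ext s; simp [norml]
  rw [e]
  refine h2.congr_deriv ?_
  have hs := Real.sqrt_pos.2 hp
  have hsq := Real.sq_sqrt hp.le
  set r := √((2 * Real.pi) ^ d * (H.cov T t).det)
  change _ = 1 / 2 * ((H.cov T t)⁻¹ * H.C t).trace * r⁻¹
  simp only [mul_neg, Matrix.trace_neg, neg_div, neg_neg]
  rw [← mul_assoc, ← hsq]
  field_simp

lemma gauss_eq (t : ℝ) (q : Rd d) :
    H.gauss T t q = H.norml T t * Real.exp (-(1 / 2) * qform (H.cov T t)⁻¹ q) := rfl

lemma norml_nonneg (t : ℝ) : 0 ≤ H.norml T t := by unfold norml; positivity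

lemma gauss_nonneg (t : ℝ) (q : Rd d) : 0 ≤ H.gauss T t q :=
  mul_nonneg (H.norml_nonneg T t) (Real.exp_pos _).le

lemma contDiff_qform (S : Matrix (Fin d) (Fin d) ℝ) : ContDiff ℝ ∞ fun q : Rd d => qform S q := by
  unfold qform
  exact ContDiff.sum fun i _ => ContDiff.sum fun j _ =>
    (contDiff_const.mul (contDiff_coord i)).mul (contDiff_coord j)

lemma contDiff_gauss (t : ℝ) : ContDiff ℝ ∞ (H.gauss T t) :=
  contDiff_const.mul (contDiff_const.mul (contDiff_qform _)).exp

lemma pd_gauss (t : ℝ) (i : Fin d) (q : Rd d) :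
    pd i (H.gauss T t) q = -(∑ j, (H.cov T t)⁻¹ i j * q j) * H.gauss T t q := by
  have h1 : HasFDerivAt (fun q : Rd d => qform (H.cov T t)⁻¹ q)
      (∑ k, ∑ j, (((H.cov T t)⁻¹ k j * q k) • (EuclideanSpace.proj (𝕜 := ℝ) j : Rd d →L[ℝ] ℝ) +
        q j • ((H.cov T t)⁻¹ k j • (EuclideanSpace.proj (𝕜 := ℝ) k : Rd d →L[ℝ] ℝ)))) q := by
    unfold qform
    refine HasFDerivAt.fun_sum fun k _ => HasFDerivAt.fun_sum fun j _ => ?_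
    have hk := (EuclideanSpace.proj (𝕜 := ℝ) k : Rd d →L[ℝ] ℝ).hasFDerivAt (x := q)
    have hj := (EuclideanSpace.proj (𝕜 := ℝ) j : Rd d →L[ℝ] ℝ).hasFDerivAt (x := q)
    exact (hk.const_mul ((H.cov T t)⁻¹ k j)).mul hj
  have h2 := (((h1.const_mul (-(1/2:ℝ))).exp).const_mul (H.norml T t)).fderiv
  have e : H.gauss T t = fun q : Rd d => H.norml T t * Real.exp (-(1 / 2) * qform (H.cov T t)⁻¹ q) :=
    rfl
  rw [pd, e, h2]
  have h3 : (∑ k, ∑ j, (((H.cov T t)⁻¹ k j * q k) • (EuclideanSpace.proj (𝕜 := ℝ) j : Rd d →L[ℝ] ℝ) +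
        q j • ((H.cov T t)⁻¹ k j • (EuclideanSpace.proj (𝕜 := ℝ) k : Rd d →L[ℝ] ℝ))))
        (EuclideanSpace.single i 1) = 2 * ∑ j, (H.cov T t)⁻¹ i j * q j := by
    simp only [sum_apply, add_apply, smul_apply, PiLp.proj_apply, smul_eq_mul,
      Finset.sum_add_distrib]
    simp
    rw [two_mul]
    congr 1
    · exact Finset.sum_congr rfl fun k _ => by rw [H.inv_symm T t k i]
    · exact Finset.sum_congr rfl fun k _ => by ring
  simp only [smul_apply, smul_eq_mul, h3]
  ring

lemma pd_pd_gauss (t : ℝ) (i j : Fin d) (q : Rd d) :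
    pd i (pd j (H.gauss T t)) q = ((∑ k, (H.cov T t)⁻¹ i k * q k) * (∑ k, (H.cov T t)⁻¹ j k * q k) -
      (H.cov T t)⁻¹ i j) * H.gauss T t q := by
  have hlin : ContDiff ℝ ∞ fun q : Rd d => -(∑ k, (H.cov T t)⁻¹ j k * q k) :=
    (ContDiff.sum fun k _ => contDiff_const.mul (contDiff_coord k)).neg
  have h1 : pd j (H.gauss T t) = fun q => -(∑ k, (H.cov T t)⁻¹ j k * q k) * H.gauss T t q :=
    funext fun q => H.pd_gauss T t j q
  have h2 : pd i (fun q : Rd d => -(∑ k, (H.cov T t)⁻¹ j k * q k)) =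
      fun _ => -(H.cov T t)⁻¹ i j := by
    have : (fun q : Rd d => -(∑ k, (H.cov T t)⁻¹ j k * q k)) =
        fun q : Rd d => ∑ k, (-(H.cov T t)⁻¹ j k) * q k := by
      ext q; simp [Finset.sum_neg_distrib]
    rw [this, pd_sum]
    · ext q
      simp_rw [pd_const_mul, pd_coord]
      simp [H.inv_symm T t i j]
    · exact fun k _ => smooth_differentiable (contDiff_const.mul (contDiff_coord k))
  rw [h1, pd_mul (smooth_differentiable hlin) (smooth_differentiable (H.contDiff_gauss T t)), h2]
  simp only [H.pd_gauss]
  ring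

/-- The Gaussian density, transported along the drift, solves the backward heat equation. -/
lemma hasDerivAt_gauss {t : ℝ} (ht : t < T) (z : Rd d) :
    HasDerivAt (fun s => H.gauss T s (z - H.mean T s))
      (-(1 / 2 * ∑ i, ∑ j, H.C t i j * pd i (pd j (H.gauss T t)) (z - H.mean T t)) +
        ∑ i, H.m t i * pd i (H.gauss T t) (z - H.mean T t)) t := by
  set q := z - H.mean T t with hq
  set A := (H.cov T t)⁻¹ with hA
  have hq' : ∀ i, HasDerivAt (fun s => (z - H.mean T s) i) (H.m t i) t := fun i => by
    have := (H.hasDerivAt_mean T t i).const_sub (z i)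
    simpa using this
  have h1 : HasDerivAt (fun s => qform (H.cov T s)⁻¹ (z - H.mean T s))
      (∑ i, ∑ j, (((A * H.C t * A) i j * q i + A i j * H.m t i) * q j + A i j * q i * H.m t j)) t := by
    unfold qform
    exact HasDerivAt.fun_sum fun i _ => HasDerivAt.fun_sum fun j _ =>
      ((H.hasDerivAt_inv T ht i j).mul (hq' i)).mul (hq' j)
  have h2 := (H.hasDerivAt_norml T ht).mul ((h1.const_mul (-(1 / 2 : ℝ))).exp)
  refine h2.congr_deriv ?_
  simp only [pd_pd_gauss, pd_gauss, ← hA]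
  rw [gauss_eq]
  set w := fun i => ∑ j, A i j * q j with hw
  have e1 : (A * H.C t).trace = ∑ i, ∑ j, H.C t i j * A i j := by
    simp only [Matrix.trace, Matrix.diag_apply, Matrix.mul_apply]
    rw [Finset.sum_comm]
    exact Finset.sum_congr rfl fun i _ => Finset.sum_congr rfl fun j _ => by
      rw [hA, H.inv_symm T t j i, mul_comm]
  have e2 : ∑ i, ∑ j, (A * H.C t * A) i j * q i * q j = ∑ i, ∑ j, H.C t i j * (w i * w j) := by
    have h3 : q.ofLp ⬝ᵥ (A * H.C t * A).mulVec q.ofLp =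
        (A.mulVec q.ofLp) ⬝ᵥ (H.C t).mulVec (A.mulVec q.ofLp) := by
      rw [← Matrix.mulVec_mulVec, ← Matrix.mulVec_mulVec, Matrix.dotProduct_mulVec,
        ← Matrix.mulVec_transpose]
      congr 2
      ext i j; exact H.inv_symm T t j i
    rw [← qform_eq_dotProduct, ← qform_eq_dotProduct] at h3
    simp only [qform] at h3
    rw [h3]
    exact Finset.sum_congr rfl fun i _ => Finset.sum_congr rfl fun j _ => by
      simp [Matrix.mulVec, dotProduct, hw, mul_assoc]
  have e3 : ∑ i, ∑ j, A i j * H.m t i * q j = ∑ i, H.m t i * w i := by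
    simp only [hw, Finset.mul_sum]
    exact Finset.sum_congr rfl fun i _ => Finset.sum_congr rfl fun j _ => by ring
  have e4 : ∑ i, ∑ j, A i j * q i * H.m t j = ∑ i, H.m t i * w i := by
    rw [Finset.sum_comm]
    simp only [hw, Finset.mul_sum]
    exact Finset.sum_congr rfl fun i _ => Finset.sum_congr rfl fun j _ => by
      rw [hA, H.inv_symm T t j i]; ring
  have e5 : ∑ i, ∑ j, H.C t i j * ((w i * w j - A i j) *
      (H.norml T t * Real.exp (-(1 / 2) * qform A q))) =
      (∑ i, ∑ j, H.C t i j * (w i * w j) - ∑ i, ∑ j, H.C t i j * A i j) *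
      (H.norml T t * Real.exp (-(1 / 2) * qform A q)) := by
    simp only [← Finset.sum_sub_distrib, Finset.sum_mul]
    exact Finset.sum_congr rfl fun i _ => Finset.sum_congr rfl fun j _ => by ring
  have e6 : ∑ i, H.m t i * (-w i * (H.norml T t * Real.exp (-(1 / 2) * qform A q))) =
      -(∑ i, H.m t i * w i) * (H.norml T t * Real.exp (-(1 / 2) * qform A q)) := by
    rw [← Finset.sum_neg_distrib, Finset.sum_mul]
    exact Finset.sum_congr rfl fun i _ => by ring
  have e7 : ∑ i, ∑ j, (((A * H.C t * A) i j * q i + A i j * H.m t i) * q j + A i j * q i * H.m t j) =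
      ∑ i, ∑ j, H.C t i j * (w i * w j) + 2 * ∑ i, H.m t i * w i := by
    simp only [add_mul, Finset.sum_add_distrib, e2, e3, e4]; ring
  have e8 : z.ofLp - (H.mean T t).ofLp = q.ofLp := rfl
  rw [e7, e5, e6, e1, e8]
  ring

end HeatData

/-! ### Gaussian bounds -/

lemma exists_pow_mul_exp_le {c : ℝ} (hc : 0 < c) (n : ℕ) :
    ∃ K : ℝ, 0 ≤ K ∧ ∀ r : ℝ, 0 ≤ r → r ^ n * Real.exp (-c * r ^ 2) ≤ K := by
  refine ⟨1 + n.factorial / c ^ n, by positivity, fun r hr => ?_⟩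
  have h1 : r ^ n ≤ 1 + (r ^ 2) ^ n := by
    rw [← pow_mul, mul_comm, pow_mul]
    nlinarith [sq_nonneg (r ^ n - 1), pow_nonneg hr n]
  have h2 : (r ^ 2) ^ n ≤ n.factorial / c ^ n * Real.exp (c * r ^ 2) := by
    have := Real.pow_div_factorial_le_exp (c * r ^ 2) (by positivity) n
    rw [mul_pow, div_le_iff₀ (by positivity)] at this
    rw [div_mul_eq_mul_div, le_div_iff₀ (by positivity)]
    linarith
  have h3 : Real.exp (c * r ^ 2) * Real.exp (-c * r ^ 2) = 1 := by
    rw [← Real.exp_add]; simp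
  have h4 : Real.exp (-c * r ^ 2) ≤ 1 := Real.exp_le_one_iff.2 (by nlinarith [sq_nonneg r])
  have h5 := Real.exp_pos (-c * r ^ 2)
  calc r ^ n * Real.exp (-c * r ^ 2)
      ≤ (1 + n.factorial / c ^ n * Real.exp (c * r ^ 2)) * Real.exp (-c * r ^ 2) := by
        gcongr; linarith
    _ = Real.exp (-c * r ^ 2) + n.factorial / c ^ n := by
        rw [add_mul, one_mul, mul_assoc, h3, mul_one]
    _ ≤ _ := by linarith

lemma integrable_exp_neg_sq_add {c : ℝ} (hc : 0 < c) (κ : ℝ) :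
    Integrable fun y : Rd d => Real.exp (-c * ‖y‖ ^ 2 + κ * ‖y‖) := by
  have h := (integrable_exp_neg_mul_sum_sq (d := d) (half_pos hc)).const_mul
    (Real.exp (κ ^ 2 / (2 * c)))
  refine h.mono' (by fun_prop) (Eventually.of_forall fun y => ?_)
  rw [Real.norm_eq_abs, Real.abs_exp, ← Real.exp_add, Real.exp_le_exp,
    ← EuclideanSpace.real_norm_sq_eq]
  have h1 : 0 ≤ (c * ‖y‖ - κ) ^ 2 / (2 * c) := by positivity
  have h2 : (c * ‖y‖ - κ) ^ 2 / (2 * c) = c / 2 * ‖y‖ ^ 2 - κ * ‖y‖ + κ ^ 2 / (2 * c) := by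
    field_simp; ring
  linarith

/-- The heat kernel of width `σ`, up to normalisation. -/
noncomputable def heatK (c σ : ℝ) (q : Rd d) : ℝ := (σ ^ d)⁻¹ * Real.exp (-c * ‖σ⁻¹ • q‖ ^ 2)

lemma norm_inv_smul {σ : ℝ} (hσ : 0 < σ) (q : Rd d) : ‖σ⁻¹ • q‖ = ‖q‖ / σ := by
  rw [norm_smul, norm_inv, Real.norm_eq_abs, abs_of_pos hσ, div_eq_inv_mul]

/-- Lets a Gaussian be recentred at the price of half of its exponent. -/
lemma sq_norm_ge (y z : Rd d) : ‖y‖ ^ 2 / 2 - ‖z‖ ^ 2 ≤ ‖y - z‖ ^ 2 := by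
  have h1 : ‖y‖ ≤ ‖y - z‖ + ‖z‖ := by simpa using norm_add_le (y - z) z
  nlinarith [norm_nonneg y, norm_nonneg z, norm_nonneg (y - z), sq_nonneg (‖y - z‖ - ‖z‖)]

/-- A rescaled function has the same integral. -/
lemma integral_rescale {σ : ℝ} (hσ : 0 < σ) (h : Rd d → ℝ) :
    ∫ q : Rd d, (σ ^ d)⁻¹ * h (σ⁻¹ • q) = ∫ v, h v := by
  rw [integral_const_mul, Measure.integral_comp_inv_smul_of_nonneg _ _ hσ.le]
  simp only [finrank_euclideanSpace, Fintype.card_fin, smul_eq_mul]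
  rw [← mul_assoc, inv_mul_cancel₀ (by positivity), one_mul]

namespace HeatData

variable (H : HeatData d) (T : ℝ)

/-- Kernels of order `b`: linear combinations of `c(t) p(q) Γ(t,q)` with `p` homogeneous of some
degree `n` and `c(t) = O((T-t)^{-(b+n)/2})`. The derivatives of order `b` of the Gaussian density
are of this kind. -/
inductive Kern : ℕ → (ℝ → Rd d → ℝ) → Prop
  | term {b n : ℕ} {p : Rd d → ℝ} {c : ℝ → ℝ} {K : ℝ} : HomPoly n p → ContinuousOn c (Iio T) →
      (∀ t < T, |c t| * √(T - t) ^ (b + n) ≤ K) → Kern b fun t q => c t * p q * H.gauss T t q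
  | add {b : ℕ} {k k' : ℝ → Rd d → ℝ} : Kern b k → Kern b k' → Kern b fun t q => k t q + k' t q
  | zero (b : ℕ) : Kern b fun _ _ => 0

/-- The rate of decay of the Gaussian bounds. -/
noncomputable def rate : ℝ := 1 / (4 * ((d + 1) * H.Λ))

lemma rate_pos : 0 < H.rate := by
  have := H.Λ_pos
  unfold rate; positivity

/-- The exponent is twice `rate`: one half is kept to absorb polynomial factors. -/
lemma gauss_le {t : ℝ} (ht : t < T) (q : Rd d) :
    H.gauss T t q ≤ (√H.l ^ d)⁻¹ * ((√(T - t) ^ d)⁻¹ *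
      Real.exp (-(2 * H.rate) * (‖q‖ / √(T - t)) ^ 2)) := by
  have hS := H.spectralBounds T ht
  have hτ : 0 < T - t := sub_pos.2 ht
  have hl := H.l_pos
  have hΛ := H.Λ_pos
  have h1 : H.norml T t ≤ (√H.l ^ d)⁻¹ * (√(T - t) ^ d)⁻¹ := by
    rw [norml, one_div, ← mul_inv, ← mul_pow, ← Real.sqrt_mul hl.le]
    exact inv_anti₀ (by positivity) hS.le_sqrt_det
  have h2 : Real.exp (-(1 / 2) * qform (H.cov T t)⁻¹ q) ≤
      Real.exp (-(2 * H.rate) * (‖q‖ / √(T - t)) ^ 2) := by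
    rw [Real.exp_le_exp, div_pow, Real.sq_sqrt hτ.le, EuclideanSpace.real_norm_sq_eq]
    have := hS.le_qform_inv q
    have e : 2 * H.rate * ((∑ i, q i ^ 2) / (T - t)) =
        1 / 2 * (1 / ((d + 1) * H.Λ * (T - t)) * ∑ i, q i ^ 2) := by
      unfold rate; field_simp; norm_num
    rw [neg_mul, neg_mul, e]
    linarith
  rw [gauss_eq, ← mul_assoc]
  exact mul_le_mul h1 h2 (Real.exp_pos _).le (by positivity)

lemma continuousOn_inv (i j : Fin d) : ContinuousOn (fun t => (H.cov T t)⁻¹ i j) (Iio T) :=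
  fun _ ht => (H.hasDerivAt_inv T ht i j).continuousAt.continuousWithinAt

lemma continuousOn_gauss : ContinuousOn (fun p : ℝ × Rd d => H.gauss T p.1 p.2) (Iio T ×ˢ univ) := by
  have h1 : ContinuousOn (fun p : ℝ × Rd d => H.norml T p.1) (Iio T ×ˢ univ) :=
    ContinuousOn.comp (g := H.norml T) (t := Iio T)
      (fun t ht => (H.hasDerivAt_norml T ht).continuousAt.continuousWithinAt)
      continuousOn_fst fun p hp => hp.1
  have h2 : ∀ i j, ContinuousOn (fun p : ℝ × Rd d => (H.cov T p.1)⁻¹ i j) (Iio T ×ˢ univ) :=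
    fun i j => (H.continuousOn_inv T i j).comp continuousOn_fst fun p hp => hp.1
  simp only [gauss_eq]
  refine h1.mul (Real.continuous_exp.comp_continuousOn' (continuousOn_const.mul ?_))
  unfold qform
  refine continuousOn_finsetSum _ fun i _ => continuousOn_finsetSum _ fun j _ =>
    ((h2 i j).mul ?_).mul ?_ <;> fun_prop

variable {H T} {b : ℕ} {k : ℝ → Rd d → ℝ}

namespace Kern

lemma contDiff (hk : H.Kern T b k) (t : ℝ) : ContDiff ℝ ∞ (k t) := by
  induction hk with
  | term hp _ _ => exact (contDiff_const.mul hp.contDiff).mul (H.contDiff_gauss T t)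
  | add _ _ ih ih' => exact ih.add ih'
  | zero => exact contDiff_const

lemma continuousOn (hk : H.Kern T b k) :
    ContinuousOn (fun p : ℝ × Rd d => k p.1 p.2) (Iio T ×ˢ univ) := by
  induction hk with
  | term hp hc _ =>
    refine ContinuousOn.mul (ContinuousOn.mul ?_ ?_) (H.continuousOn_gauss T)
    · exact hc.comp continuousOn_fst fun p hp => hp.1
    · exact (hp.contDiff.continuous.comp continuous_snd).continuousOn
  | add _ _ ih ih' => exact ih.add ih'
  | zero => exact continuousOn_const

lemma sum {ι : Type*} (s : Finset ι) {k : ι → ℝ → Rd d → ℝ} (hk : ∀ j ∈ s, H.Kern T b (k j)) :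
    H.Kern T b fun t q => ∑ j ∈ s, k j t q := by
  classical
  induction s using Finset.induction_on with
  | empty => simpa using zero b
  | insert j s hj ih =>
    simp only [Finset.sum_insert hj]
    exact add (hk j (Finset.mem_insert_self _ _))
      (ih fun i hi => hk i (Finset.mem_insert_of_mem hi))

/-- A derivative either lowers the degree of `p` or produces a factor `(𝐂⁻¹ q)_i`, of degree one with a
coefficient of size `(T - t)⁻¹`; in both cases the order grows by one. -/
lemma pd (hk : H.Kern T b k) (i : Fin d) : H.Kern T (b + 1) fun t => GaussianExpansion.pd i (k t) := by
  induction hk with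
  | @term n p c K hp hc hb =>
    have h1 : (fun t => GaussianExpansion.pd i fun q => c t * p q * H.gauss T t q) =
        fun t q => c t * GaussianExpansion.pd i p q * H.gauss T t q +
          ∑ j, (-(c t * (H.cov T t)⁻¹ i j)) * (q j * p q) * H.gauss T t q := by
      ext t q
      rw [pd_mul ((smooth_differentiable hp.contDiff).const_mul _)
        (smooth_differentiable (H.contDiff_gauss T t)), pd_const_mul]
      beta_reduce
      rw [pd_gauss, neg_mul, mul_neg,
        Finset.sum_mul, Finset.mul_sum, ← Finset.sum_neg_distrib]
      congr 1
      exact Finset.sum_congr rfl fun j _ => by ring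
    rw [h1]
    refine add ?_ (sum _ fun j _ => ?_)
    · rcases hp.pd i with ⟨-, h0⟩ | ⟨m, rfl, hm⟩
      · simpa [h0] using zero _
      · exact term (K := K) hm hc fun t ht => by
          have := hb t ht
          rwa [show b + 1 + m = b + (m + 1) by ring]
    · refine term (K := K * (1 / H.l)) (hp.coord j) (hc.mul (H.continuousOn_inv T i j)).neg
        fun t ht => ?_
      have hτ : 0 < T - t := sub_pos.2 ht
      have hl := H.l_pos
      have h2 := (H.spectralBounds T ht).abs_inv_le i j
      have h3 : √(T - t) ^ (b + 1 + (n + 1)) = √(T - t) ^ (b + n) * (T - t) := by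
        rw [show b + 1 + (n + 1) = b + n + 2 by ring, pow_add, Real.sq_sqrt hτ.le]
      rw [abs_neg, abs_mul, h3]
      calc |c t| * |(H.cov T t)⁻¹ i j| * (√(T - t) ^ (b + n) * (T - t))
          = (|c t| * √(T - t) ^ (b + n)) * (|(H.cov T t)⁻¹ i j| * (T - t)) := by ring
        _ ≤ K * (1 / (H.l * (T - t)) * (T - t)) := by
            refine mul_le_mul (hb t ht) (by gcongr) (by positivity) ?_
            exact le_trans (by positivity) (hb t ht)
        _ = K * (1 / H.l) := by field_simp
  | add h h' ih ih' =>
    have : (fun t => GaussianExpansion.pd i fun q => _) = _ := funext fun t =>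
      pd_add (smooth_differentiable (h.contDiff t)) (smooth_differentiable (h'.contDiff t)) i
    rw [this]
    exact add ih ih'
  | zero => simpa [pd_const] using zero _

lemma pdL (hk : H.Kern T b k) (L : List (Fin d)) :
    H.Kern T (b + L.length) fun t => GaussianExpansion.pdL L (k t) := by
  induction L with
  | nil => exact hk
  | cons i L ih => exact ih.pd i

/-- In the variable `r = ‖q‖ / √(T - t)` a kernel of order `b` is `(T - t)^{-b/2}` times a polynomial in
`r` times the density, and half of the Gaussian exponent absorbs the polynomial. -/
lemma bound (hk : H.Kern T b k) : ∃ K : ℝ, 0 ≤ K ∧ ∀ t < T, ∀ q : Rd d,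
    |k t q| * √(T - t) ^ b ≤ K * heatK H.rate √(T - t) q := by
  induction hk with
  | @term n p c K hp hc hb =>
    obtain ⟨Kp, hKp, hp'⟩ := hp.bound
    obtain ⟨Kn, hKn, hn⟩ := exists_pow_mul_exp_le H.rate_pos n
    have hl := H.l_pos
    refine ⟨|K| * Kp * (√H.l ^ d)⁻¹ * Kn, by positivity, fun t ht q => ?_⟩
    have hτ : 0 < T - t := sub_pos.2 ht
    set σ := √(T - t) with hσ
    have hσ0 : 0 < σ := Real.sqrt_pos.2 hτ
    set r := ‖q‖ / σ with hr
    have hr0 : 0 ≤ r := by positivity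
    have hq : ‖q‖ = r * σ := by rw [hr]; field_simp
    have h1 := H.gauss_le T ht q
    rw [← hσ, ← hr] at h1
    have h2 : Real.exp (-(2 * H.rate) * r ^ 2) =
        Real.exp (-H.rate * r ^ 2) * Real.exp (-H.rate * r ^ 2) := by
      rw [← Real.exp_add]; congr 1; ring
    have h3 : |c t| * σ ^ (b + n) ≤ |K| := (hb t ht).trans (le_abs_self K)
    rw [heatK, norm_inv_smul hσ0, ← hr, abs_mul, abs_mul, abs_of_nonneg (H.gauss_nonneg T t q)]
    calc |c t| * |p q| * H.gauss T t q * σ ^ b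
        ≤ |c t| * (Kp * (r * σ) ^ n) * ((√H.l ^ d)⁻¹ * ((σ ^ d)⁻¹ *
            Real.exp (-(2 * H.rate) * r ^ 2))) * σ ^ b := by
          have := hp' q
          rw [hq] at this
          gcongr
          exact H.gauss_nonneg T t q
      _ = (|c t| * σ ^ (b + n)) * (Kp * (√H.l ^ d)⁻¹) * (r ^ n * Real.exp (-H.rate * r ^ 2)) *
            ((σ ^ d)⁻¹ * Real.exp (-H.rate * r ^ 2)) := by
          rw [h2, pow_add, mul_pow]; ring
      _ ≤ |K| * (Kp * (√H.l ^ d)⁻¹) * Kn * ((σ ^ d)⁻¹ * Real.exp (-H.rate * r ^ 2)) := by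
          have := hn r hr0
          gcongr
      _ = _ := by ring
  | add _ _ ih ih' =>
    obtain ⟨K, hK, h⟩ := ih
    obtain ⟨K', hK', h'⟩ := ih'
    refine ⟨K + K', add_nonneg hK hK', fun t ht q => ?_⟩
    rw [add_mul]
    refine le_trans ?_ (add_le_add (h t ht q) (h' t ht q))
    rw [← add_mul]
    exact mul_le_mul_of_nonneg_right (abs_add_le _ _) (by positivity)
  | zero => exact ⟨0, le_rfl, fun t _ q => by simp⟩

lemma gauss : H.Kern T 0 (H.gauss T) := by
  have : (H.gauss T) = fun t q => 1 * 1 * H.gauss T t q := by ext; ring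
  rw [this]
  exact term (K := 1) (c := fun _ => 1) (HomPoly.const 1) continuousOn_const fun t _ => by simp

end Kern

/-! ### Integrals against kernels -/

variable (H T)

/-- `x ↦ ∫ k(t, y - x - 𝐦(t,T)) φ(y) dy`. -/
noncomputable def smear (φ : Rd d → ℝ) (k : ℝ → Rd d → ℝ) (t : ℝ) (x : Rd d) : ℝ :=
  ∫ y, k t (y - x - H.mean T t) * φ y

lemma smear_eq (φ : Rd d → ℝ) (k : ℝ → Rd d → ℝ) (t : ℝ) (x : Rd d) :
    H.smear T φ k t x = ∫ q, k t q * φ (q + (x + H.mean T t)) := by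
  rw [smear, ← integral_add_right_eq_self _ (x + H.mean T t)]
  congr 1; ext q
  rw [show q + (x + H.mean T t) - x - H.mean T t = q by abel]

variable {H T} {φ : Rd d → ℝ} {Kφ κ : ℝ}

namespace Kern

/-- Domination that is locally uniform in `(t,x)`. -/
lemma dominated (hk : H.Kern T b k) (hφ : ∀ y, |φ y| ≤ Kφ * Real.exp (κ * ‖y‖)) {t₀ : ℝ}
    (ht₀ : t₀ < T) (R : ℝ) : ∃ B : Rd d → ℝ, Integrable B ∧
      ∀ᶠ t in 𝓝 t₀, ∀ x, ‖x‖ ≤ R → ∀ y, ‖k t (y - x - H.mean T t) * φ y‖ ≤ B y := by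
  obtain ⟨K, hK, hb⟩ := hk.bound
  set τ₀ := T - t₀ with hτ₀
  have hτ₀p : 0 < τ₀ := sub_pos.2 ht₀
  set σ₁ := √(τ₀ / 2) with hσ₁
  have hσ₁p : 0 < σ₁ := Real.sqrt_pos.2 (by positivity)
  set R' := R + d * H.Λ * (τ₀ + 1) with hR'
  set c := H.rate / (τ₀ + 1) with hc
  have hcp : 0 < c := div_pos H.rate_pos (by positivity)
  have hΛ := H.Λ_pos
  refine ⟨fun y => (K * ((σ₁ ^ d)⁻¹ * (σ₁ ^ b)⁻¹) * Real.exp (c * R' ^ 2) * Kφ) *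
    Real.exp (-(c / 2) * ‖y‖ ^ 2 + κ * ‖y‖),
    (integrable_exp_neg_sq_add (by positivity) κ).const_mul _, ?_⟩
  have hnhds : Ioo (t₀ - 1) (t₀ + τ₀ / 2) ∈ 𝓝 t₀ := Ioo_mem_nhds (by linarith) (by linarith)
  filter_upwards [hnhds] with t ht x hx y
  have htT : t < T := by have := ht.2; linarith
  have hτ : 0 < T - t := sub_pos.2 htT
  have hτ1 : τ₀ / 2 ≤ T - t := by have := ht.2; linarith
  have hτ2 : T - t ≤ τ₀ + 1 := by have := ht.1; linarith
  set σ := √(T - t) with hσ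
  have hσp : 0 < σ := Real.sqrt_pos.2 hτ
  have hσσ : σ₁ ≤ σ := Real.sqrt_le_sqrt hτ1
  set q := y - x - H.mean T t with hq
  have h1 := hb t htT q
  have h2 : |k t q| ≤ K * ((σ₁ ^ d)⁻¹ * (σ₁ ^ b)⁻¹) * Real.exp (-c * ‖q‖ ^ 2) := by
    have h3 : |k t q| ≤ K * heatK H.rate σ q * (σ ^ b)⁻¹ := by
      rw [← div_eq_mul_inv, le_div_iff₀ (by positivity)]; exact h1
    refine h3.trans ?_
    have h4 : Real.exp (-H.rate * ‖σ⁻¹ • q‖ ^ 2) ≤ Real.exp (-c * ‖q‖ ^ 2) := by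
      rw [Real.exp_le_exp, norm_inv_smul hσp, div_pow, hσ, Real.sq_sqrt hτ.le, hc, neg_mul,
        neg_mul, neg_le_neg_iff, div_mul_eq_mul_div, mul_div_assoc]
      exact mul_le_mul_of_nonneg_left (by gcongr) H.rate_pos.le
    calc K * heatK H.rate σ q * (σ ^ b)⁻¹
        = K * ((σ ^ d)⁻¹ * (σ ^ b)⁻¹) * Real.exp (-H.rate * ‖σ⁻¹ • q‖ ^ 2) := by
          rw [heatK]; ring
      _ ≤ _ := by gcongr
  have hm : ‖x + H.mean T t‖ ≤ R' := by
    refine (norm_add_le _ _).trans (add_le_add hx ((H.norm_mean_le T htT.le).trans ?_))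
    gcongr
  have h5 : ‖y‖ ^ 2 / 2 - R' ^ 2 ≤ ‖q‖ ^ 2 := by
    have h6 := sq_norm_ge y (x + H.mean T t)
    rw [← sub_sub] at h6
    have : ‖x + H.mean T t‖ ^ 2 ≤ R' ^ 2 := by gcongr
    linarith
  have h7 : Real.exp (-c * ‖q‖ ^ 2) ≤ Real.exp (c * R' ^ 2) * Real.exp (-(c / 2) * ‖y‖ ^ 2) := by
    rw [← Real.exp_add, Real.exp_le_exp]
    nlinarith
  rw [norm_mul, Real.norm_eq_abs, Real.norm_eq_abs, Real.exp_add]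
  calc |k t q| * |φ y| ≤ (K * ((σ₁ ^ d)⁻¹ * (σ₁ ^ b)⁻¹) *
        (Real.exp (c * R' ^ 2) * Real.exp (-(c / 2) * ‖y‖ ^ 2))) *
        (Kφ * Real.exp (κ * ‖y‖)) := by
        refine mul_le_mul (h2.trans ?_) (hφ y) (abs_nonneg _) (by positivity)
        gcongr
    _ = _ := by ring

lemma aestronglyMeasurable (hk : H.Kern T b k) (hφm : Measurable φ) (t : ℝ) (x : Rd d) :
    AEStronglyMeasurable (fun y => k t (y - x - H.mean T t) * φ y) := by
  refine Measurable.aestronglyMeasurable (Measurable.mul ?_ hφm)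
  exact ((hk.contDiff t).continuous.comp (by fun_prop)).measurable

lemma integrable (hk : H.Kern T b k) (hφm : Measurable φ)
    (hφ : ∀ y, |φ y| ≤ Kφ * Real.exp (κ * ‖y‖)) {t : ℝ} (ht : t < T) (x : Rd d) :
    Integrable fun y => k t (y - x - H.mean T t) * φ y := by
  obtain ⟨B, hB, h⟩ := hk.dominated hφ ht ‖x‖
  exact hB.mono' (hk.aestronglyMeasurable hφm t x)
    (Eventually.of_forall fun y => h.self_of_nhds x le_rfl y)

/-- Joint continuity in `(t,x)`, by dominated convergence. -/
lemma continuousOn_smear (hk : H.Kern T b k) (hφm : Measurable φ)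
    (hφ : ∀ y, |φ y| ≤ Kφ * Real.exp (κ * ‖y‖)) :
    ContinuousOn (fun p : ℝ × Rd d => H.smear T φ k p.1 p.2) (Iio T ×ˢ univ) := by
  have hopen : IsOpen (Iio T ×ˢ (univ : Set (Rd d))) := isOpen_Iio.prod isOpen_univ
  rintro ⟨t₀, x₀⟩ ⟨ht₀, -⟩
  refine ContinuousAt.continuousWithinAt ?_
  obtain ⟨B, hB, h⟩ := hk.dominated hφ (t₀ := t₀) ht₀ (‖x₀‖ + 1)
  have hx : ∀ᶠ x : Rd d in 𝓝 x₀, ‖x‖ ≤ ‖x₀‖ + 1 :=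
    (continuous_norm.tendsto x₀).eventually_le_const (by linarith)
  unfold smear
  refine continuousAt_of_dominated (bound := B)
    (Eventually.of_forall fun p => hk.aestronglyMeasurable hφm p.1 p.2) ?_ hB ?_
  · rw [nhds_prod_eq]
    filter_upwards [h.prod_mk hx] with p hp
    exact Eventually.of_forall fun y => hp.1 p.2 hp.2 y
  · refine Eventually.of_forall fun y => ContinuousAt.mul ?_ continuousAt_const
    have h1 : ContinuousAt (fun p : ℝ × Rd d => k p.1 p.2) (t₀, y - x₀ - H.mean T t₀) :=
      hk.continuousOn.continuousAt (hopen.mem_nhds ⟨ht₀, mem_univ _⟩)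
    have h2 : ContinuousAt (fun p : ℝ × Rd d => (p.1, y - p.2 - H.mean T p.1)) (t₀, x₀) := by
      have := H.continuous_mean T
      exact Continuous.continuousAt (by fun_prop)
    exact ContinuousAt.comp (f := fun p : ℝ × Rd d => (p.1, y - p.2 - H.mean T p.1)) h1 h2

lemma norm_clm_le (A : Rd d →L[ℝ] ℝ) : ‖A‖ ≤ ∑ i, |A (EuclideanSpace.single i 1)| := by
  refine A.opNorm_le_bound (Finset.sum_nonneg fun i _ => abs_nonneg _) fun v => ?_
  have hv : v = ∑ i, v i • EuclideanSpace.single i (1 : ℝ) := by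
    ext j; simp [Finset.sum_apply, Pi.single_apply]
  conv_lhs => rw [hv]
  rw [map_sum, Finset.sum_mul]
  refine (norm_sum_le _ _).trans (Finset.sum_le_sum fun i _ => ?_)
  rw [map_smul, smul_eq_mul, norm_mul, mul_comm]
  exact mul_le_mul_of_nonneg_left (PiLp.norm_apply_le v i) (abs_nonneg _)

lemma hasFDerivAt_smear (hk : H.Kern T b k) (hφm : Measurable φ)
    (hφ : ∀ y, |φ y| ≤ Kφ * Real.exp (κ * ‖y‖)) {t : ℝ} (ht : t < T) (x₀ : Rd d) :
    Integrable (fun y => -(φ y) • fderiv ℝ (k t) (y - x₀ - H.mean T t)) ∧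
    HasFDerivAt (H.smear T φ k t)
      (∫ y, -(φ y) • fderiv ℝ (k t) (y - x₀ - H.mean T t)) x₀ := by
  choose B hB h using fun i => (hk.pd i).dominated hφ ht (‖x₀‖ + 1)
  have hx : {x : Rd d | ‖x‖ ≤ ‖x₀‖ + 1} ∈ 𝓝 x₀ :=
    (continuous_norm.tendsto x₀).eventually_le_const (by linarith)
  have hmeas : AEStronglyMeasurable (fun y => -(φ y) • fderiv ℝ (k t) (y - x₀ - H.mean T t)) := by
    refine (Measurable.neg hφm).aestronglyMeasurable.smul ?_
    have h1 : Continuous (fderiv ℝ (k t)) := (hk.contDiff t).continuous_fderiv (by simp)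
    exact (h1.comp (by fun_prop : Continuous fun y : Rd d => y - x₀ - H.mean T t)).aestronglyMeasurable
  have hbd : ∀ y, ∀ x ∈ {x : Rd d | ‖x‖ ≤ ‖x₀‖ + 1},
      ‖-(φ y) • fderiv ℝ (k t) (y - x - H.mean T t)‖ ≤ ∑ i, B i y := by
    intro y x hx
    refine (norm_clm_le _).trans (Finset.sum_le_sum fun i _ => ?_)
    refine le_trans (le_of_eq ?_) ((h i).self_of_nhds x hx y)
    rw [Real.norm_eq_abs, smul_apply, smul_eq_mul, abs_mul, abs_neg, abs_mul, mul_comm]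
    rfl
  have hBs : Integrable fun y => ∑ i, B i y := integrable_finsetSum _ fun i _ => hB i
  refine ⟨hBs.mono' hmeas (Eventually.of_forall fun y => hbd y x₀ (by simp)), ?_⟩
  refine hasFDerivAt_integral_of_dominated_of_fderiv_le (bound := fun y => ∑ i, B i y) hx
    (F' := fun x y => -(φ y) • fderiv ℝ (k t) (y - x - H.mean T t))
    (Eventually.of_forall fun x => hk.aestronglyMeasurable hφm t x)
    (hk.integrable hφm hφ ht x₀) hmeas (Eventually.of_forall hbd) hBs ?_
  refine Eventually.of_forall fun y x _ => ?_
  have h1 := (smooth_differentiable (hk.contDiff t) (y - x - H.mean T t)).hasFDerivAt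
  have h2 : HasFDerivAt (fun x : Rd d => y - x - H.mean T t) (-(ContinuousLinearMap.id ℝ (Rd d))) x :=
    ((hasFDerivAt_id x).const_sub y).sub_const _
  have h3 := (h1.comp x h2).mul_const (φ y)
  refine h3.congr_fderiv ?_
  ext v; simp

lemma differentiable_smear (hk : H.Kern T b k) (hφm : Measurable φ)
    (hφ : ∀ y, |φ y| ≤ Kφ * Real.exp (κ * ‖y‖)) {t : ℝ} (ht : t < T) :
    Differentiable ℝ (H.smear T φ k t) :=
  fun x => (hk.hasFDerivAt_smear hφm hφ ht x).2.differentiableAt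

lemma pd_smear (hk : H.Kern T b k) (hφm : Measurable φ)
    (hφ : ∀ y, |φ y| ≤ Kφ * Real.exp (κ * ‖y‖)) {t : ℝ} (ht : t < T) (i : Fin d) :
    GaussianExpansion.pd i (H.smear T φ k t) =
      fun x => -H.smear T φ (fun t => GaussianExpansion.pd i (k t)) t x := by
  ext x
  obtain ⟨h1, h2⟩ := hk.hasFDerivAt_smear hφm hφ ht x
  rw [GaussianExpansion.pd, h2.fderiv, ContinuousLinearMap.integral_apply h1, smear, ← integral_neg]
  congr 1; ext y
  simp [GaussianExpansion.pd, mul_comm]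

end Kern

end HeatData

/-! ### Lebesgue points -/

section Lebesgue

variable {φ : Rd d → ℝ} {K κ : ℝ}

/-- `x` is a Lebesgue point of `φ`, expressed after rescaling the balls around `x`. -/
def LebPt (φ : Rd d → ℝ) (x : Rd d) : Prop :=
  ∀ R > 0, Tendsto (fun σ : ℝ => ∫ v in Metric.closedBall (0 : Rd d) R, |φ (x + σ • v) - φ x|)
    (𝓝[>] 0) (𝓝 0)

lemma expBound_nonneg (hφ : ∀ y, |φ y| ≤ K * Real.exp (κ * ‖y‖)) : 0 ≤ K :=
  nonneg_of_mul_nonneg_left ((abs_nonneg _).trans (hφ 0)) (Real.exp_pos _)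

/-- Lebesgue's differentiation theorem; the average over the ball of radius `σ R` becomes, after
rescaling, a constant times the integral over the ball of radius `R`. -/
lemma ae_lebPt (hφm : Measurable φ) (hφ : ∀ y, |φ y| ≤ K * Real.exp (κ * ‖y‖)) :
    ∀ᵐ x, LebPt φ x := by
  have hloc : LocallyIntegrable φ := by
    refine LocallyIntegrable.mono (f := fun y : Rd d => K * Real.exp (κ * ‖y‖))
      (Continuous.locallyIntegrable (by fun_prop)) hφm.aestronglyMeasurable
      (Eventually.of_forall fun y => (hφ y).trans (le_abs_self _))
  filter_upwards [IsUnifLocDoublingMeasure.ae_tendsto_average_norm_sub volume hloc 1] with x hx R hR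
  have h1 : Tendsto (fun σ : ℝ => σ * R) (𝓝[>] 0) (𝓝[>] 0) := by
    refine tendsto_nhdsWithin_iff.2 ⟨?_, ?_⟩
    · have : Tendsto (fun σ : ℝ => σ * R) (𝓝 0) (𝓝 (0 * R)) :=
        (continuous_id.mul continuous_const).tendsto 0
      rw [zero_mul] at this
      exact this.mono_left nhdsWithin_le_nhds
    · filter_upwards [self_mem_nhdsWithin] with σ hσ using mul_pos hσ hR
  have h2 := hx (fun _ => x) (fun σ : ℝ => σ * R) h1 (by
    filter_upwards [self_mem_nhdsWithin] with σ hσ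
    have hσ' : (0 : ℝ) < σ := hσ
    exact Metric.mem_closedBall_self (by positivity))
  have h3 := h2.const_mul (R ^ d * volume.real (Metric.closedBall (0 : Rd d) 1))
  rw [mul_zero] at h3
  refine h3.congr' ?_
  filter_upwards [self_mem_nhdsWithin] with σ hσ
  have hσ' : (0 : ℝ) < σ := hσ
  have hv : 0 < volume.real (Metric.closedBall (0 : Rd d) 1) :=
    ENNReal.toReal_pos (Metric.measure_closedBall_pos _ _ one_pos).ne' measure_closedBall_lt_top.ne
  have h4 : ∫ y in Metric.closedBall x (σ * R), ‖φ y - φ x‖ =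
      ∫ w in Metric.closedBall 0 (σ * R), |φ (x + w) - φ x| := by
    have := (measurePreserving_add_left volume x).setIntegral_preimage_emb
      (MeasurableEquiv.addLeft x).measurableEmbedding (fun y => ‖φ y - φ x‖)
      (Metric.closedBall x (σ * R))
    rw [← this]
    congr 2
    ext w; simp
  rw [Measure.setIntegral_comp_smul_of_pos volume (fun w => |φ (x + w) - φ x|) _ hσ',
    smul_closedBall _ _ hR.le, smul_zero, Real.norm_of_nonneg hσ'.le, setAverage_eq, h4,
    Measure.addHaar_real_closedBall' volume x (by positivity : 0 ≤ σ * R)]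
  simp only [finrank_euclideanSpace, Fintype.card_fin, smul_eq_mul, mul_pow]
  field_simp

/-- The definition of a Lebesgue point controls a large ball, and the tail is small uniformly in `σ ≤ 1`
because the growth of `φ` is dominated by the Gaussian. -/
lemma LebPt.tendsto_gauss (hφm : Measurable φ) (hφ : ∀ y, |φ y| ≤ K * Real.exp (κ * ‖y‖))
    {x : Rd d} (hx : LebPt φ x) {c : ℝ} (hc : 0 < c) :
    Tendsto (fun σ : ℝ => ∫ v, Real.exp (-c * ‖v‖ ^ 2) * |φ (x + σ • v) - φ x|)
      (𝓝[>] 0) (𝓝 0) := by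
  have hK := expBound_nonneg hφ
  set A := K * Real.exp (|κ| * ‖x‖) + |φ x| with hA
  set g : Rd d → ℝ := fun v => A * Real.exp (-c * ‖v‖ ^ 2 + |κ| * ‖v‖) with hg
  have hgi : Integrable g := (integrable_exp_neg_sq_add hc _).const_mul _
  have hbd : ∀ σ : ℝ, 0 < σ → σ ≤ 1 → ∀ v, Real.exp (-c * ‖v‖ ^ 2) * |φ (x + σ • v) - φ x| ≤ g v := by
    intro σ h0 h1 v
    have h2 : |φ (x + σ • v)| ≤ K * Real.exp (|κ| * ‖x‖) * Real.exp (|κ| * ‖v‖) := by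
      refine (hφ _).trans ?_
      rw [mul_assoc, ← Real.exp_add]
      gcongr
      rw [← mul_add]
      have h3 : ‖x + σ • v‖ ≤ ‖x‖ + ‖v‖ := (norm_add_le _ _).trans (by
        rw [norm_smul, Real.norm_of_nonneg h0.le]; nlinarith [norm_nonneg v])
      calc κ * ‖x + σ • v‖ ≤ |κ| * ‖x + σ • v‖ :=
            mul_le_mul_of_nonneg_right (le_abs_self _) (norm_nonneg _)
        _ ≤ _ := by gcongr
    have h4 : 1 ≤ Real.exp (|κ| * ‖v‖) := Real.one_le_exp (by positivity)
    have h5 : |φ (x + σ • v) - φ x| ≤ A * Real.exp (|κ| * ‖v‖) := by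
      refine (abs_sub _ _).trans ?_
      rw [hA, add_mul]
      have := abs_nonneg (φ x)
      nlinarith
    calc _ ≤ Real.exp (-c * ‖v‖ ^ 2) * (A * Real.exp (|κ| * ‖v‖)) := by gcongr
      _ = g v := by rw [hg]; simp only [Real.exp_add]; ring
  have hint : ∀ σ : ℝ, 0 < σ → σ ≤ 1 →
      Integrable fun v => Real.exp (-c * ‖v‖ ^ 2) * |φ (x + σ • v) - φ x| := by
    intro σ h0 h1
    refine hgi.mono' ?_ (Eventually.of_forall fun v => ?_)
    · refine Measurable.aestronglyMeasurable (Measurable.mul (by fun_prop) ?_)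
      have : Measurable fun v : Rd d => φ (x + σ • v) := hφm.comp (by fun_prop)
      exact (this.sub_const _).norm
    · rw [Real.norm_of_nonneg (by positivity)]
      exact hbd σ h0 h1 v
  have htail := (aecover_closedBall (μ := volume) (x := (0 : Rd d))
    (tendsto_id (α := ℝ) (x := atTop))).integral_tendsto_of_countably_generated hgi
  rw [Metric.tendsto_nhds]
  intro ε hε
  obtain ⟨R, hR1, hR2⟩ := ((Metric.tendsto_nhds.1 htail (ε / 2) (half_pos hε)).and
    (eventually_gt_atTop 0)).exists
  have h01 : Ioc (0 : ℝ) 1 ∈ 𝓝[>] (0 : ℝ) := Ioc_mem_nhdsGT one_pos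
  filter_upwards [h01, Metric.tendsto_nhds.1 (hx R hR2) (ε / 2) (half_pos hε)] with σ hσ hσ2
  have hi := hint σ hσ.1 hσ.2
  rw [Real.dist_eq, sub_zero] at hσ2 ⊢
  rw [abs_of_nonneg (integral_nonneg fun v => by positivity),
    ← integral_add_compl (s := Metric.closedBall (0 : Rd d) R) measurableSet_closedBall hi]
  have h6 : ∫ v in Metric.closedBall (0 : Rd d) R,
      Real.exp (-c * ‖v‖ ^ 2) * |φ (x + σ • v) - φ x| < ε / 2 := by
    refine lt_of_le_of_lt ?_ (lt_of_abs_lt hσ2)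
    refine integral_mono_of_nonneg (Eventually.of_forall fun v => by positivity) ?_
      (Eventually.of_forall fun v => ?_)
    · refine Measure.integrableOn_of_bounded (M := A * Real.exp (|κ| * R)) (measure_closedBall_lt_top).ne ?_ ?_
      · have : Measurable fun v : Rd d => φ (x + σ • v) := hφm.comp (by fun_prop)
        exact (this.sub_const _).norm.aestronglyMeasurable
      · refine (ae_restrict_iff' measurableSet_closedBall).2 (Eventually.of_forall fun v hv => ?_)
        have h7 := hbd σ hσ.1 hσ.2 v
        rw [hg] at h7
        simp only [Real.exp_add] at h7
        rw [mul_left_comm] at h7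
        have h8 := le_of_mul_le_mul_left h7 (Real.exp_pos _)
        rw [norm_abs_eq_norm, Real.norm_eq_abs]
        refine h8.trans ?_
        have : ‖v‖ ≤ R := by simpa using hv
        gcongr
    · exact mul_le_of_le_one_left (abs_nonneg _)
        (Real.exp_le_one_iff.2 (by nlinarith [sq_nonneg ‖v‖]))
  have h7 : ∫ v in (Metric.closedBall (0 : Rd d) R)ᶜ,
      Real.exp (-c * ‖v‖ ^ 2) * |φ (x + σ • v) - φ x| < ε / 2 := by
    have h8 : ∫ v in (Metric.closedBall (0 : Rd d) R)ᶜ, g v < ε / 2 := by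
      rw [setIntegral_compl measurableSet_closedBall hgi]
      rw [Real.dist_eq, abs_sub_comm] at hR1
      exact lt_of_abs_lt hR1
    refine lt_of_le_of_lt ?_ h8
    exact integral_mono_of_nonneg (Eventually.of_forall fun v => by positivity) hgi.integrableOn
      (Eventually.of_forall fun v => hbd σ hσ.1 hσ.2 v)
  linarith

end Lebesgue

namespace HeatData

variable {H : HeatData d} {T : ℝ} {b : ℕ} {k : ℝ → Rd d → ℝ} {φ : Rd d → ℝ} {Kφ κ : ℝ}

namespace Kern

/-- The growth rate `κ` of `φ` is preserved, whatever its sign; for `κ < 0` this means decay. -/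
lemma growth (hk : H.Kern T b k) (hφ : ∀ y, |φ y| ≤ Kφ * Real.exp (κ * ‖y‖)) (S : ℝ) :
    ∃ K : ℝ, 0 ≤ K ∧ ∀ t < T, T - t ≤ S → ∀ x,
      |H.smear T φ k t x| * √(T - t) ^ b ≤ K * Real.exp (κ * ‖x‖) := by
  obtain ⟨K, hK, hb⟩ := hk.bound
  have hKφ := expBound_nonneg hφ
  have hΛ := H.Λ_pos
  set h : Rd d → ℝ := fun v => Real.exp (-H.rate * ‖v‖ ^ 2 + (|κ| * √S) * ‖v‖) with hh
  have hhi : Integrable h := integrable_exp_neg_sq_add H.rate_pos _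
  refine ⟨K * Kφ * Real.exp (|κ| * (d * H.Λ * S)) * ∫ v, h v,
    mul_nonneg (by positivity) (integral_nonneg fun v => (Real.exp_pos _).le), fun t ht hS x => ?_⟩
  have hτ : 0 < T - t := sub_pos.2 ht
  set σ := √(T - t) with hσ
  have hσp : 0 < σ := Real.sqrt_pos.2 hτ
  set A := K * Kφ * Real.exp (|κ| * (d * H.Λ * S)) * Real.exp (κ * ‖x‖) with hA
  have hbd : ∀ q, ‖σ ^ b * (k t q * φ (q + (x + H.mean T t)))‖ ≤ A * ((σ ^ d)⁻¹ * h (σ⁻¹ • q)) := by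
    intro q
    have h1 := hb t ht q
    have h2 : |φ (q + (x + H.mean T t))| ≤ Kφ * (Real.exp (κ * ‖x‖) *
        (Real.exp (|κ| * (d * H.Λ * S)) * Real.exp (|κ| * √S * ‖σ⁻¹ • q‖))) := by
      refine (hφ _).trans ?_
      rw [← Real.exp_add, ← Real.exp_add]
      gcongr
      have h3 : |‖q + (x + H.mean T t)‖ - ‖x‖| ≤ ‖q‖ + ‖H.mean T t‖ := by
        refine (abs_norm_sub_norm_le _ _).trans ?_
        rw [show q + (x + H.mean T t) - x = q + H.mean T t by abel]
        exact norm_add_le _ _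
      have h4 : ‖H.mean T t‖ ≤ d * H.Λ * S := (H.norm_mean_le T ht.le).trans (by gcongr)
      have h5 : ‖q‖ ≤ √S * ‖σ⁻¹ • q‖ := by
        rw [norm_inv_smul hσp, mul_div_assoc', le_div_iff₀ hσp, mul_comm]
        exact mul_le_mul_of_nonneg_right (Real.sqrt_le_sqrt hS) (norm_nonneg _)
      have h6 : κ * (‖q + (x + H.mean T t)‖ - ‖x‖) ≤ |κ| * (√S * ‖σ⁻¹ • q‖ + d * H.Λ * S) := by
        refine (le_abs_self _).trans ?_
        rw [abs_mul]
        gcongr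
        linarith
      linarith
    rw [norm_mul, norm_mul, Real.norm_of_nonneg (by positivity : 0 ≤ σ ^ b), Real.norm_eq_abs,
      Real.norm_eq_abs]
    calc σ ^ b * (|k t q| * |φ (q + (x + H.mean T t))|)
        = |k t q| * σ ^ b * |φ (q + (x + H.mean T t))| := by ring
      _ ≤ K * heatK H.rate σ q * (Kφ * (Real.exp (κ * ‖x‖) *
        (Real.exp (|κ| * (d * H.Λ * S)) * Real.exp (|κ| * √S * ‖σ⁻¹ • q‖)))) :=
          mul_le_mul h1 h2 (abs_nonneg _) ((by positivity : (0:ℝ) ≤ |k t q| * σ ^ b).trans h1)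
      _ = A * ((σ ^ d)⁻¹ * h (σ⁻¹ • q)) := by
          rw [hh, heatK, hA]; simp only [Real.exp_add]; ring
  have hint : Integrable fun q => A * ((σ ^ d)⁻¹ * h (σ⁻¹ • q)) :=
    ((hhi.comp_smul (inv_ne_zero hσp.ne')).const_mul _).const_mul _
  have h7 := norm_integral_le_of_norm_le hint (Eventually.of_forall hbd)
  rw [integral_const_mul, integral_const_mul, ← smear_eq, integral_rescale hσp, norm_mul,
    Real.norm_of_nonneg (by positivity : 0 ≤ σ ^ b), Real.norm_eq_abs] at h7
  rw [mul_comm]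
  refine h7.trans (le_of_eq ?_)
  rw [hA]; ring

/-- Rescaled kernels only see the values near a Lebesgue point. -/
lemma tendsto_smear_sub (hk : H.Kern T b k) (hφm : Measurable φ)
    (hφ : ∀ y, |φ y| ≤ Kφ * Real.exp (κ * ‖y‖)) {x : Rd d} (hx : LebPt φ x) :
    Tendsto (fun t => √(T - t) ^ b * (H.smear T φ k t x - φ x * ∫ q, k t q)) (𝓝[<] T) (𝓝 0) := by
  obtain ⟨K, hK, hb⟩ := hk.bound
  have hΛ := H.Λ_pos
  have hr := H.rate_pos
  have hσ0 : Tendsto (fun t => √(T - t)) (𝓝[<] T) (𝓝[>] 0) := by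
    refine tendsto_nhdsWithin_iff.2 ⟨?_, ?_⟩
    · have : Tendsto (fun t => √(T - t)) (𝓝 T) (𝓝 (√(T - T))) :=
        (by fun_prop : Continuous fun t => √(T - t)).tendsto T
      rw [sub_self, Real.sqrt_zero] at this
      exact this.mono_left nhdsWithin_le_nhds
    · filter_upwards [self_mem_nhdsWithin] with t ht
      exact Real.sqrt_pos.2 (sub_pos.2 ht)
  have hlim := ((hx.tendsto_gauss hφm hφ (half_pos hr)).comp hσ0).const_mul
    (K * Real.exp (H.rate * (d * H.Λ) ^ 2))
  rw [mul_zero] at hlim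
  refine squeeze_zero_norm' ?_ hlim
  have h1 : Ioo (T - 1) T ∈ 𝓝[<] T := Ioo_mem_nhdsLT (by linarith)
  filter_upwards [h1] with t ht
  have hτ : 0 < T - t := sub_pos.2 ht.2
  have hτ1 : T - t ≤ 1 := by have := ht.1; linarith
  set σ := √(T - t) with hσ
  have hσp : 0 < σ := Real.sqrt_pos.2 hτ
  set A := K * Real.exp (H.rate * (d * H.Λ) ^ 2) with hA
  set m := H.mean T t with hm
  have hmσ : ‖σ⁻¹ • m‖ ≤ d * H.Λ := by
    rw [norm_inv_smul hσp, div_le_iff₀ hσp]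
    refine (H.norm_mean_le T ht.2.le).trans ?_
    gcongr
    rw [← Real.sq_sqrt hτ.le, ← hσ, sq]
    have : σ ≤ 1 := Real.sqrt_le_one.2 hτ1
    nlinarith
  have hone : ∀ y : Rd d, |(fun _ => (1:ℝ)) y| ≤ 1 * Real.exp (0 * ‖y‖) := fun y => by simp
  have hi1 := hk.integrable hφm hφ ht.2 x
  have hi2 := hk.integrable (φ := fun _ => (1:ℝ)) measurable_const hone ht.2 x
  have hmass : ∫ q, k t q = ∫ y, k t (y - x - m) * 1 := by
    have := H.smear_eq T (fun _ => 1) k t x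
    rw [smear] at this
    simpa using this.symm
  have e1 : H.smear T φ k t x - φ x * ∫ q, k t q = ∫ z, k t (z - m) * (φ (x + z) - φ x) := by
    rw [hmass, smear, ← integral_const_mul, ← integral_sub hi1 (hi2.const_mul _),
      ← integral_add_right_eq_self _ x]
    congr 1; ext z
    rw [show z + x - x - m = z - m by abel, add_comm z x]
    ring
  rw [e1, ← integral_const_mul]
  have hbd : ∀ z, ‖σ ^ b * (k t (z - m) * (φ (x + z) - φ x))‖ ≤
      A * ((σ ^ d)⁻¹ * (Real.exp (-(H.rate / 2) * ‖σ⁻¹ • z‖ ^ 2) *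
        |φ (x + σ • (σ⁻¹ • z)) - φ x|)) := by
    intro z
    rw [smul_smul, mul_inv_cancel₀ hσp.ne', one_smul, norm_mul, norm_mul,
      Real.norm_of_nonneg (by positivity : 0 ≤ σ ^ b), Real.norm_eq_abs, Real.norm_eq_abs]
    have h2 := hb t ht.2 (z - m)
    have h3 : Real.exp (-H.rate * ‖σ⁻¹ • (z - m)‖ ^ 2) ≤
        Real.exp (H.rate * (d * H.Λ) ^ 2) * Real.exp (-(H.rate / 2) * ‖σ⁻¹ • z‖ ^ 2) := by
      rw [← Real.exp_add, Real.exp_le_exp, smul_sub]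
      have h4 := sq_norm_ge (σ⁻¹ • z) (σ⁻¹ • m)
      have h5 : ‖σ⁻¹ • m‖ ^ 2 ≤ (d * H.Λ) ^ 2 := by gcongr
      nlinarith
    calc σ ^ b * (|k t (z - m)| * |φ (x + z) - φ x|)
        = |k t (z - m)| * σ ^ b * |φ (x + z) - φ x| := by ring
      _ ≤ K * heatK H.rate σ (z - m) * |φ (x + z) - φ x| := by gcongr
      _ ≤ K * ((σ ^ d)⁻¹ * (Real.exp (H.rate * (d * H.Λ) ^ 2) *
          Real.exp (-(H.rate / 2) * ‖σ⁻¹ • z‖ ^ 2))) * |φ (x + z) - φ x| := by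
          rw [heatK]; gcongr
      _ = _ := by rw [hA]; ring
  have hint : Integrable fun z => A * ((σ ^ d)⁻¹ * (Real.exp (-(H.rate / 2) * ‖σ⁻¹ • z‖ ^ 2) *
        |φ (x + σ • (σ⁻¹ • z)) - φ x|)) := by
    have hKφ := expBound_nonneg hφ
    have hi3 : Integrable fun v : Rd d => Real.exp (-(H.rate / 2) * ‖v‖ ^ 2) *
        |φ (x + σ • v) - φ x| := by
      have hg := ((integrable_exp_neg_sq_add (d := d) (half_pos hr) (|κ| * σ)).const_mul
        (Kφ * Real.exp (|κ| * ‖x‖))).add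
        ((integrable_exp_neg_sq_add (d := d) (half_pos hr) 0).const_mul |φ x|)
      refine hg.mono' ?_ (Eventually.of_forall fun v => ?_)
      · have : Measurable fun v : Rd d => φ (x + σ • v) := hφm.comp (by fun_prop)
        exact Measurable.aestronglyMeasurable
          (Measurable.mul (by fun_prop) (this.sub_const _).norm)
      · rw [Real.norm_of_nonneg (by positivity)]
        have h2 : |φ (x + σ • v)| ≤ Kφ * (Real.exp (|κ| * ‖x‖) * Real.exp (|κ| * σ * ‖v‖)) := by
          refine (hφ _).trans ?_
          rw [← Real.exp_add]
          gcongr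
          have h3 : ‖x + σ • v‖ ≤ ‖x‖ + σ * ‖v‖ := (norm_add_le _ _).trans (by
            rw [norm_smul, Real.norm_of_nonneg hσp.le])
          calc κ * ‖x + σ • v‖ ≤ |κ| * ‖x + σ • v‖ :=
                mul_le_mul_of_nonneg_right (le_abs_self _) (norm_nonneg _)
            _ ≤ |κ| * (‖x‖ + σ * ‖v‖) := by gcongr
            _ = _ := by ring
        simp only [Pi.add_apply, zero_mul, add_zero, Real.exp_add]
        have h3 := (abs_sub (φ (x + σ • v)) (φ x)).trans (add_le_add_left h2 _)
        calc _ ≤ Real.exp (-(H.rate / 2) * ‖v‖ ^ 2) * _ :=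
              mul_le_mul_of_nonneg_left h3 (Real.exp_pos _).le
          _ = _ := by ring
    exact ((hi3.comp_smul (inv_ne_zero hσp.ne')).const_mul _).const_mul _
  refine (norm_integral_le_of_norm_le hint (Eventually.of_forall hbd)).trans (le_of_eq ?_)
  rw [integral_const_mul, integral_rescale hσp (fun v => Real.exp (-(H.rate / 2) * ‖v‖ ^ 2) *
      |φ (x + σ • v) - φ x|)]
  rfl

end Kern

end HeatData

namespace HeatData

/-! ### The Cauchy problem with coefficients independent of the space variable -/

variable (H : HeatData d) (T : ℝ)

/-- The operator `½ ∑ C_{ij}(t) ∂_{ij} + ⟨m(t), ∇⟩ + γ(t)`. -/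
noncomputable def gen (t : ℝ) (f : Rd d → ℝ) (x : Rd d) : ℝ :=
  1 / 2 * ∑ i, ∑ j, H.C t i j * pd i (pd j f) x + ∑ i, H.m t i * pd i f x + H.γ t * f x

/-- The Gaussian solution `e^{∫_t^T γ} ∫ Γ(t, y - x - 𝐦(t,T)) φ(y) dy`. -/
noncomputable def sol (φ : Rd d → ℝ) (t : ℝ) (x : Rd d) : ℝ :=
  Real.exp (∫ s in t..T, H.γ s) * H.smear T φ (H.gauss T) t x

variable {H T} {φ : Rd d → ℝ} {Kφ κ : ℝ}

/-- The equation for the density, integrated against `φ`; the signs of the first-order terms reflect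
that the density is evaluated at `y - x - 𝐦(t,T)`. -/
lemma hasDerivAt_smear_gauss (hφm : Measurable φ) (hφ : ∀ y, |φ y| ≤ Kφ * Real.exp (κ * ‖y‖))
    {t : ℝ} (ht : t < T) (x : Rd d) :
    HasDerivAt (fun s => H.smear T φ (H.gauss T) s x)
      (-(1 / 2 * ∑ i, ∑ j, H.C t i j * H.smear T φ (fun s => pd i (pd j (H.gauss T s))) t x) +
        ∑ i, H.m t i * H.smear T φ (fun s => pd i (H.gauss T s)) t x) t := by
  have hk0 : H.Kern T 0 (H.gauss T) := Kern.gauss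
  have hk1 : ∀ i, H.Kern T 1 fun s => pd i (H.gauss T s) := fun i => hk0.pd i
  have hk2 : ∀ i j, H.Kern T 2 fun s => pd i (pd j (H.gauss T s)) := fun i j => (hk1 j).pd i
  choose B1 hB1 h1 using fun i => (hk1 i).dominated hφ ht ‖x‖
  choose B2 hB2 h2 using fun i j => (hk2 i j).dominated hφ ht ‖x‖
  have hev : ∀ᶠ s in 𝓝 t, s < T ∧ (∀ i y, ‖pd i (H.gauss T s) (y - x - H.mean T s) * φ y‖ ≤ B1 i y) ∧
      ∀ i j y, ‖pd i (pd j (H.gauss T s)) (y - x - H.mean T s) * φ y‖ ≤ B2 i j y := by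
    refine (gt_mem_nhds ht).and (Eventually.and ?_ ?_)
    · exact eventually_all.2 fun i => (h1 i).mono fun s hs y => hs x le_rfl y
    · exact eventually_all.2 fun i => eventually_all.2 fun j =>
        (h2 i j).mono fun s hs y => hs x le_rfl y
  set F' : ℝ → Rd d → ℝ := fun s y =>
    (-(1 / 2 * ∑ i, ∑ j, H.C s i j * pd i (pd j (H.gauss T s)) (y - x - H.mean T s)) +
        ∑ i, H.m s i * pd i (H.gauss T s) (y - x - H.mean T s)) * φ y with hF'
  have hF'2 : ∀ s y, F' s y =
      -(1 / 2 * ∑ i, ∑ j, H.C s i j * (pd i (pd j (H.gauss T s)) (y - x - H.mean T s) * φ y)) +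
        ∑ i, H.m s i * (pd i (H.gauss T s) (y - x - H.mean T s) * φ y) := by
    intro s y
    simp only [hF', add_mul, neg_mul, mul_assoc, Finset.sum_mul]
  have hi1 : ∀ i, Integrable fun y => H.m t i * (pd i (H.gauss T t) (y - x - H.mean T t) * φ y) :=
    fun i => ((hk1 i).integrable hφm hφ ht x).const_mul _
  have hi2 : ∀ i j, Integrable fun y =>
      H.C t i j * (pd i (pd j (H.gauss T t)) (y - x - H.mean T t) * φ y) :=
    fun i j => ((hk2 i j).integrable hφm hφ ht x).const_mul _
  have hi3 : Integrable fun y =>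
      ∑ i, ∑ j, H.C t i j * (pd i (pd j (H.gauss T t)) (y - x - H.mean T t) * φ y) :=
    integrable_finsetSum _ fun i _ => integrable_finsetSum _ fun j _ => hi2 i j
  have hi4 : Integrable fun y => ∑ i, H.m t i * (pd i (H.gauss T t) (y - x - H.mean T t) * φ y) :=
    integrable_finsetSum _ fun i _ => hi1 i
  have hF'i : Integrable (F' t) := by
    have : F' t = fun y => _ := funext fun y => hF'2 t y
    rw [this]
    exact (hi3.const_mul _).neg.add hi4
  have hbi : Integrable fun y => 1 / 2 * ∑ i, ∑ j, H.Λ * B2 i j y + ∑ i, H.Λ * B1 i y :=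
    ((integrable_finsetSum _ fun i _ => integrable_finsetSum _ fun j _ =>
      (hB2 i j).const_mul _).const_mul _).add (integrable_finsetSum _ fun i _ => (hB1 i).const_mul _)
  have key := (hasDerivAt_integral_of_dominated_loc_of_deriv_le (μ := volume)
    (F := fun s y => H.gauss T s (y - x - H.mean T s) * φ y) (F' := F')
    (bound := fun y => 1 / 2 * ∑ i, ∑ j, H.Λ * B2 i j y + ∑ i, H.Λ * B1 i y) hev
    (Eventually.of_forall fun s => hk0.aestronglyMeasurable hφm s x)
    (hk0.integrable hφm hφ ht x) hF'i.aestronglyMeasurable (Eventually.of_forall fun y s hs => ?_) hbi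
    (Eventually.of_forall fun y s hs => ?_)).2
  · refine key.congr_deriv ?_
    have : F' t = fun y => _ := funext fun y => hF'2 t y
    have hn : Integrable fun y => -(1 / 2 * ∑ i, ∑ j, H.C t i j *
        (pd i (pd j (H.gauss T t)) (y - x - H.mean T t) * φ y)) := (hi3.const_mul _).neg
    rw [this]
    beta_reduce
    rw [integral_add hn hi4, integral_neg, integral_const_mul,
      integral_finsetSum _ fun i _ => hi1 i,
      integral_finsetSum _ fun i _ => integrable_finsetSum _ fun j _ => hi2 i j]
    simp_rw [integral_finsetSum _ fun j _ => hi2 _ j, integral_const_mul]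
    rfl
  · obtain ⟨-, hs1, hs2⟩ := hs
    rw [hF'2]
    refine (norm_add_le _ _).trans (add_le_add ?_ ?_)
    · rw [norm_neg, norm_mul, Real.norm_of_nonneg (by norm_num : (0:ℝ) ≤ 1 / 2)]
      refine mul_le_mul_of_nonneg_left ?_ (by norm_num)
      refine (norm_sum_le _ _).trans (Finset.sum_le_sum fun i _ => (norm_sum_le _ _).trans
        (Finset.sum_le_sum fun j _ => ?_))
      rw [norm_mul]
      exact mul_le_mul (H.boundC s i j) (hs2 i j y) (norm_nonneg _) H.Λ_pos.le
    · refine (norm_sum_le _ _).trans (Finset.sum_le_sum fun i _ => ?_)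
      rw [norm_mul]
      exact mul_le_mul (H.boundm s i) (hs1 i y) (norm_nonneg _) H.Λ_pos.le
  · have := H.hasDerivAt_gauss T hs.1 (y - x)
    exact this.mul_const (φ y)

lemma smear_const_mul_pd (a : ℝ) {b : ℕ} {k : ℝ → Rd d → ℝ} (hk : H.Kern T b k)
    (hφm : Measurable φ) (hφ : ∀ y, |φ y| ≤ Kφ * Real.exp (κ * ‖y‖)) {t : ℝ} (ht : t < T)
    (i : Fin d) :
    pd i (fun x => a * H.smear T φ k t x) =
      fun x => -a * H.smear T φ (fun s => pd i (k s)) t x := by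
  rw [pd_const_mul, hk.pd_smear hφm hφ ht]
  ext x; ring

section sol

variable (hφm : Measurable φ) (hφ : ∀ y, |φ y| ≤ Kφ * Real.exp (κ * ‖y‖))
include hφm hφ

lemma pdL_sol {t : ℝ} (ht : t < T) (L : List (Fin d)) :
    pdL L (H.sol T φ t) = fun x => Real.exp (∫ s in t..T, H.γ s) * (-1) ^ L.length *
      H.smear T φ (fun s => pdL L (H.gauss T s)) t x := by
  induction L with
  | nil => ext x; simp [sol]
  | cons i L ih =>
    rw [pdL_cons, ih, smear_const_mul_pd _ (Kern.gauss.pdL L) hφm hφ ht]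
    ext x
    simp only [List.length_cons, pdL_cons, pow_succ]
    ring

/-- The integrals against kernels of arbitrary order are stable under derivatives. -/
lemma contDiff_sol {t : ℝ} (ht : t < T) : ContDiff ℝ ∞ (H.sol T φ t) := by
  refine contDiff_of_pd_stable
    {f | ∃ (a : ℝ) (b : ℕ) (k : ℝ → Rd d → ℝ), H.Kern T b k ∧ f = fun x => a * H.smear T φ k t x}
    ?_ ?_ _ ⟨Real.exp (∫ s in t..T, H.γ s), 0, H.gauss T, Kern.gauss, rfl⟩
  · rintro f ⟨a, b, k, hk, rfl⟩
    exact (hk.differentiable_smear hφm hφ ht).const_mul _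
  · rintro f ⟨a, b, k, hk, rfl⟩ i
    exact ⟨-a, b + 1, _, hk.pd i, smear_const_mul_pd a hk hφm hφ ht i⟩

lemma continuousOn_pdL_sol (L : List (Fin d)) :
    ContinuousOn (fun p : ℝ × Rd d => pdL L (H.sol T φ p.1) p.2) (Iio T ×ˢ univ) := by
  have h1 : Continuous fun p : ℝ × Rd d => Real.exp (∫ s in p.1..T, H.γ s) := by
    refine Real.continuous_exp.comp (Continuous.comp (g := fun t => ∫ s in t..T, H.γ s) ?_
      continuous_fst)
    refine continuous_iff_continuousAt.2 fun t => (intervalIntegral.integral_hasDerivAt_left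
      (H.contγ.intervalIntegrable _ _) (H.contγ.stronglyMeasurableAtFilter _ _)
      H.contγ.continuousAt).continuousAt
  have h2 := ((h1.mul (continuous_const (y := (-1 : ℝ) ^ L.length))).continuousOn
    (s := Iio T ×ˢ univ)).mul ((Kern.gauss (H := H) (T := T)).pdL L |>.continuousOn_smear hφm hφ)
  refine h2.congr fun p hp => ?_
  rw [pdL_sol hφm hφ hp.1]
  rfl

/-- Each space derivative of the Gaussian solution costs a factor `(T - t)^{-1/2}`. -/
lemma growth_pdL_sol (L : List (Fin d)) (S : ℝ) : ∃ K : ℝ, 0 ≤ K ∧ ∀ t < T, T - t ≤ S → ∀ x,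
    |pdL L (H.sol T φ t) x| * √(T - t) ^ L.length ≤ K * Real.exp (κ * ‖x‖) := by
  have hg := ((Kern.gauss (H := H) (T := T)).pdL L).growth hφ S
  rw [zero_add] at hg
  obtain ⟨K, hK, h⟩ := hg
  have hΛ := H.Λ_pos
  refine ⟨Real.exp (H.Λ * S) * K, by positivity, fun t ht hS x => ?_⟩
  rw [pdL_sol hφm hφ ht]
  simp only [abs_mul, abs_pow, abs_neg, abs_one, one_pow, mul_one, Real.abs_exp]
  rw [mul_assoc, mul_assoc]
  refine mul_le_mul ?_ (h t ht hS x) (by positivity) (Real.exp_pos _).le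
  rw [Real.exp_le_exp]
  refine (le_abs_self _).trans ((abs_integral_le T H.boundγ ht.le).trans ?_)
  gcongr

omit hφm hφ in
lemma integral_gauss {t : ℝ} (ht : t < T) : ∫ q, H.gauss T t q = 1 := by
  have hS := H.spectralBounds T ht
  have hp : 0 < (2 * Real.pi) ^ d * (H.cov T t).det := mul_pos (by positivity) hS.det_pos
  simp only [gauss]
  rw [integral_const_mul, integral_exp_neg_qform_inv hS, one_div, inv_mul_cancel₀]
  exact (Real.sqrt_pos.2 hp).ne'

omit hφm hφ in
/-- The derivatives of the density have mean zero, as the solution with datum `1` is constant in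
space. -/
lemma integral_pdL_gauss {t : ℝ} (ht : t < T) {L : List (Fin d)} (hL : L ≠ []) :
    ∫ q, pdL L (H.gauss T t) q = 0 := by
  have hone : ∀ y : Rd d, |(fun _ => (1:ℝ)) y| ≤ 1 * Real.exp (0 * ‖y‖) := fun y => by simp
  have h1 := pdL_sol (H := H) (T := T) (φ := fun _ => 1) measurable_const hone ht L
  have h2 : H.sol T (fun _ => 1) t = fun _ => Real.exp (∫ s in t..T, H.γ s) := by
    ext x
    rw [sol, smear_eq]
    simp [integral_gauss ht]
  have h3 : ∀ (L : List (Fin d)) (c : ℝ), L ≠ [] → pdL L (fun _ : Rd d => c) = fun _ => 0 := by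
    intro L
    induction L with
    | nil => intro c h; exact absurd rfl h
    | cons i L ih =>
      intro c _
      rcases eq_or_ne L [] with rfl | hne
      · simp [pd_const]
      · rw [pdL_cons, ih c hne, pd_const]
  rw [h2, h3 L _ hL] at h1
  have h4 := congrFun h1 0
  rw [smear_eq] at h4
  simpa using h4.symm

/-- At Lebesgue points the bound `O((T - t)^{-|L|/2})` improves to `o((T - t)^{-|L|/2})`, because the
kernel `∂^L Γ` has mean zero. -/
lemma tendsto_pdL_sol {x : Rd d} (hx : LebPt φ x) {L : List (Fin d)} (hL : L ≠ []) :
    Tendsto (fun t => √(T - t) ^ L.length * pdL L (H.sol T φ t) x) (𝓝[<] T) (𝓝 0) := by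
  have h1 := ((Kern.gauss (H := H) (T := T)).pdL L).tendsto_smear_sub hφm hφ hx
  rw [zero_add] at h1
  have h2 : Tendsto (fun t => Real.exp (∫ s in t..T, H.γ s) * (-1) ^ L.length) (𝓝[<] T)
      (𝓝 (Real.exp (∫ s in T..T, H.γ s) * (-1) ^ L.length)) := by
    have : ContinuousAt (fun t => ∫ s in t..T, H.γ s) T := (intervalIntegral.integral_hasDerivAt_left
      (H.contγ.intervalIntegrable _ _) (H.contγ.stronglyMeasurableAtFilter _ _)
      H.contγ.continuousAt).continuousAt
    exact ((this.tendsto.mono_left nhdsWithin_le_nhds).rexp).mul_const _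
  have h3 := h2.mul h1
  rw [mul_zero] at h3
  refine h3.congr' ?_
  filter_upwards [self_mem_nhdsWithin] with t ht
  rw [pdL_sol hφm hφ ht, integral_pdL_gauss ht hL]
  ring

lemma tendsto_sol {x : Rd d} (hx : LebPt φ x) :
    Tendsto (fun t => H.sol T φ t x) (𝓝[<] T) (𝓝 (φ x)) := by
  have h1 := (Kern.gauss (H := H) (T := T)).tendsto_smear_sub hφm hφ hx
  have h2 : Tendsto (fun t => Real.exp (∫ s in t..T, H.γ s)) (𝓝[<] T)
      (𝓝 (Real.exp (∫ s in T..T, H.γ s))) := by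
    have : ContinuousAt (fun t => ∫ s in t..T, H.γ s) T := (intervalIntegral.integral_hasDerivAt_left
      (H.contγ.intervalIntegrable _ _) (H.contγ.stronglyMeasurableAtFilter _ _)
      H.contγ.continuousAt).continuousAt
    exact ((this.tendsto.mono_left nhdsWithin_le_nhds).rexp)
  have h3 := h2.mul (h1.add_const (φ x))
  rw [intervalIntegral.integral_same, Real.exp_zero, one_mul, zero_add] at h3
  refine h3.congr' ?_
  filter_upwards [self_mem_nhdsWithin] with t ht
  rw [integral_gauss ht, sol]
  ring

lemma hasDerivAt_sol {t : ℝ} (ht : t < T) (x : Rd d) :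
    HasDerivAt (fun s => H.sol T φ s x) (-H.gen t (H.sol T φ t) x) t := by
  have h1 : HasDerivAt (fun t => ∫ s in t..T, H.γ s) (-H.γ t) t :=
    intervalIntegral.integral_hasDerivAt_left
      (H.contγ.intervalIntegrable _ _) (H.contγ.stronglyMeasurableAtFilter _ _)
      H.contγ.continuousAt
  have h2 := h1.exp.mul (hasDerivAt_smear_gauss (H := H) hφm hφ ht x)
  refine h2.congr_deriv ?_
  have e1 : ∀ i, pd i (H.sol T φ t) x = Real.exp (∫ s in t..T, H.γ s) * (-1) *
      H.smear T φ (fun s => pd i (H.gauss T s)) t x := fun i => by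
    have := congrFun (pdL_sol (H := H) hφm hφ ht [i]) x
    simpa using this
  have e2 : ∀ i j, pd i (pd j (H.sol T φ t)) x = Real.exp (∫ s in t..T, H.γ s) *
      H.smear T φ (fun s => pd i (pd j (H.gauss T s))) t x := fun i j => by
    have := congrFun (pdL_sol (H := H) hφm hφ ht [i, j]) x
    simpa using this
  simp only [gen, e1, e2, sol]
  have e3 : ∑ i, ∑ j, H.C t i j * (Real.exp (∫ s in t..T, H.γ s) *
      H.smear T φ (fun s => pd i (pd j (H.gauss T s))) t x) = Real.exp (∫ s in t..T, H.γ s) *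
      ∑ i, ∑ j, H.C t i j * H.smear T φ (fun s => pd i (pd j (H.gauss T s))) t x := by
    simp only [Finset.mul_sum]
    exact Finset.sum_congr rfl fun i _ => Finset.sum_congr rfl fun j _ => by ring
  have e4 : ∑ i, H.m t i * (Real.exp (∫ s in t..T, H.γ s) * (-1) *
      H.smear T φ (fun s => pd i (H.gauss T s)) t x) = -(Real.exp (∫ s in t..T, H.γ s) *
      ∑ i, H.m t i * H.smear T φ (fun s => pd i (H.gauss T s)) t x) := by
    simp only [Finset.mul_sum, ← Finset.sum_neg_distrib]
    exact Finset.sum_congr rfl fun i _ => by ring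
  rw [e3, e4]
  ring

end sol

end HeatData

/-! ### Coefficients that are continuous on the whole line -/

/-- On polynomials of bounded degree the coefficients are linear combinations of values, so they
depend continuously on a parameter if the values do. -/
lemma continuous_coeff_of_continuous_eval {X : Type*} [TopologicalSpace X]
    {p : X → MvPolynomial (Fin d) ℝ} {k : ℕ} (hdeg : ∀ s, (p s).totalDegree ≤ k)
    (hp : ∀ x : Fin d → ℝ, Continuous fun s => MvPolynomial.eval x (p s)) (β : Fin d →₀ ℕ) :
    Continuous fun s => (p s).coeff β := by
  let V := MvPolynomial.restrictTotalDegree (Fin d) ℝ k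
  let ev : (Fin d → ℝ) → Module.Dual ℝ V := fun x =>
    (MvPolynomial.aeval x : MvPolynomial (Fin d) ℝ →ₐ[ℝ] ℝ).toLinearMap.comp V.subtype
  have hev : ∀ x (v : V), ev x v = MvPolynomial.eval x (v : MvPolynomial (Fin d) ℝ) := fun x v => by
    simp [ev, MvPolynomial.aeval_eq_eval]
  let W : Subspace ℝ (Module.Dual ℝ V) := Submodule.span ℝ (range ev)
  have hW : W = ⊤ := by
    have h1 : W.dualCoannihilator = ⊥ := by
      refine (Submodule.eq_bot_iff _).2 fun v hv => ?_
      rw [Submodule.mem_dualCoannihilator] at hv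
      have : (v : MvPolynomial (Fin d) ℝ) = 0 := MvPolynomial.funext fun x => by
        rw [← hev, hv _ (Submodule.subset_span ⟨x, rfl⟩), map_zero]
      exact Subtype.ext this
    have h2 := Subspace.dualCoannihilator_dualAnnihilator_eq (W := W)
    rw [h1, Submodule.dualAnnihilator_bot] at h2
    exact h2.symm
  let q : X → V := fun s => ⟨p s, (MvPolynomial.mem_restrictTotalDegree _ _ _).2 (hdeg s)⟩
  have key : ∀ f ∈ W, Continuous fun s => f (q s) := by
    intro f hf
    induction hf using Submodule.span_induction with
    | mem f hf =>
      obtain ⟨x, rfl⟩ := hf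
      simpa only [hev] using hp x
    | zero => exact continuous_const
    | add f g _ _ hf hg => exact hf.add hg
    | smul c f _ hf => exact hf.const_smul c
  have := key ((MvPolynomial.lcoeff ℝ β).comp V.subtype) (by rw [hW]; trivial)
  exact this

namespace Coeffs

/-- The hypotheses on a polynomial expansion, with `[0,T]` replaced by the whole line and
boundedness of the coefficients of `𝓐₀` added. -/
structure Regular (a : Coeffs d) : Prop where
  continuous_coeff : ∀ α ∈ multiIdx d, ∀ (n : ℕ) (β : Fin d →₀ ℕ),
    Continuous fun t => (a α n t).coeff β
  support_subset : ∀ α ∈ multiIdx d, ∀ n : ℕ, ∃ B : Finset (Fin d →₀ ℕ), ∀ t, (a α n t).support ⊆ B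
  zeroth_const : ∀ α ∈ multiIdx d, ∀ t, ∃ c : ℝ, a α 0 t = MvPolynomial.C c
  bounded : ∃ K : ℝ, ∀ α ∈ multiIdx d, ∀ t, |a.zeroth α t| ≤ K
  elliptic : ∃ l : ℝ, 0 < l ∧ ∀ t, ∀ ξ : Fin d → ℝ, l * ∑ i, ξ i ^ 2 ≤ qform (a.diffusion t) ξ

/-- The coefficients frozen outside `[0,T]`. -/
noncomputable def clamp (a : Coeffs d) {T : ℝ} (hT : 0 ≤ T) : Coeffs d :=
  fun α n t => a α n (projIcc 0 T hT t)

lemma clamp_apply (a : Coeffs d) {T : ℝ} (hT : 0 ≤ T) {t : ℝ} (ht : t ∈ Icc 0 T) (α : Fin d → ℕ)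
    (n : ℕ) : a.clamp hT α n t = a α n t := by
  simp [clamp, projIcc_of_mem hT ht]

/-- The bounds on the coefficients of `𝓐₀` come from the compactness of `[0,T]`. -/
lemma regular_clamp {a : Coeffs d} {T : ℝ} (hT : 0 ≤ T) (ha : IsPolynomialExpansion a T) :
    (a.clamp hT).Regular := by
  have hval : ∀ α ∈ multiIdx d, ∀ n, ∀ x : Fin d → ℝ,
      Continuous fun t => MvPolynomial.eval x (a.clamp hT α n t) := by
    intro α hα n x
    have h1 := ha.continuousOn_val α hα n
    have h2 : Continuous fun t : ℝ => ((projIcc 0 T hT t : ℝ), (WithLp.toLp 2 x : Rd d)) :=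
      (continuous_subtype_val.comp continuous_projIcc).prodMk continuous_const
    exact h1.comp_continuous h2 fun t => ⟨(projIcc 0 T hT t).2, mem_univ _⟩
  have hzero : ∀ α ∈ multiIdx d, Continuous fun t => (a.clamp hT).zeroth α t := by
    intro α hα
    exact hval α hα 0 _
  refine ⟨fun α hα n β => ?_, fun α hα n => ?_, fun α hα t => ?_, ?_, ?_⟩
  · obtain ⟨k, hk⟩ := ha.degree_le α hα n
    exact continuous_coeff_of_continuous_eval (k := k) (fun t => hk _ (projIcc 0 T hT t).2)
      (hval α hα n) β
  · obtain ⟨k, hk⟩ := ha.degree_le α hα n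
    refine ⟨(Finset.Iic (Finsupp.equivFunOnFinite.symm fun _ => k)), fun t β hβ => ?_⟩
    rw [Finset.mem_Iic]
    intro i
    have h1 := MvPolynomial.le_totalDegree hβ
    have h2 : β i ≤ β.sum fun _ e => e := by
      rcases eq_or_ne (β i) 0 with h0 | h0
      · omega
      · exact Finset.single_le_sum (f := fun i => β i) (fun _ _ => Nat.zero_le _)
          (Finsupp.mem_support_iff.2 h0)
    have h3 := hk _ (projIcc 0 T hT t).2
    simp only [Finsupp.equivFunOnFinite_symm_apply_apply]
    exact h2.trans (h1.trans h3)
  · exact ha.zeroth_const α hα _ (projIcc 0 T hT t).2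
  · have h1 : ∀ α ∈ multiIdx d, ∃ K, ∀ t, |(a.clamp hT).zeroth α t| ≤ K := by
      intro α hα
      obtain ⟨K, hK⟩ := (isCompact_Icc (a := (0:ℝ)) (b := T)).exists_bound_of_continuousOn
        (hzero α hα).continuousOn
      refine ⟨K, fun t => ?_⟩
      have h2 := hK _ (projIcc 0 T hT t).2
      rw [Real.norm_eq_abs] at h2
      have : (a.clamp hT).zeroth α t = (a.clamp hT).zeroth α (projIcc 0 T hT t) := by
        simp [zeroth, val, clamp]
      rwa [this]
    choose! K hK using h1
    refine ⟨∑ α ∈ multiIdx d, |K α|, fun α hα t => (hK α hα t).trans ((le_abs_self _).trans ?_)⟩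
    exact Finset.single_le_sum (f := fun α => |K α|) (fun _ _ => abs_nonneg _) hα
  · obtain ⟨l, hl, h⟩ := ha.elliptic
    exact ⟨l, hl, fun t ξ => h _ (projIcc 0 T hT t).2 ξ⟩

lemma zero_mem : (0 : Fin d → ℕ) ∈ multiIdx d := mem_multiIdx.2 (by simp)

lemma single_mem (i : Fin d) : Pi.single i 1 ∈ multiIdx d :=
  mem_multiIdx.2 (by rw [sum_single]; norm_num)

lemma pair_mem (i j : Fin d) : Pi.single i 1 + Pi.single j 1 ∈ multiIdx d :=
  mem_multiIdx.2 (by rw [sum_single_pair])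

namespace Regular

variable {a : Coeffs d} (ha : a.Regular)
include ha

lemma continuous_zeroth {α : Fin d → ℕ} (hα : α ∈ multiIdx d) : Continuous fun t => a.zeroth α t := by
  have : (fun t => a.zeroth α t) = fun t => (a α 0 t).coeff 0 := by
    ext t
    obtain ⟨c, hc⟩ := ha.zeroth_const α hα t
    simp [zeroth, val, hc]
  rw [this]
  exact ha.continuous_coeff α hα 0 0

lemma val_zero {α : Fin d → ℕ} (hα : α ∈ multiIdx d) (t : ℝ) (x : Rd d) :
    a.val α 0 t x = a.zeroth α t := by
  obtain ⟨c, hc⟩ := ha.zeroth_const α hα t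
  simp [zeroth, val, hc]

/-- The operator `𝓐₀` as a parabolic operator with coefficients independent of `x`. -/
noncomputable def heat : HeatData d where
  C := a.diffusion
  m := a.drift
  γ := a.potential
  l := ha.elliptic.choose
  Λ := 2 * |ha.bounded.choose| + 1
  contC i j := continuous_const.mul (ha.continuous_zeroth (pair_mem i j))
  contm i := ha.continuous_zeroth (single_mem i)
  contγ := ha.continuous_zeroth zero_mem
  symm t i j := by
    simp only [diffusion, Matrix.of_apply, eq_comm (a := i), add_comm (Pi.single i 1)]
  l_pos := ha.elliptic.choose_spec.1
  Λ_pos := by positivity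
  boundC t i j := by
    have h1 := ha.bounded.choose_spec _ (pair_mem i j) t
    simp only [diffusion, Matrix.of_apply, abs_mul]
    have h2 : |(if i = j then 2 else 1 : ℝ)| ≤ 2 := by split_ifs <;> norm_num
    have h3 := (abs_nonneg _).trans h1
    rw [abs_of_nonneg h3]
    nlinarith [abs_nonneg (a.zeroth (Pi.single i 1 + Pi.single j 1) t)]
  boundm t i := by
    have h1 := ha.bounded.choose_spec _ (single_mem i) t
    have h2 := le_abs_self ha.bounded.choose
    have h3 := abs_nonneg ha.bounded.choose
    simp only [drift]
    linarith
  boundγ t := by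
    have h1 := ha.bounded.choose_spec _ zero_mem t
    have h2 := le_abs_self ha.bounded.choose
    have h3 := abs_nonneg ha.bounded.choose
    simp only [potential]
    linarith
  elliptic := ha.elliptic.choose_spec.2

/-- Passing from multi-indices to pairs of indices, see `sum_multiIdx`. -/
lemma op_zero {f : Rd d → ℝ} (hf : ContDiff ℝ 2 f) (t : ℝ) (x : Rd d) :
    a.op 0 t f x = ha.heat.gen t f x := by
  have h1 : a.op 0 t f x = ∑ α ∈ multiIdx d, a.zeroth α t * D α f x :=
    Finset.sum_congr rfl fun α hα => by rw [ha.val_zero hα]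
  rw [h1, sum_multiIdx fun α => a.zeroth α t * D α f x, HeatData.gen]
  simp only [D_zero, D_single, D_pair hf]
  have h2 : ∀ i j, (if i = j then (2:ℝ) else 1) * (a.zeroth (Pi.single i 1 + Pi.single j 1) t *
      pd i (pd j f) x) = ha.heat.C t i j * pd i (pd j f) x := by
    intro i j
    simp only [heat, diffusion, Matrix.of_apply]; ring
  simp_rw [h2]
  have h3 : ∀ i, a.zeroth (Pi.single i 1) t * pd i f x = ha.heat.m t i * pd i f x := fun i => rfl
  have h4 : a.zeroth 0 t = ha.heat.γ t := rfl
  simp_rw [h3, h4]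
  ring

lemma u₀_eq (T : ℝ) (φ : Rd d → ℝ) : a.u₀ T φ = ha.heat.sol T φ := by
  ext t x
  simp only [u₀, HeatData.sol, HeatData.smear]
  congr 1

end Regular

end Coeffs

/-! ### Differentiation under interval integrals -/

lemma hasDerivAt_intervalIntegral {F F' : ℝ → ℝ → ℝ} {U : Set ℝ} {t₀ a b : ℝ} (hU : U ∈ 𝓝 t₀)
    (hF : ∀ t ∈ U, ContinuousOn (F t) (uIcc a b))
    (hF' : ContinuousOn (fun z : ℝ × ℝ => F' z.1 z.2) (U ×ˢ uIcc a b))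
    (hd : ∀ t ∈ U, ∀ s ∈ uIcc a b, HasDerivAt (fun t => F t s) (F' t s) t) :
    HasDerivAt (fun t => ∫ s in a..b, F t s) (∫ s in a..b, F' t₀ s) t₀ := by
  obtain ⟨ε, hε, hball⟩ := Metric.nhds_basis_closedBall.mem_iff.1 hU
  have hc : IsCompact (Metric.closedBall t₀ ε ×ˢ uIcc a b) :=
    (isCompact_closedBall t₀ ε).prod isCompact_uIcc
  obtain ⟨K, hK⟩ := hc.exists_bound_of_continuousOn (hF'.mono (prod_mono hball Subset.rfl))
  have hsub : uIoc a b ⊆ uIcc a b := uIoc_subset_uIcc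
  have ht₀ : t₀ ∈ U := mem_of_mem_nhds hU
  have hF't : ContinuousOn (F' t₀) (uIcc a b) := by
    have : ContinuousOn ((fun z : ℝ × ℝ => F' z.1 z.2) ∘ fun s => (t₀, s)) (uIcc a b) :=
      hF'.comp (by fun_prop) fun s hs => ⟨ht₀, hs⟩
    exact this
  refine (intervalIntegral.hasDerivAt_integral_of_dominated_loc_of_deriv_le
    (Metric.closedBall_mem_nhds t₀ hε) ?_ (hF t₀ ht₀).intervalIntegrable ?_
    (bound := fun _ => K) (Eventually.of_forall fun s hs t ht => hK (t, s) ⟨ht, hsub hs⟩)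
    intervalIntegrable_const
    (Eventually.of_forall fun s hs t ht => hd t (hball ht) s (hsub hs))).2
  · filter_upwards [hU] with t ht
    exact ((hF t ht).mono hsub).aestronglyMeasurable measurableSet_uIoc
  · exact (hF't.mono hsub).aestronglyMeasurable measurableSet_uIoc

lemma hasDerivAt_line {f : Rd d → ℝ} (hf : Differentiable ℝ f) (i : Fin d) (x : Rd d) (r : ℝ) :
    HasDerivAt (fun r : ℝ => f (x + r • EuclideanSpace.single i 1))
      (pd i f (x + r • EuclideanSpace.single i 1)) r := by
  have h1 : HasDerivAt (fun r : ℝ => x + r • (EuclideanSpace.single i (1:ℝ) : Rd d))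
      (EuclideanSpace.single i 1) r := by
    simpa using ((hasDerivAt_id r).smul_const (EuclideanSpace.single i (1:ℝ) : Rd d)).const_add x
  exact (hf _).hasFDerivAt.comp_hasDerivAt r h1

/-- Time and space derivatives commute. -/
lemma hasDerivAt_pd {u g : ℝ → Rd d → ℝ} {T : ℝ}
    (hu : ∀ t < T, ∀ x, HasDerivAt (fun s => u s x) (g t x) t)
    (hud : ∀ t < T, Differentiable ℝ (u t)) (hgd : ∀ t < T, Differentiable ℝ (g t)) (i : Fin d)
    (hg : ContinuousOn (fun p : ℝ × Rd d => g p.1 p.2) (Iio T ×ˢ univ))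
    (hg' : ContinuousOn (fun p : ℝ × Rd d => pd i (g p.1) p.2) (Iio T ×ˢ univ)) {t₀ : ℝ}
    (ht₀ : t₀ < T) (x : Rd d) :
    HasDerivAt (fun s => pd i (u s) x) (pd i (g t₀) x) t₀ := by
  have hsub : ∀ t < T, uIcc t₀ t ⊆ Iio T := fun t ht s hs =>
    lt_of_le_of_lt hs.2 (max_lt ht₀ ht)
  have hcg : ∀ y, ContinuousOn (fun s => g s y) (Iio T) := fun y =>
    hg.comp (f := fun s : ℝ => (s, y)) (by fun_prop) fun s hs => ⟨hs, mem_univ _⟩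
  have hcg' : ContinuousOn (fun s => pd i (g s) x) (Iio T) :=
    hg'.comp (f := fun s : ℝ => (s, x)) (by fun_prop) fun s hs => ⟨hs, mem_univ _⟩
  have h1 : ∀ t < T, ∀ y, u t y = u t₀ y + ∫ s in t₀..t, g s y := by
    intro t ht y
    have := intervalIntegral.integral_eq_sub_of_hasDerivAt (a := t₀) (b := t)
      (f := fun s => u s y) (f' := fun s => g s y)
      (fun s hs => hu s (hsub t ht hs) y) ((hcg y).mono (hsub t ht)).intervalIntegrable
    rw [this]; ring
  have h2 : ∀ t < T, pd i (u t) x = pd i (u t₀) x + ∫ s in t₀..t, pd i (g s) x := by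
    intro t ht
    have h3 : HasDerivAt (fun r : ℝ => ∫ s in t₀..t, g s (x + r • EuclideanSpace.single i 1))
        (∫ s in t₀..t, pd i (g s) (x + (0:ℝ) • EuclideanSpace.single i 1)) 0 := by
      refine hasDerivAt_intervalIntegral (U := univ) univ_mem
        (F' := fun r s => pd i (g s) (x + r • EuclideanSpace.single i 1))
        (fun r _ => (hcg _).mono (hsub t ht)) ?_ fun r _ s hs =>
          hasDerivAt_line (hgd s (hsub t ht hs)) i x r
      refine hg'.comp (f := fun z : ℝ × ℝ => (z.2, x + z.1 • (EuclideanSpace.single i (1:ℝ) : Rd d)))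
        (by fun_prop) fun z hz => ⟨hsub t ht hz.2, mem_univ _⟩
    have h4 := hasDerivAt_line (hud t ht) i x 0
    have h5 := (hasDerivAt_line (hud t₀ ht₀) i x 0).add h3
    simp only [zero_smul, add_zero] at h4 h5
    refine h4.unique (h5.congr_of_eventuallyEq (Eventually.of_forall fun r => ?_))
    exact h1 t ht _
  have h6 : HasDerivAt (fun t => pd i (u t₀) x + ∫ s in t₀..t, pd i (g s) x) (pd i (g t₀) x) t₀ := by
    refine HasDerivAt.const_add _ (intervalIntegral.integral_hasDerivAt_right
      (by simp) ?_ (hcg'.continuousAt (Iio_mem_nhds ht₀)))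
    exact hcg'.stronglyMeasurableAtFilter isOpen_Iio t₀ ht₀
  exact h6.congr_of_eventuallyEq (by
    filter_upwards [Iio_mem_nhds ht₀] with t ht using h2 t ht)

/-- Differentiating `∫_t^T F(t,s) ds`. -/
lemma hasDerivAt_integral_diag {F F' : ℝ → ℝ → ℝ} {T b t₀ : ℝ} (ht₀ : t₀ < T)
    (hF : ContinuousOn (fun z : ℝ × ℝ => F z.1 z.2) (Iio T ×ˢ univ))
    (hF' : ContinuousOn (fun z : ℝ × ℝ => F' z.1 z.2) (Iio T ×ˢ univ))
    (hd : ∀ t < T, ∀ s, HasDerivAt (fun t => F t s) (F' t s) t) :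
    HasDerivAt (fun t => ∫ s in t..b, F t s) (-F t₀ t₀ + ∫ s in t₀..b, F' t₀ s) t₀ := by
  have hc : ∀ t < T, Continuous (F t) := fun t ht => by
    rw [← continuousOn_univ]
    exact hF.comp (f := fun s : ℝ => (t, s)) (by fun_prop) fun s hs => ⟨ht, hs⟩
  have h1 : HasDerivAt (fun t => ∫ s in t₀..b, F t s) (∫ s in t₀..b, F' t₀ s) t₀ :=
    hasDerivAt_intervalIntegral (U := Iio T) (Iio_mem_nhds ht₀)
      (fun t ht => (hc t ht).continuousOn)
      (hF'.mono (prod_mono Subset.rfl (subset_univ _))) fun t ht s _ => hd t ht s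
  have h2 : HasDerivAt (fun t => ∫ s in t₀..t, F t s) (F t₀ t₀) t₀ := by
    rw [hasDerivAt_iff_isLittleO, Asymptotics.isLittleO_iff]
    intro ε hε
    have hcont : ContinuousAt (fun z : ℝ × ℝ => F z.1 z.2) (t₀, t₀) :=
      hF.continuousAt ((isOpen_Iio.prod isOpen_univ).mem_nhds ⟨ht₀, mem_univ _⟩)
    obtain ⟨δ, hδ, hball⟩ := Metric.continuousAt_iff.1 hcont ε hε
    filter_upwards [Metric.ball_mem_nhds t₀ hδ, Iio_mem_nhds ht₀] with t ht htT
    have h3 : ∫ s in t₀..t, (F t s - F t₀ t₀) = (∫ s in t₀..t, F t s) - (t - t₀) * F t₀ t₀ := by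
      rw [intervalIntegral.integral_sub ((hc t htT).intervalIntegrable _ _)
        intervalIntegrable_const, intervalIntegral.integral_const, smul_eq_mul]
    rw [intervalIntegral.integral_same, sub_zero, smul_eq_mul, ← h3]
    refine (intervalIntegral.norm_integral_le_of_norm_le_const fun s hs => ?_)
    have hs' : dist s t₀ ≤ dist t t₀ := by
      rw [Real.dist_eq, Real.dist_eq]
      exact abs_sub_left_of_mem_uIcc (uIoc_subset_uIcc hs)
    refine (hball (x := (t, s)) ?_).le
    rw [Prod.dist_eq]
    exact max_lt ht (lt_of_le_of_lt hs' ht)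
  have h4 := (h1.sub h2).congr_deriv
    (by ring : _ = -F t₀ t₀ + ∫ s in t₀..b, F' t₀ s)
  refine h4.congr_of_eventuallyEq ?_
  filter_upwards [Iio_mem_nhds ht₀] with t ht
  have := intervalIntegral.integral_add_adjacent_intervals
    ((hc t ht).intervalIntegrable (μ := volume) t₀ t) ((hc t ht).intervalIntegrable t b)
  simp only [Pi.sub_apply]
  linarith

namespace HeatData

/-! ### Commutation relations -/

variable (H : HeatData d)

lemma contDiff_gen {f : Rd d → ℝ} (hf : ContDiff ℝ ∞ f) (t : ℝ) : ContDiff ℝ ∞ (H.gen t f) := by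
  unfold gen
  refine ((contDiff_const.mul (ContDiff.sum fun i _ => ContDiff.sum fun j _ =>
    contDiff_const.mul ?_)).add (ContDiff.sum fun i _ => contDiff_const.mul ?_)).add
    (contDiff_const.mul hf)
  · exact (hf.pd_smooth j).pd_smooth i
  · exact hf.pd_smooth i

lemma gen_add {f g : Rd d → ℝ} (hf : ContDiff ℝ ∞ f) (hg : ContDiff ℝ ∞ g) (t : ℝ) (x : Rd d) :
    H.gen t (fun x => f x + g x) x = H.gen t f x + H.gen t g x := by
  have h1 : ∀ i, pd i (fun x => f x + g x) = fun x => pd i f x + pd i g x := fun i =>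
    pd_add (smooth_differentiable hf) (smooth_differentiable hg) i
  have h2 : ∀ i j, pd i (fun x => pd j f x + pd j g x) =
      fun x => pd i (pd j f) x + pd i (pd j g) x := fun i j =>
    pd_add (smooth_differentiable (hf.pd_smooth j)) (smooth_differentiable (hg.pd_smooth j)) i
  simp only [gen, h1, h2, mul_add, Finset.sum_add_distrib]
  ring

lemma gen_const_mul (f : Rd d → ℝ) (c : ℝ) (t : ℝ) (x : Rd d) :
    H.gen t (fun x => c * f x) x = c * H.gen t f x := by
  simp only [gen, pd_const_mul, mul_add, Finset.mul_sum]
  congr 1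
  · congr 1
    · exact Finset.sum_congr rfl fun i _ => Finset.sum_congr rfl fun j _ => by ring
    · exact Finset.sum_congr rfl fun i _ => by ring
  · ring

lemma gen_zero (t : ℝ) (x : Rd d) : H.gen t (fun _ => 0) x = 0 := by
  simpa using H.gen_const_mul (fun _ => 0) 0 t x

lemma gen_sum {ι : Type*} (s : Finset ι) {f : ι → Rd d → ℝ} (hf : ∀ j, ContDiff ℝ ∞ (f j))
    (t : ℝ) (x : Rd d) : H.gen t (fun x => ∑ j ∈ s, f j x) x = ∑ j ∈ s, H.gen t (f j) x := by
  classical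
  induction s using Finset.induction_on with
  | empty => simpa using H.gen_zero t x
  | insert j s hj ih =>
    simp only [Finset.sum_insert hj]
    rw [H.gen_add (hf j) (ContDiff.sum fun j _ => hf j), ih]

lemma pd_gen {f : Rd d → ℝ} (hf : ContDiff ℝ ∞ f) (t : ℝ) (i : Fin d) :
    pd i (H.gen t f) = H.gen t (pd i f) := by
  have hd : ∀ {g : Rd d → ℝ}, ContDiff ℝ ∞ g → ∀ c : ℝ, Differentiable ℝ fun x => c * g x :=
    fun hg c => (smooth_differentiable hg).const_mul c
  have h2 : ∀ {g : Rd d → ℝ}, ContDiff ℝ ∞ g → ContDiff ℝ 2 g := fun hg => contDiff_infty.1 hg 2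
  have s1 : ∀ k, ContDiff ℝ ∞ (pd k f) := fun k => hf.pd_smooth k
  have s2 : ∀ k j, ContDiff ℝ ∞ (pd k (pd j f)) := fun k j => (s1 j).pd_smooth k
  unfold gen
  rw [pd_add, pd_add, pd_const_mul, pd_const_mul, pd_sum, pd_sum]
  · ext x
    beta_reduce
    congr 2
    · congr 1
      refine Finset.sum_congr rfl fun k _ => ?_
      rw [pd_sum _ fun j _ => hd (s2 k j) _]
      refine Finset.sum_congr rfl fun j _ => ?_
      rw [pd_const_mul, pd_comm (h2 (s1 j)) i k, pd_comm (h2 hf) i j]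
    · refine Finset.sum_congr rfl fun k _ => ?_
      rw [pd_const_mul, pd_comm (h2 hf) i k]
  · exact fun k _ => hd (s1 k) _
  · exact fun k _ => Differentiable.fun_sum fun j _ => hd (s2 k j) _
  · exact (Differentiable.fun_sum fun k _ => Differentiable.fun_sum fun j _ => hd (s2 k j) _).const_mul _
  · exact Differentiable.fun_sum fun k _ => hd (s1 k) _
  · exact ((Differentiable.fun_sum fun k _ => Differentiable.fun_sum fun j _ =>
      hd (s2 k j) _).const_mul _).add (Differentiable.fun_sum fun k _ => hd (s1 k) _)
  · exact hd hf _

/-- The commutator of `𝓐₀` and `x_i` is `m_i + ∑_j C_{ij} ∂_j`. -/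
lemma gen_coord_mul {f : Rd d → ℝ} (hf : ContDiff ℝ ∞ f) (t : ℝ) (i : Fin d) (x : Rd d) :
    H.gen t (fun x => x i * f x) x =
      x i * H.gen t f x + H.m t i * f x + ∑ j, H.C t i j * pd j f x := by
  have h1 : ∀ k, pd k (fun x => x i * f x) = fun x => (if k = i then 1 else 0) * f x + x i * pd k f x :=
    fun k => pd_coord_mul (smooth_differentiable hf) k i
  have h2 : ∀ j k, pd j (fun x => (if k = i then 1 else 0) * f x + x i * pd k f x) = fun x =>
      (if k = i then 1 else 0) * pd j f x + ((if j = i then 1 else 0) * pd k f x +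
        x i * pd j (pd k f) x) := fun j k => by
    rw [pd_add ((smooth_differentiable hf).const_mul _)
      (smooth_differentiable ((contDiff_coord i).mul (hf.pd_smooth k))), pd_const_mul,
      pd_coord_mul (smooth_differentiable (hf.pd_smooth k))]
  simp only [gen, h1, h2, mul_add, Finset.sum_add_distrib]
  have e1 : ∑ j, ∑ k, H.C t j k * ((if k = i then 1 else 0) * pd j f x) =
      ∑ j, H.C t i j * pd j f x := by
    simp [H.symm t i]
  have e2 : ∑ j, ∑ k, H.C t j k * ((if j = i then 1 else 0) * pd k f x) =
      ∑ j, H.C t i j * pd j f x := by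
    rw [Finset.sum_comm]
    simp
  have e3 : ∑ j, ∑ k, H.C t j k * (x i * pd j (pd k f) x) =
      x i * ∑ j, ∑ k, H.C t j k * pd j (pd k f) x := by
    simp only [Finset.mul_sum]
    exact Finset.sum_congr rfl fun j _ => Finset.sum_congr rfl fun k _ => by ring
  have e4 : ∑ k, H.m t k * ((if k = i then 1 else 0) * f x) = H.m t i * f x := by
    simp
  have e5 : ∑ k, H.m t k * (x i * pd k f x) = x i * ∑ k, H.m t k * pd k f x := by
    simp only [Finset.mul_sum]
    exact Finset.sum_congr rfl fun j _ => by ring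
  rw [e1, e2, e3, e4, e5]
  ring

/-! ### Two-parameter families built from a solution -/

/-- The base function `u₀` of the expansion, seen as a solution that is smooth in space. -/
structure Profile (T : ℝ) (U : ℝ → Rd d → ℝ) : Prop where
  smooth : ∀ t, ContDiff ℝ ∞ (U t)
  cont : ∀ L, ContinuousOn (fun p : ℝ × Rd d => pdL L (U p.1) p.2) (Iio T ×ˢ univ)
  pde : ∀ t < T, ∀ x, HasDerivAt (fun s => U s x) (-H.gen t (U t) x) t

variable (T : ℝ) (U : ℝ → Rd d → ℝ)

/-- Families `f(t,r,x)` that are linear combinations of terms `c(t,r) p(x) ∂^L U(t,x)` with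
`c(t,r) = O((T-t)^e)` for `0 ≤ t ≤ r ≤ T`, where `e ≥ e₀` and at most `2e + q` derivatives are
applied to `U`. As `∂^L u₀(t,·)` is of order `(T-t)^{-|L|/2}`, a family with `q = 0` stays bounded
as `t ↑ T`. -/
inductive Rep (q e₀ : ℕ) : (ℝ → ℝ → Rd d → ℝ) → Prop
  | term {n e : ℕ} {p : Rd d → ℝ} {c : ℝ → ℝ → ℝ} {K : ℝ} {L : List (Fin d)} : HomPoly n p →
      Continuous (fun z : ℝ × ℝ => c z.1 z.2) →
      (∀ t r, 0 ≤ t → t ≤ r → r ≤ T → |c t r| ≤ K * (T - t) ^ e) → e₀ ≤ e → L.length ≤ 2 * e + q →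
      Rep q e₀ fun t r x => c t r * p x * pdL L (U t) x
  | add {f g : ℝ → ℝ → Rd d → ℝ} : Rep q e₀ f → Rep q e₀ g → Rep q e₀ fun t r x => f t r x + g t r x
  | zero : Rep q e₀ fun _ _ _ => 0

variable {T U} {q e₀ : ℕ} {f g : ℝ → ℝ → Rd d → ℝ}

namespace Rep

lemma mono {q' e₀' : ℕ} (hq : q ≤ q') (he : e₀' ≤ e₀) (hf : Rep T U q e₀ f) : Rep T U q' e₀' f := by
  induction hf with
  | term hp hc hb h1 h2 => exact term hp hc hb (he.trans h1) (h2.trans (by omega))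
  | add _ _ ih ih' => exact add ih ih'
  | zero => exact zero

lemma sum {ι : Type*} (s : Finset ι) {f : ι → ℝ → ℝ → Rd d → ℝ}
    (hf : ∀ j ∈ s, Rep T U q e₀ (f j)) : Rep T U q e₀ fun t r x => ∑ j ∈ s, f j t r x := by
  classical
  induction s using Finset.induction_on with
  | empty => simpa using zero
  | insert j s hj ih =>
    simp only [Finset.sum_insert hj]
    exact add (hf j (Finset.mem_insert_self _ _))
      (ih fun i hi => hf i (Finset.mem_insert_of_mem hi))

lemma contDiff (hU : H.Profile T U) (hf : Rep T U q e₀ f) (t r : ℝ) : ContDiff ℝ ∞ (f t r) := by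
  induction hf with
  | term hp _ _ _ _ => exact (contDiff_const.mul hp.contDiff).mul ((hU.smooth t).pdL_smooth _)
  | add _ _ ih ih' => exact ih.add ih'
  | zero => exact contDiff_const

lemma continuousOn (hU : H.Profile T U) (hf : Rep T U q e₀ f) :
    ContinuousOn (fun z : (ℝ × ℝ) × Rd d => f z.1.1 z.1.2 z.2) ((Iio T ×ˢ univ) ×ˢ univ) := by
  induction hf with
  | @term n e p c K L hp hc _ _ _ =>
    have h1 : Continuous fun z : (ℝ × ℝ) × Rd d => c z.1.1 z.1.2 := hc.comp continuous_fst
    have h2 : Continuous fun z : (ℝ × ℝ) × Rd d => p z.2 := hp.contDiff.continuous.comp continuous_snd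
    refine (h1.mul h2).continuousOn.mul ?_
    exact (hU.cont L).comp (f := fun z : (ℝ × ℝ) × Rd d => (z.1.1, z.2)) (by fun_prop)
      fun z hz => ⟨hz.1.1, mem_univ _⟩
  | add _ _ ih ih' => exact ih.add ih'
  | zero => exact continuousOn_const

lemma continuousOn_diag (hU : H.Profile T U) (hf : Rep T U q e₀ f) :
    ContinuousOn (fun z : ℝ × Rd d => f z.1 z.1 z.2) (Iio T ×ˢ univ) :=
  (hf.continuousOn H hU).comp (f := fun z : ℝ × Rd d => ((z.1, z.1), z.2)) (by fun_prop)
    fun z hz => ⟨⟨hz.1, mem_univ _⟩, mem_univ _⟩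

lemma continuousOn_tr (hU : H.Profile T U) (hf : Rep T U q e₀ f) (x : Rd d) :
    ContinuousOn (fun z : ℝ × ℝ => f z.1 z.2 x) (Iio T ×ˢ univ) :=
  (hf.continuousOn H hU).comp (f := fun z : ℝ × ℝ => (z, x)) (by fun_prop)
    fun z hz => ⟨hz, mem_univ _⟩

lemma continuous_r (hf : Rep T U q e₀ f) (t : ℝ) (x : Rd d) : Continuous fun r => f t r x := by
  induction hf with
  | term _ hc _ _ _ =>
    exact ((hc.comp (by fun_prop : Continuous fun r : ℝ => (t, r))).mul_const _).mul_const _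
  | add _ _ ih ih' => exact ih.add ih'
  | zero => exact continuous_const

lemma smul {c : ℝ → ℝ → ℝ} (hc : Continuous fun z : ℝ × ℝ => c z.1 z.2) (hf : Rep T U q e₀ f) :
    Rep T U q e₀ fun t r x => c t r * f t r x := by
  induction hf with
  | @term n e p c' K L hp hc' hb h1 h2 =>
    obtain ⟨K', hK'⟩ := ((isCompact_Icc (a := (0:ℝ)) (b := T)).prod
      (isCompact_Icc (a := (0:ℝ)) (b := T))).exists_bound_of_continuousOn hc.continuousOn
    have : (fun t r (x : Rd d) => c t r * (c' t r * p x * pdL L (U t) x)) =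
        fun t r x => (c t r * c' t r) * p x * pdL L (U t) x := by ext; ring
    rw [this]
    refine term (K := K' * K) hp (hc.mul hc') (fun t r h0 htr hrT => ?_) h1 h2
    have h3 : |c t r| ≤ K' := hK' (t, r) ⟨⟨h0, by linarith⟩, by linarith, hrT⟩
    rw [abs_mul, mul_assoc]
    exact mul_le_mul h3 (hb t r h0 htr hrT) (abs_nonneg _) ((abs_nonneg _).trans h3)
  | add _ _ ih ih' => simpa only [mul_add] using add ih ih'
  | zero => simpa using zero

/-- A factor of size `O(T-t)` pays for two derivatives. -/
lemma smul_gain {c : ℝ → ℝ → ℝ} {K' : ℝ} (hc : Continuous fun z : ℝ × ℝ => c z.1 z.2)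
    (hK' : ∀ t r, 0 ≤ t → t ≤ r → r ≤ T → |c t r| ≤ K' * (T - t)) (hf : Rep T U (q + 2) e₀ f) :
    Rep T U q (e₀ + 1) fun t r x => c t r * f t r x := by
  induction hf with
  | @term n e p c' K L hp hc' hb h1 h2 =>
    have : (fun t r (x : Rd d) => c t r * (c' t r * p x * pdL L (U t) x)) =
        fun t r x => (c t r * c' t r) * p x * pdL L (U t) x := by ext; ring
    rw [this]
    refine term (K := K' * K) (e := e + 1) hp (hc.mul hc') (fun t r h0 htr hrT => ?_) (by omega)
      (by omega)
    have h3 := hK' t r h0 htr hrT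
    rw [abs_mul]
    refine (mul_le_mul h3 (hb t r h0 htr hrT) (abs_nonneg _) ((abs_nonneg _).trans h3)).trans
      (le_of_eq (by ring))
  | add _ _ ih ih' => simpa only [mul_add] using add ih ih'
  | zero => simpa using zero

lemma coord_mul (i : Fin d) (hf : Rep T U q e₀ f) : Rep T U q e₀ fun t r x => x i * f t r x := by
  induction hf with
  | @term n e p c' K L hp hc' hb h1 h2 =>
    have : (fun t r (x : Rd d) => x i * (c' t r * p x * pdL L (U t) x)) =
        fun t r x => c' t r * (x i * p x) * pdL L (U t) x := by ext; ring
    rw [this]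
    exact term (hp.coord i) hc' hb h1 h2
  | add _ _ ih ih' => simpa only [mul_add] using add ih ih'
  | zero => simpa using zero

lemma pd (hU : H.Profile T U) (i : Fin d) (hf : Rep T U q e₀ f) :
    Rep T U (q + 1) e₀ fun t r => GaussianExpansion.pd i (f t r) := by
  induction hf with
  | @term n e p c K L hp hc hb h1 h2 =>
    have : (fun t r => GaussianExpansion.pd i fun x => c t r * p x * pdL L (U t) x) =
        fun t r x => c t r * GaussianExpansion.pd i p x * pdL L (U t) x +
          c t r * p x * pdL (i :: L) (U t) x := by
      ext t r x
      rw [pd_mul ((smooth_differentiable hp.contDiff).const_mul _)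
        (smooth_differentiable ((hU.smooth t).pdL_smooth L)), pd_const_mul]
      rfl
    rw [this]
    refine add ?_ (term hp hc hb h1 (by simp only [List.length_cons]; omega))
    rcases hp.pd i with ⟨-, h0⟩ | ⟨m, -, hm⟩
    · simpa [h0] using zero
    · exact term hm hc hb h1 (by omega)
  | add h h' ih ih' =>
    have : (fun t r => GaussianExpansion.pd i fun x => _) = _ := funext fun t => funext fun r =>
      pd_add (smooth_differentiable (h.contDiff H hU t r))
        (smooth_differentiable (h'.contDiff H hU t r)) i
    rw [this]
    exact add ih ih'
  | zero => simpa [pd_const] using zero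

lemma pdL (hU : H.Profile T U) (L : List (Fin d)) (hf : Rep T U q e₀ f) :
    Rep T U (q + L.length) e₀ fun t r => GaussianExpansion.pdL L (f t r) := by
  induction L with
  | nil => exact hf
  | cons i L ih => exact ih.pd H hU i

/-- For families of this kind the time and space variables separate, so that no theorem on
differentiation under the integral sign is needed. -/
lemma pd_integral (hU : H.Profile T U) (hf : Rep T U q e₀ f) (i : Fin d) (t r : ℝ) :
    GaussianExpansion.pd i (fun x => ∫ s in r..T, f t s x) =
      fun x => ∫ s in r..T, GaussianExpansion.pd i (f t s) x := by
  suffices h : Differentiable ℝ (fun x => ∫ s in r..T, f t s x) ∧ _ from h.2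
  induction hf with
  | @term n e p c K L hp hc hb h1 h2 =>
    have h3 : Differentiable ℝ fun x => p x * GaussianExpansion.pdL L (U t) x :=
      smooth_differentiable (hp.contDiff.mul ((hU.smooth t).pdL_smooth L))
    simp only [mul_assoc, intervalIntegral.integral_mul_const, pd_const_mul]
    exact ⟨h3.const_mul _, by simp⟩
  | @add f g h h' ih ih' =>
    have hi : ∀ x, ∫ s in r..T, (f t s x + g t s x) = (∫ s in r..T, f t s x) + ∫ s in r..T, g t s x :=
      fun x => intervalIntegral.integral_add ((h.continuous_r t x).intervalIntegrable _ _)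
        ((h'.continuous_r t x).intervalIntegrable _ _)
    simp only [hi]
    refine ⟨ih.1.add ih'.1, ?_⟩
    rw [pd_add ih.1 ih'.1, ih.2, ih'.2]
    ext x
    rw [← intervalIntegral.integral_add (((h.pd H hU i).continuous_r t x).intervalIntegrable _ _)
        (((h'.pd H hU i).continuous_r t x).intervalIntegrable _ _)]
    congr 1; ext s
    rw [pd_add (smooth_differentiable (h.contDiff H hU t s))
        (smooth_differentiable (h'.contDiff H hU t s))]
  | zero => simp [pd_const]

/-- Integration over `[r,T] ⊆ [t,T]` gains a factor `T - t`, which pays for two derivatives. -/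
lemma integral (hf : Rep T U (q + 2) e₀ f) :
    Rep T U q (e₀ + 1) fun t r x => ∫ s in r..T, f t s x := by
  induction hf with
  | @term n e p c K L hp hc hb h1 h2 =>
    simp only [intervalIntegral.integral_mul_const]
    have hc' : Continuous fun z : ℝ × ℝ => ∫ s in z.2..T, c z.1 s := by
      simp_rw [intervalIntegral.integral_symm T]
      exact (intervalIntegral.continuous_parametric_intervalIntegral_of_continuous
        (f := fun (z : ℝ × ℝ) s => c z.1 s)
        (hc.comp (by fun_prop : Continuous fun z : (ℝ × ℝ) × ℝ => (z.1.1, z.2))) continuous_snd).neg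
    refine term (c := fun t r => ∫ s in r..T, c t s) (K := |K|) (e := e + 1) hp hc'
      (fun t r h0 htr hrT => ?_) (by omega) (by omega)
    have hT : 0 ≤ T - t := by linarith
    have h3 := intervalIntegral.norm_integral_le_of_norm_le_const (a := r) (b := T) (f := c t)
      (C := |K| * (T - t) ^ e) fun s hs => by
        rw [uIoc_of_le hrT] at hs
        refine (hb t s h0 (htr.trans hs.1.le) hs.2).trans ?_
        exact mul_le_mul_of_nonneg_right (le_abs_self K) (by positivity)
    refine h3.trans ?_
    rw [abs_of_nonneg (by linarith : 0 ≤ T - r), pow_succ, ← mul_assoc]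
    exact mul_le_mul_of_nonneg_left (by linarith) (by positivity)
  | @add f g h h' ih ih' =>
    have hi : ∀ t r x, ∫ s in r..T, (f t s x + g t s x) =
        (∫ s in r..T, f t s x) + ∫ s in r..T, g t s x :=
      fun t r x => intervalIntegral.integral_add ((h.continuous_r t x).intervalIntegrable _ _)
        ((h'.continuous_r t x).intervalIntegrable _ _)
    simp only [hi]
    exact add ih ih'
  | zero => simpa using zero

lemma gen_integral (hU : H.Profile T U) (hf : Rep T U q e₀ f) (t r : ℝ) (x : Rd d) :
    H.gen t (fun x => ∫ s in r..T, f t s x) x = ∫ s in r..T, H.gen t (f t s) x := by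
  have c1 : ∀ i, Continuous fun s => GaussianExpansion.pd i (f t s) x := fun i =>
    (hf.pd H hU i).continuous_r t x
  have c2 : ∀ i j, Continuous fun s => GaussianExpansion.pd i (GaussianExpansion.pd j (f t s)) x :=
    fun i j => ((hf.pd H hU j).pd H hU i).continuous_r t x
  have hsum : ∀ (c : Fin d → ℝ) {F : Fin d → ℝ → ℝ}, (∀ i, Continuous (F i)) →
      ∫ s in r..T, ∑ i, c i * F i s = ∑ i, c i * ∫ s in r..T, F i s := fun c F hF => by
    rw [intervalIntegral.integral_finsetSum fun i _ => ((hF i).const_mul _).intervalIntegrable _ _]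
    exact Finset.sum_congr rfl fun i _ => intervalIntegral.integral_const_mul _ _
  simp only [gen, hf.pd_integral H hU, (hf.pd H hU _).pd_integral H hU]
  have k1 : Continuous fun s => 1 / 2 * ∑ i, ∑ j, H.C t i j *
      GaussianExpansion.pd i (GaussianExpansion.pd j (f t s)) x :=
    continuous_const.mul (continuous_finsetSum _ fun i _ => continuous_finsetSum _ fun j _ =>
      (c2 i j).const_mul _)
  have k2 : Continuous fun s => ∑ i, H.m t i * GaussianExpansion.pd i (f t s) x :=
    continuous_finsetSum _ fun i _ => (c1 i).const_mul _
  have k12 : Continuous fun s => 1 / 2 * ∑ i, ∑ j, H.C t i j *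
      GaussianExpansion.pd i (GaussianExpansion.pd j (f t s)) x +
      ∑ i, H.m t i * GaussianExpansion.pd i (f t s) x := k1.add k2
  rw [intervalIntegral.integral_add (k12.intervalIntegrable _ _)
    (((hf.continuous_r t x).const_mul _).intervalIntegrable _ _),
    intervalIntegral.integral_add (k1.intervalIntegrable _ _) (k2.intervalIntegrable _ _),
    intervalIntegral.integral_const_mul, intervalIntegral.integral_const_mul,
    hsum _ fun i => c1 i]
  congr 3
  refine Eq.symm ((intervalIntegral.integral_finsetSum fun i _ =>
    (continuous_finsetSum _ fun j _ => (c2 i j).const_mul _).intervalIntegrable _ _).trans ?_)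
  exact Finset.sum_congr rfl fun i _ => hsum _ fun j => c2 i j

end Rep

/-- `f(·,r,·)` solves the homogeneous equation `(∂_t + 𝓐₀) f = 0` for every `r`. -/
def Solves (T : ℝ) (f : ℝ → ℝ → Rd d → ℝ) : Prop :=
  ∀ t < T, ∀ r x, HasDerivAt (fun s => f s r x) (-H.gen t (f t r) x) t

variable {H}

lemma Rep.gen_continuousOn (hU : H.Profile T U) (hf : Rep T U q e₀ f) :
    ContinuousOn (fun z : (ℝ × ℝ) × Rd d => H.gen z.1.1 (f z.1.1 z.1.2) z.2)
      ((Iio T ×ˢ univ) ×ˢ univ) := by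
  have hc : ∀ {c : ℝ → ℝ}, Continuous c → Continuous fun z : (ℝ × ℝ) × Rd d => c z.1.1 :=
    fun hc => hc.comp (by fun_prop)
  unfold gen
  refine ((continuousOn_const.mul (continuousOn_finsetSum _ fun i _ =>
    continuousOn_finsetSum _ fun j _ => (hc (H.contC i j)).continuousOn.mul ?_)).add
    (continuousOn_finsetSum _ fun i _ => (hc (H.contm i)).continuousOn.mul ?_)).add
    ((hc H.contγ).continuousOn.mul (hf.continuousOn H hU))
  · exact ((hf.pd H hU j).pd H hU i).continuousOn H hU
  · exact (hf.pd H hU i).continuousOn H hU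

/-- The coefficients of `𝓐₀` do not depend on `x`. -/
lemma Solves.pd (hU : H.Profile T U) (hf : Rep T U q e₀ f) (h : H.Solves T f) (i : Fin d) :
    H.Solves T fun t r => GaussianExpansion.pd i (f t r) := by
  intro t ht r x
  have hcomp : ∀ {F : (ℝ × ℝ) × Rd d → ℝ}, ContinuousOn F ((Iio T ×ˢ univ) ×ˢ univ) →
      ContinuousOn (fun p : ℝ × Rd d => F ((p.1, r), p.2)) (Iio T ×ˢ univ) := fun hF =>
    hF.comp (f := fun p : ℝ × Rd d => ((p.1, r), p.2)) (by fun_prop)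
      fun p hp => ⟨⟨hp.1, mem_univ _⟩, mem_univ _⟩
  have e : ∀ t, GaussianExpansion.pd i (fun x => -H.gen t (f t r) x) =
      fun x => -H.gen t (GaussianExpansion.pd i (f t r)) x := fun t => by
    have := pd_const_mul (f := H.gen t (f t r)) (-1) i
    simp only [neg_one_mul] at this
    rw [this, H.pd_gen (hf.contDiff H hU t r)]
  have key := hasDerivAt_pd (u := fun t => f t r) (g := fun t x => -H.gen t (f t r) x)
    (fun t ht x => h t ht r x) (fun t _ => smooth_differentiable (hf.contDiff H hU t r))
    (fun t _ => smooth_differentiable (H.contDiff_gen (hf.contDiff H hU t r) t).neg) i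
    (hcomp (hf.gen_continuousOn hU)).neg (by
      simp only [e]
      exact (hcomp ((hf.pd H hU i).gen_continuousOn hU)).neg) ht x
  simp only [e] at key
  exact key

lemma Solves.add (hU : H.Profile T U) (hf : Rep T U q e₀ f) (hg : Rep T U q e₀ g)
    (h : H.Solves T f) (h' : H.Solves T g) : H.Solves T fun t r x => f t r x + g t r x := by
  intro t ht r x
  refine ((h t ht r x).add (h' t ht r x)).congr_deriv ?_
  rw [H.gen_add (hf.contDiff H hU t r) (hg.contDiff H hU t r)]
  ring

lemma Solves.zero : H.Solves T fun _ _ _ => 0 := by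
  intro t _ r x
  rw [H.gen_zero, neg_zero]
  exact hasDerivAt_const _ _

lemma Solves.smul (h : H.Solves T f) (c : ℝ → ℝ) : H.Solves T fun t r x => c r * f t r x := by
  intro t ht r x
  rw [H.gen_const_mul]
  exact ((h t ht r x).const_mul (c r)).congr_deriv (by ring)

/-- The operator `x_i + 𝐦_i(t,r) + ∑_j 𝐂_{ij}(t,r) ∂_j` commutes with `∂_t + 𝓐₀`. -/
lemma Solves.shift (hU : H.Profile T U) (hf : Rep T U q e₀ f) (h : H.Solves T f) (i : Fin d) :
    H.Solves T fun t r x => (x i + H.mean r t i) * f t r x +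
      ∑ j, H.cov r t i j * GaussianExpansion.pd j (f t r) x := by
  intro t ht r x
  have hs := hf.contDiff H hU t r
  have h1 := ((H.hasDerivAt_mean r t i).const_add (x i)).mul (h t ht r x)
  have h2 := HasDerivAt.fun_sum (u := Finset.univ) fun j _ =>
    (H.hasDerivAt_cov r t i j).mul (Solves.pd hU hf h j t ht r x)
  refine (h1.add h2).congr_deriv ?_
  have e1 : (fun x : Rd d => (x i + H.mean r t i) * f t r x +
      ∑ j, H.cov r t i j * GaussianExpansion.pd j (f t r) x) = fun x => (x i * f t r x +
      H.mean r t i * f t r x) + ∑ j, H.cov r t i j * GaussianExpansion.pd j (f t r) x := by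
    ext x; ring
  have s1 : ∀ j, ContDiff ℝ ∞ fun x => H.cov r t i j * GaussianExpansion.pd j (f t r) x :=
    fun j => contDiff_const.mul (hs.pd_smooth j)
  beta_reduce
  rw [e1, H.gen_add (((contDiff_coord i).mul hs).add (contDiff_const.mul hs))
    (ContDiff.sum fun j _ => s1 j), H.gen_add ((contDiff_coord i).mul hs) (contDiff_const.mul hs),
    H.gen_coord_mul hs, H.gen_const_mul, H.gen_sum _ s1]
  simp_rw [H.gen_const_mul]
  simp only [Matrix.neg_apply, neg_mul, mul_neg, Finset.sum_add_distrib, Finset.sum_neg_distrib]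
  ring

lemma Solves.integral (hU : H.Profile T U) (hf : Rep T U q e₀ f) (h : H.Solves T f) :
    H.Solves T fun t r x => ∫ s in r..T, f t s x := by
  intro t ht r x
  rw [hf.gen_integral H hU, ← intervalIntegral.integral_neg]
  have hg : ContinuousOn (fun z : ℝ × ℝ => -H.gen z.1 (f z.1 z.2) x) (Iio T ×ˢ univ) :=
    ((hf.gen_continuousOn hU).comp (f := fun z : ℝ × ℝ => (z, x)) (by fun_prop)
      fun z hz => ⟨hz, mem_univ _⟩).neg
  exact hasDerivAt_intervalIntegral (U := Iio T) (Iio_mem_nhds ht)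
    (fun t _ => (hf.continuous_r t x).continuousOn)
    (hg.mono (prod_mono Subset.rfl (subset_univ _))) fun t ht s _ => h t ht s x

/-- Along the diagonal `r = t` the integral picks up the boundary term `-f(t,t,x)`. -/
lemma Solves.hasDerivAt_integral_diag (hU : H.Profile T U) (hf : Rep T U q e₀ f)
    (h : H.Solves T f) {t : ℝ} (ht : t < T) (x : Rd d) :
    HasDerivAt (fun t => ∫ s in t..T, f t s x)
      (-f t t x - H.gen t (fun x => ∫ s in t..T, f t s x) x) t := by
  rw [hf.gen_integral H hU, sub_eq_add_neg, ← intervalIntegral.integral_neg]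
  have hg : ContinuousOn (fun z : ℝ × ℝ => -H.gen z.1 (f z.1 z.2) x) (Iio T ×ˢ univ) :=
    ((hf.gen_continuousOn hU).comp (f := fun z : ℝ × ℝ => (z, x)) (by fun_prop)
      fun z hz => ⟨hz, mem_univ _⟩).neg
  exact GaussianExpansion.hasDerivAt_integral_diag (F := fun t s => f t s x)
    (F' := fun t s => -H.gen t (f t s) x) ht (hf.continuousOn_tr H hU x) hg
    fun t ht s => h t ht s x

end HeatData

/-! ### The operators `𝓖_n` -/

lemma polyOp_eq_sum {p : MvPolynomial (Fin d) ℝ} {B : Finset (Fin d →₀ ℕ)} (h : p.support ⊆ B)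
    (A : Fin d → (Rd d → ℝ) → (Rd d → ℝ)) (f : Rd d → ℝ) (x : Rd d) :
    polyOp p A f x = ∑ β ∈ B, p.coeff β * opPow A (⇑β) f x :=
  Finset.sum_subset h fun β _ hβ => by rw [MvPolynomial.notMem_support_iff.1 hβ, zero_mul]

namespace Coeffs.Regular

variable {a : Coeffs d} (ha : a.Regular)
include ha

/-- A class of families of functions that is stable under the building blocks of `𝓖_n` is stable
under `𝓖_n`. -/
theorem G_closure {ι : Type*} {t s : ι → ℝ} (k : ℕ) {𝒬 : (ι → Rd d → ℝ) → Prop}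
    (add : ∀ {f g}, 𝒬 f → 𝒬 g → 𝒬 fun p x => f p x + g p x) (zero : 𝒬 fun _ _ => 0)
    (coeff : ∀ α ∈ multiIdx d, ∀ β {f}, 𝒬 f → 𝒬 fun p x => (a α k (s p)).coeff β * f p x)
    (hM : ∀ i {f}, 𝒬 f → 𝒬 fun p => a.M (t p) (s p) i (f p))
    {f : ι → Rd d → ℝ} (hD : ∀ α ∈ multiIdx d, 𝒬 fun p => D α (f p)) :
    𝒬 fun p => a.G k (t p) (s p) (f p) := by
  classical
  have sum : ∀ {J : Type} (S : Finset J) {F : J → ι → Rd d → ℝ}, (∀ j ∈ S, 𝒬 (F j)) →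
      𝒬 fun p x => ∑ j ∈ S, F j p x := by
    intro J S F hF
    induction S using Finset.induction_on with
    | empty => simpa using zero
    | insert j S hj ih =>
      simp only [Finset.sum_insert hj]
      exact add (hF j (Finset.mem_insert_self _ _))
        (ih fun i hi => hF i (Finset.mem_insert_of_mem hi))
  have iter : ∀ i (n : ℕ) {f}, 𝒬 f → 𝒬 fun p => (a.M (t p) (s p) i)^[n] (f p) := by
    intro i n f hf
    induction n with
    | zero => exact hf
    | succ n ih => simpa only [Function.iterate_succ_apply'] using hM i ih
  have pow : ∀ (β : Fin d → ℕ) {f}, 𝒬 f → 𝒬 fun p => opPow (a.M (t p) (s p)) β (f p) := by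
    intro β f hf
    unfold opPow
    induction List.finRange d with
    | nil => exact hf
    | cons i l ih => exact iter i (β i) ih
  refine sum (F := fun α p => polyOp (a α k (s p)) (a.M (t p) (s p)) (D α (f p))) _ fun α hα => ?_
  obtain ⟨B, hB⟩ := ha.support_subset α hα k
  have : (fun p => polyOp (a α k (s p)) (a.M (t p) (s p)) (D α (f p))) = fun p x =>
      ∑ β ∈ B, (a α k (s p)).coeff β * opPow (a.M (t p) (s p)) (⇑β) (D α (f p)) x :=
    funext fun p => funext fun x => polyOp_eq_sum (hB _) _ _ _
  rw [this]
  exact sum B fun β _ => coeff α hα β (pow β (hD α hα))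

lemma continuous_mean (i : Fin d) : Continuous fun z : ℝ × ℝ => a.mean z.1 z.2 i := by
  have hc := ha.heat.contm i
  have : (fun z : ℝ × ℝ => a.mean z.1 z.2 i) =
      fun z => (∫ r in (0:ℝ)..z.2, a.drift r i) - ∫ r in (0:ℝ)..z.1, a.drift r i :=
    funext fun z => (intervalIntegral.integral_interval_sub_left (hc.intervalIntegrable _ _)
      (hc.intervalIntegrable _ _)).symm
  rw [this]
  have h := intervalIntegral.continuous_primitive (μ := volume)
    (fun a b => hc.intervalIntegrable a b) 0
  exact (h.comp continuous_snd).sub (h.comp continuous_fst)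

lemma continuous_cov (i j : Fin d) : Continuous fun z : ℝ × ℝ => a.cov z.1 z.2 i j := by
  have hc := ha.heat.contC i j
  have : (fun z : ℝ × ℝ => a.cov z.1 z.2 i j) =
      fun z => (∫ r in (0:ℝ)..z.2, a.diffusion r i j) - ∫ r in (0:ℝ)..z.1, a.diffusion r i j :=
    funext fun z => (intervalIntegral.integral_interval_sub_left (hc.intervalIntegrable _ _)
      (hc.intervalIntegrable _ _)).symm
  rw [this]
  have h := intervalIntegral.continuous_primitive (μ := volume)
    (fun a b => hc.intervalIntegrable a b) 0
  exact (h.comp continuous_snd).sub (h.comp continuous_fst)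

/-- The variant of `Coeffs.Regular.G_closure` for classes that are stable under single derivatives. -/
theorem G_closure_of_pd {ι : Type*} {t s : ι → ℝ} (k : ℕ) {𝒬 : (ι → Rd d → ℝ) → Prop}
    (add : ∀ {f g}, 𝒬 f → 𝒬 g → 𝒬 fun p x => f p x + g p x) (zero : 𝒬 fun _ _ => 0)
    (smul : ∀ {c : ℝ × ℝ → ℝ}, Continuous c → ∀ {f}, 𝒬 f → 𝒬 fun p x => c (t p, s p) * f p x)
    (coord : ∀ (i : Fin d) {f}, 𝒬 f → 𝒬 fun p x => x i * f p x)
    (hpd : ∀ i {f}, 𝒬 f → 𝒬 fun p => pd i (f p)) {f : ι → Rd d → ℝ} (hf : 𝒬 f) :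
    𝒬 fun p => a.G k (t p) (s p) (f p) := by
  refine ha.G_closure k add zero (fun α hα β f hf => smul (c := fun z => (a α k z.2).coeff β)
    ((ha.continuous_coeff α hα k β).comp continuous_snd) hf) (fun i f hf => ?_) fun α _ => ?_
  · have h1 : ∀ S : Finset (Fin d), 𝒬 fun p x => ∑ j ∈ S, a.cov (t p) (s p) i j * pd j (f p) x := by
      intro S
      classical
      induction S using Finset.induction_on with
      | empty => simpa using zero
      | insert j S hj ih =>
        simp only [Finset.sum_insert hj]
        exact add (smul (ha.continuous_cov i j) (hpd j hf)) ih
    have h2 := add (add (coord i hf) (smul (ha.continuous_mean i) hf)) (h1 Finset.univ)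
    refine (congrArg 𝒬 (funext fun p => funext fun x => ?_)).mp h2
    simp only [M, add_mul]
  · obtain ⟨L, -, hL⟩ := exists_list_D α
    simp only [hL]
    clear hL
    induction L with
    | nil => exact hf
    | cons i L ih => exact hpd i ih

/-- `𝓖_k` is additive on smooth functions; the closure principle keeps track of the smoothness of all
the intermediate functions. -/
lemma G_sum {J : Type*} (S : Finset J) {f : J → Rd d → ℝ} (hf : ∀ j, ContDiff ℝ ∞ (f j)) (k : ℕ)
    (t s : ℝ) (x : Rd d) :
    a.G k t s (fun x => ∑ j ∈ S, f j x) x = ∑ j ∈ S, a.G k t s (f j) x := by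
  -- the family consists of the summands and, at the index `none`, of their sum
  have key := ha.G_closure_of_pd (ι := Option J) (t := fun _ => t) (s := fun _ => s) k
    (𝒬 := fun F => (∀ j, ContDiff ℝ ∞ (F (some j))) ∧ F none = fun x => ∑ j ∈ S, F (some j) x)
    (fun h h' => ⟨fun j => (h.1 j).add (h'.1 j), by
      simp only [h.2, h'.2, Finset.sum_add_distrib]⟩)
    ⟨fun _ => contDiff_const, by simp⟩
    (fun _ _ h => ⟨fun j => contDiff_const.mul (h.1 j), by simp only [h.2, Finset.mul_sum]⟩)
    (fun i _ h => ⟨fun j => (contDiff_coord i).mul (h.1 j), by simp only [h.2, Finset.mul_sum]⟩)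
    (fun i _ h => ⟨fun j => (h.1 j).pd_smooth i, by
      simp only [h.2]
      rw [pd_sum _ fun j _ => smooth_differentiable (h.1 j)]⟩)
    (f := fun o => o.elim (fun x => ∑ j ∈ S, f j x) f) ⟨hf, rfl⟩
  exact congrFun key.2 x

omit ha in
/-- At `s = t` the operator `𝓜(t,s)` is the multiplication by `x`. -/
lemma G_self (a : Coeffs d) (k : ℕ) (t : ℝ) (f : Rd d → ℝ) (x : Rd d) :
    a.G k t t f x = a.op k t f x := by
  have hM : a.M t t = fun i f x => x i * f x := by
    ext i f x
    simp [M, mean, cov]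
  have hpow : ∀ (β : Fin d → ℕ) (f : Rd d → ℝ),
      opPow (a.M t t) β f = fun x => (∏ i, x i ^ β i) * f x := by
    intro β f
    have h1 : ∀ (i : Fin d) (n : ℕ) (g : Rd d → ℝ),
        (a.M t t i)^[n] g = fun x => x i ^ n * g x := by
      intro i n g
      induction n with
      | zero => simp
      | succ n ih =>
        rw [Function.iterate_succ_apply', ih, hM]
        ext x; ring
    have h2 : ∀ l : List (Fin d), l.foldr (fun i g => (a.M t t i)^[β i] g) f =
        fun x => (l.map fun i => x i ^ β i).prod * f x := by
      intro l
      induction l with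
      | nil => simp
      | cons i l ih =>
        rw [List.foldr_cons, ih, h1]
        ext x; simp [mul_assoc]
    rw [opPow, h2]
    ext x
    rw [← List.ofFn_eq_map, List.prod_ofFn]
  simp only [G, op, polyOp, hpow, val, MvPolynomial.eval_eq']
  refine Finset.sum_congr rfl fun α _ => ?_
  rw [Finset.sum_mul]
  exact Finset.sum_congr rfl fun β _ => by ring

end Coeffs.Regular

/-! ### Iterated integrals -/

lemma continuous_cons {h : ℕ} : Continuous fun z : ℝ × (Fin h → ℝ) =>
    (Fin.cons z.1 z.2 : Fin (h + 1) → ℝ) := by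
  refine continuous_pi fun i => ?_
  refine Fin.cases ?_ (fun j => ?_) i
  · simp only [Fin.cons_zero]; fun_prop
  · simp only [Fin.cons_succ]; fun_prop

/-- The parameter space is general because the induction adds the outer variables to it. -/
lemma continuous_iterInt (T : ℝ) (h : ℕ) : ∀ {X : Type} [TopologicalSpace X]
    [FirstCountableTopology X] [LocallyCompactSpace X] {F : X → (Fin h → ℝ) → ℝ},
    (Continuous fun z : X × (Fin h → ℝ) => F z.1 z.2) →
    Continuous fun z : X × ℝ => iterInt T h z.2 (F z.1) := by
  induction h with
  | zero =>
    intro X _ _ _ F hF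
    exact hF.comp (by fun_prop : Continuous fun z : X × ℝ => (z.1, (Fin.elim0 : Fin 0 → ℝ)))
  | succ h ih =>
    intro X _ _ _ F hF
    have h1 := ih (X := X × ℝ) (F := fun z v => F z.1 (Fin.cons z.2 v))
      (hF.comp ((continuous_fst.comp continuous_fst).prodMk (continuous_cons.comp (by fun_prop :
        Continuous fun z : (X × ℝ) × (Fin h → ℝ) => (z.1.2, z.2)))))
    simp only [iterInt]
    simp_rw [intervalIntegral.integral_symm T]
    exact (intervalIntegral.continuous_parametric_intervalIntegral_of_continuous (a₀ := T)
      (f := fun (z : X × ℝ) s => iterInt T h s fun v => F z.1 (Fin.cons s v))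
      (h1.comp (by fun_prop : Continuous fun z : (X × ℝ) × ℝ => ((z.1.1, z.2), z.2)))
      continuous_snd).neg

lemma continuous_iterInt_cons (T : ℝ) {h : ℕ} {F : (Fin (h + 1) → ℝ) → ℝ} (hF : Continuous F) :
    Continuous fun s => iterInt T h s fun v => F (Fin.cons s v) :=
  (continuous_iterInt T h (X := ℝ) (F := fun s v => F (Fin.cons s v))
    (hF.comp continuous_cons)).comp (by fun_prop : Continuous fun s : ℝ => (s, s))

lemma iterInt_add (T : ℝ) : ∀ (h : ℕ) (s : ℝ) {F G : (Fin h → ℝ) → ℝ} (_ : Continuous F)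
    (_ : Continuous G), iterInt T h s (fun v => F v + G v) = iterInt T h s F + iterInt T h s G
  | 0, _, _, _, _, _ => rfl
  | h + 1, s, F, G, hF, hG => by
    simp only [iterInt]
    rw [← intervalIntegral.integral_add ((continuous_iterInt_cons T hF).intervalIntegrable _ _)
      ((continuous_iterInt_cons T hG).intervalIntegrable _ _)]
    congr 1; ext r
    have hc : Continuous fun v : Fin h → ℝ => (Fin.cons r v : Fin (h + 1) → ℝ) :=
      continuous_cons.comp (by fun_prop : Continuous fun v : Fin h → ℝ => (r, v))
    exact iterInt_add T h r (hF.comp hc) (hG.comp hc)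

lemma iterInt_mul_const (T c : ℝ) : ∀ (h : ℕ) (s : ℝ) (F : (Fin h → ℝ) → ℝ),
    iterInt T h s (fun v => F v * c) = iterInt T h s F * c
  | 0, _, _ => rfl
  | h + 1, s, F => by
    simp only [iterInt]
    rw [← intervalIntegral.integral_mul_const]
    congr 1; ext r
    exact iterInt_mul_const T c h r _

lemma iterInt_zero (T : ℝ) (h : ℕ) (s : ℝ) : iterInt T h s (fun _ => 0) = 0 := by
  simpa using iterInt_mul_const T 0 h s fun _ => 0

lemma iterInt_sum (T : ℝ) (h : ℕ) (s : ℝ) {J : Type*} (S : Finset J)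
    {F : J → (Fin h → ℝ) → ℝ} (hF : ∀ j, Continuous (F j)) :
    iterInt T h s (fun v => ∑ j ∈ S, F j v) = ∑ j ∈ S, iterInt T h s (F j) := by
  classical
  induction S using Finset.induction_on with
  | empty => simpa using iterInt_zero T h s
  | insert j S hj ih =>
    simp only [Finset.sum_insert hj]
    rw [iterInt_add T h s (hF j) (continuous_finsetSum _ fun j _ => hF j), ih]

/-! ### Families with separated variables -/

/-- Families `∑ c(v) Q(x)` with `c` continuous and `Q` smooth. -/
inductive Sep {V : Type} [TopologicalSpace V] : (V → Rd d → ℝ) → Prop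
  | term {c : V → ℝ} {Q : Rd d → ℝ} : Continuous c → ContDiff ℝ ∞ Q → Sep fun v x => c v * Q x
  | add {f g : V → Rd d → ℝ} : Sep f → Sep g → Sep fun v x => f v x + g v x
  | zero : Sep fun _ _ => 0

namespace Sep

variable {V : Type} [TopologicalSpace V] {f : V → Rd d → ℝ}

lemma const {Q : Rd d → ℝ} (hQ : ContDiff ℝ ∞ Q) : Sep fun _ : V => Q := by
  simpa using term (V := V) (continuous_const (y := 1)) hQ

lemma sum {J : Type*} (S : Finset J) {F : J → V → Rd d → ℝ} (hF : ∀ j ∈ S, Sep (F j)) :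
    Sep fun v x => ∑ j ∈ S, F j v x := by
  classical
  induction S using Finset.induction_on with
  | empty => simpa using zero
  | insert j S hj ih =>
    simp only [Finset.sum_insert hj]
    exact add (hF j (Finset.mem_insert_self _ _))
      (ih fun i hi => hF i (Finset.mem_insert_of_mem hi))

lemma comp {W : Type} [TopologicalSpace W] {e : W → V} (he : Continuous e) (hf : Sep f) :
    Sep fun w => f (e w) := by
  induction hf with
  | term hc hQ => exact term (hc.comp he) hQ
  | add _ _ h h' => exact add h h'
  | zero => exact zero

lemma contDiff (hf : Sep f) (v : V) : ContDiff ℝ ∞ (f v) := by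
  induction hf with
  | term _ hQ => exact contDiff_const.mul hQ
  | add _ _ h h' => exact h.add h'
  | zero => exact contDiff_const

lemma continuous (hf : Sep f) (x : Rd d) : Continuous fun v => f v x := by
  induction hf with
  | term hc _ => exact hc.mul_const _
  | add _ _ h h' => exact h.add h'
  | zero => exact continuous_const

lemma smul {c : V → ℝ} (hc : Continuous c) (hf : Sep f) : Sep fun v x => c v * f v x := by
  induction hf with
  | term hc' hQ => simpa only [Pi.mul_apply, mul_assoc] using term (hc.mul hc') hQ
  | add _ _ h h' => simpa only [mul_add] using add h h'
  | zero => simpa using zero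

lemma coord (i : Fin d) (hf : Sep f) : Sep fun v x => x i * f v x := by
  induction hf with
  | term hc hQ => simpa only [mul_left_comm] using term hc ((contDiff_coord i).mul hQ)
  | add _ _ h h' => simpa only [mul_add] using add h h'
  | zero => simpa using zero

lemma pd (i : Fin d) (hf : Sep f) : Sep fun v => GaussianExpansion.pd i (f v) := by
  induction hf with
  | term hc hQ => simpa only [pd_const_mul] using term hc (hQ.pd_smooth i)
  | add hf hg h h' =>
    have := add h h'
    simp only [pd_add (smooth_differentiable (hf.contDiff _))
      (smooth_differentiable (hg.contDiff _))]
    exact this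
  | zero => simpa [pd_const] using zero

lemma G {a : Coeffs d} (ha : a.Regular) (k : ℕ) (t : ℝ) {s : V → ℝ} (hs : Continuous s)
    (hf : Sep f) : Sep fun v => a.G k t (s v) (f v) :=
  ha.G_closure_of_pd (t := fun _ => t) (s := s) k (𝒬 := Sep) add zero
    (fun hc _ h => h.smul (hc.comp (by fun_prop))) (fun i _ h => h.coord i)
    (fun i _ h => h.pd i) hf

variable {h : ℕ} {f : (Fin h → ℝ) → Rd d → ℝ}

lemma contDiff_iterInt (hf : Sep f) (T r : ℝ) :
    ContDiff ℝ ∞ fun x => iterInt T h r fun v => f v x := by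
  induction hf with
  | term _ hQ =>
    simp only [iterInt_mul_const]
    exact contDiff_const.mul hQ
  | add hf hg ih ih' =>
    simp only [iterInt_add T h r (hf.continuous _) (hg.continuous _)]
    exact ih.add ih'
  | zero =>
    simp only [iterInt_zero]
    exact contDiff_const

lemma pd_iterInt (hf : Sep f) (T r : ℝ) (i : Fin d) :
    GaussianExpansion.pd i (fun x => iterInt T h r fun v => f v x) =
      fun x => iterInt T h r fun v => GaussianExpansion.pd i (f v) x := by
  induction hf with
  | term _ hQ => simp only [iterInt_mul_const, pd_const_mul]
  | add hf hg ih ih' =>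
    simp only [iterInt_add T h r (hf.continuous _) (hg.continuous _)]
    rw [pd_add (smooth_differentiable (hf.contDiff_iterInt T r))
      (smooth_differentiable (hg.contDiff_iterInt T r)), ih, ih']
    ext x
    rw [← iterInt_add T h r ((hf.pd i).continuous _) ((hg.pd i).continuous _)]
    congr 1; ext v
    rw [pd_add (smooth_differentiable (hf.contDiff v)) (smooth_differentiable (hg.contDiff v))]
  | zero => simp only [iterInt_zero, pd_const]

/-- `𝓖_k` commutes with iterated integrals. -/
lemma G_iterInt {a : Coeffs d} (ha : a.Regular) (k : ℕ) (t s T r : ℝ) (hf : Sep f) (x : Rd d) :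
    a.G k t s (fun x => iterInt T h r fun v => f v x) x =
      iterInt T h r fun v => a.G k t s (f v) x := by
  -- the index `none` carries the integral of the members with index `some v`
  have key := ha.G_closure_of_pd (ι := Option (Fin h → ℝ)) (t := fun _ => t) (s := fun _ => s) k
    (𝒬 := fun F => Sep (fun v => F (some v)) ∧
      F none = fun x => iterInt T h r fun v => F (some v) x)
    (fun h1 h2 => ⟨add h1.1 h2.1, by
      simp only [h1.2, h2.2]
      ext x
      rw [iterInt_add T h r (h1.1.continuous x) (h2.1.continuous x)]⟩)
    ⟨zero, by simp only [iterInt_zero]⟩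
    (fun _ _ h1 => ⟨h1.1.smul continuous_const, by
      simp only [h1.2, mul_comm _ (iterInt _ _ _ _), ← iterInt_mul_const]
      simp only [mul_comm]⟩)
    (fun i _ h1 => ⟨h1.1.coord i, by
      simp only [h1.2, mul_comm _ (iterInt _ _ _ _), ← iterInt_mul_const]
      simp only [mul_comm]⟩)
    (fun i _ h1 => ⟨h1.1.pd i, by
      simp only [h1.2]
      rw [h1.1.pd_iterInt]⟩)
    (f := fun o => o.elim (fun x => iterInt T h r fun v => f v x) f) ⟨hf, rfl⟩
  exact congrFun key.2 x

end Sep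

lemma Coeffs.prodG_cons (a : Coeffs d) (t : ℝ) {h : ℕ} (k : ℕ) (i : Fin h → ℕ) (r : ℝ)
    (v : Fin h → ℝ) (f : Rd d → ℝ) :
    a.prodG t (Fin.cons k i : Fin (h + 1) → ℕ) (Fin.cons r v) f = a.G k t r (a.prodG t i v f) := by
  simp [prodG, List.finRange_succ, List.foldr_map]

/-- For a fixed `t` the operators `𝓖_k(t,s)` depend on `s` through continuous coefficients only, so the
variables `s_1, …, s_h` separate from `x`. -/
lemma Sep.prodG {a : Coeffs d} (ha : a.Regular) (t : ℝ) {f : Rd d → ℝ} (hf : ContDiff ℝ ∞ f) :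
    ∀ {h : ℕ} (i : Fin h → ℕ), Sep fun v : Fin h → ℝ => a.prodG t i v f
  | 0, i => Sep.const hf
  | h + 1, i => by
    have h1 := (Sep.prodG ha t hf fun j : Fin h => i j.succ).comp
      (by fun_prop : Continuous fun v : Fin (h + 1) → ℝ => fun j : Fin h => v j.succ)
    have h2 := h1.G ha (i 0) t (s := fun v => v 0) (continuous_apply 0)
    refine (congrArg Sep (funext fun v => ?_)).mp h2
    rw [← a.prodG_cons]
    congr 1
    · exact Fin.cons_self_tail i
    · exact Fin.cons_self_tail v

/-- Splitting off the first part `k` of a composition of `n`. For `k = n` the remaining compositions are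
those of `0`, of which there are none unless `h = 0`. -/
lemma sum_compositions_succ {M : Type*} [AddCommMonoid M] (n h : ℕ) (F : (Fin (h + 1) → ℕ) → M) :
    ∑ i ∈ compositions n (h + 1), F i =
      ∑ k ∈ Finset.Icc 1 n, ∑ i ∈ compositions (n - k) h, F (Fin.cons k i) := by
  rw [Finset.sum_sigma']
  refine Finset.sum_nbij' (fun i => ⟨i 0, fun j => i j.succ⟩) (fun p => Fin.cons p.1 p.2) ?_ ?_ ?_ ?_ ?_
  · intro i hi
    simp only [compositions, Finset.mem_filter, Finset.mem_piAntidiag, Fin.sum_univ_succ] at hi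
    obtain ⟨⟨h1, -⟩, h2⟩ := hi
    simp only [compositions, Finset.mem_sigma, Finset.mem_Icc, Finset.mem_filter,
      Finset.mem_piAntidiag]
    change i 0 + ∑ j : Fin h, i j.succ = n at h1
    refine ⟨⟨h2 0, by omega⟩, ⟨?_, fun _ _ => Finset.mem_univ _⟩, fun k => h2 _⟩
    omega
  · rintro ⟨k, i⟩ hp
    simp only [compositions, Finset.mem_sigma, Finset.mem_Icc, Finset.mem_filter,
      Finset.mem_piAntidiag] at hp
    obtain ⟨⟨h1, h2⟩, ⟨h3, -⟩, h4⟩ := hp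
    simp only [compositions, Finset.mem_filter, Finset.mem_piAntidiag, Fin.sum_univ_succ,
      Fin.cons_zero, Fin.cons_succ]
    change ∑ j : Fin h, i j = n - k at h3
    refine ⟨⟨by omega, fun _ _ => Finset.mem_univ _⟩, fun j => Fin.cases h1 (fun j => ?_) j⟩
    simpa using h4 j
  · intro i _; exact Fin.cons_self_tail i
  · rintro ⟨k, i⟩ _; simp
  · intro i _; exact congrArg F (Fin.cons_self_tail i).symm

lemma compositions_eq_empty {n h : ℕ} (hnh : n < h) : compositions n h = ∅ := by
  refine Finset.filter_eq_empty_iff.2 fun i hi hk => ?_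
  have h1 := (Finset.mem_piAntidiag.1 hi).1
  have h2 : ∑ _k : Fin h, 1 ≤ Finset.univ.sum i := Finset.sum_le_sum fun k _ => hk k
  simp at h2
  omega

/-! ### The terms of the expansion -/

namespace HeatData

variable {H : HeatData d} {T : ℝ} {U : ℝ → Rd d → ℝ} {q e₀ : ℕ} {f : ℝ → ℝ → Rd d → ℝ}

lemma Solves.pdL (hU : H.Profile T U) (hf : Rep T U q e₀ f) (h : H.Solves T f)
    (L : List (Fin d)) : H.Solves T fun t r => GaussianExpansion.pdL L (f t r) := by
  induction L with
  | nil => exact h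
  | cons i L ih => exact ih.pd hU (hf.pdL H hU L) i

/-- The operators `𝓖_k(t,r)` map solutions of the homogeneous equation to solutions. -/
lemma Rep.G {a : Coeffs d} (ha : a.Regular) (hU : ha.heat.Profile T U) (k : ℕ)
    (hf : Rep T U q e₀ f) (hs : ha.heat.Solves T f) :
    Rep T U (q + 2) e₀ (fun t r => a.G k t r (f t r)) ∧
      ha.heat.Solves T fun t r => a.G k t r (f t r) := by
  refine ha.G_closure (ι := ℝ × ℝ) (t := Prod.fst) (s := Prod.snd) k
    (𝒬 := fun F => Rep T U (q + 2) e₀ (fun t r => F (t, r)) ∧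
      ha.heat.Solves T fun t r => F (t, r))
    (fun h h' => ⟨h.1.add h'.1, h.2.add hU h.1 h'.1 h'.2⟩) ⟨.zero, .zero⟩
    (fun α hα β F h => ⟨h.1.smul (c := fun _ r => (a α k r).coeff β)
      ((ha.continuous_coeff α hα k β).comp continuous_snd), h.2.smul fun r => (a α k r).coeff β⟩)
    (fun i F h => ⟨?_, h.2.shift hU h.1 i⟩)
    (f := fun p => f p.1 p.2) (fun α hα => ?_)
  · have hcov : ∀ j t r, 0 ≤ t → t ≤ r → r ≤ T → |a.cov t r i j| ≤ ha.heat.Λ * (T - t) :=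
      fun j t r _ htr hrT => (abs_integral_le r (fun s => ha.heat.boundC s i j) htr).trans
        (mul_le_mul_of_nonneg_left (by linarith) ha.heat.Λ_pos.le)
    have h1 := ((h.1.coord_mul i).add (h.1.smul (c := fun t r => a.mean t r i)
      (ha.continuous_mean i))).add (Rep.sum Finset.univ fun j _ =>
        ((((h.1.pd ha.heat hU j).mono (q' := q + 2 + 2) (e₀' := e₀) (by omega) le_rfl).smul_gain
          (ha.continuous_cov i j) (hcov j)).mono (q' := q + 2) (e₀' := e₀) le_rfl (by omega)))
    refine (congrArg (Rep T U (q + 2) e₀) (funext fun t => funext fun r => funext fun x => ?_)).mp h1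
    simp only [Coeffs.M, add_mul]
  · obtain ⟨L, h1, h2⟩ := exists_list_D α
    have hL : L.length ≤ 2 := (list_length_eq h1).trans_le (mem_multiIdx.1 hα)
    simp only [h2]
    exact ⟨(hf.pdL ha.heat hU L).mono (by omega) le_rfl, hs.pdL hU hf L⟩

end HeatData

namespace Coeffs

/-- The part of the `n`-th term that is made of `h`-fold compositions, with the outermost integral
starting at `r` instead of `t`. -/
noncomputable def part (a : Coeffs d) (T : ℝ) (U : ℝ → Rd d → ℝ) (n h : ℕ) (t r : ℝ) (x : Rd d) : ℝ :=
  iterInt T h r fun s => ∑ i ∈ compositions n h, a.prodG t i s (U t) x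

/-- The `n`-th term of the expansion with base function `U`. -/
noncomputable def expansion (a : Coeffs d) (T : ℝ) (U : ℝ → Rd d → ℝ) (n : ℕ) (t : ℝ) (x : Rd d) : ℝ :=
  ∑ h ∈ Finset.range (n + 1), a.part T U n h t t x

variable {a : Coeffs d} {T : ℝ} {U : ℝ → Rd d → ℝ}

lemma part_zero_zero (t r : ℝ) : a.part T U 0 0 t r = U t := by
  ext x
  simp [part, iterInt, compositions, prodG]

lemma part_succ_zero (n : ℕ) (t r : ℝ) : a.part T U (n + 1) 0 t r = fun _ => 0 := by
  ext x
  simp [part, iterInt, compositions]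

lemma part_eq_zero {n h : ℕ} (hnh : n < h) (t r : ℝ) : a.part T U n h t r = fun _ => 0 := by
  ext x
  simp only [part, compositions_eq_empty hnh, Finset.sum_empty, iterInt_zero]

lemma expansion_zero (t : ℝ) : a.expansion T U 0 t = U t := by
  ext x
  simp [expansion, part_zero_zero]

lemma expansion_eq_L {n : ℕ} (hn : 1 ≤ n) (t : ℝ) (x : Rd d) :
    a.expansion T U n t x = a.L n t T (U t) x := by
  obtain ⟨n, rfl⟩ : ∃ m, n = m + 1 := ⟨n - 1, by omega⟩
  rw [expansion, Finset.sum_range_succ', part_succ_zero, add_zero, L,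
    Finset.range_eq_Ico, Finset.sum_Ico_add' (fun h => a.part T U (n + 1) h t t x)]
  rfl

variable (ha : a.Regular)
include ha

/-- The outermost operator is taken out of the inner integrals. -/
lemma part_succ {t : ℝ} (hU : ContDiff ℝ ∞ (U t)) (n h : ℕ) (r : ℝ) (x : Rd d) :
    a.part T U n (h + 1) t r x =
      ∫ s in r..T, ∑ k ∈ Finset.Icc 1 n, a.G k t s (a.part T U (n - k) h t s) x := by
  have hS : ∀ m, Sep fun (v : Fin h → ℝ) x => ∑ i ∈ compositions m h, a.prodG t i v (U t) x :=
    fun m => Sep.sum _ fun i _ => Sep.prodG ha t hU i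
  simp only [part, iterInt]
  congr 1
  ext s
  have h1 : ∀ k, a.G k t s (a.part T U (n - k) h t s) x = iterInt T h s fun v =>
      a.G k t s (fun x => ∑ i ∈ compositions (n - k) h, a.prodG t i v (U t) x) x := fun k =>
    (hS (n - k)).G_iterInt ha k t s T s x
  simp only [h1]
  rw [← iterInt_sum T h s _ fun k => ((hS (n - k)).G ha k t continuous_const).continuous x]
  congr 1
  ext v
  rw [sum_compositions_succ]
  refine Finset.sum_congr rfl fun k _ => ?_
  rw [ha.G_sum _ fun i => (Sep.prodG ha t hU i).contDiff v]
  exact Finset.sum_congr rfl fun i _ => by rw [prodG_cons]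

/-- The integrand in `part_succ`. -/
lemma part_integrand (hU : ha.heat.Profile T U) {h : ℕ} (n : ℕ)
    (ih : ∀ n, HeatData.Rep T U 0 h (a.part T U n h) ∧ ha.heat.Solves T (a.part T U n h)) :
    HeatData.Rep T U 2 h
        (fun t s x => ∑ k ∈ Finset.Icc 1 n, a.G k t s (a.part T U (n - k) h t s) x) ∧
      ha.heat.Solves T
        (fun t s x => ∑ k ∈ Finset.Icc 1 n, a.G k t s (a.part T U (n - k) h t s) x) := by
  induction Finset.Icc 1 n using Finset.induction_on with
  | empty => simpa using ⟨HeatData.Rep.zero, HeatData.Solves.zero⟩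
  | insert k S hk ihS =>
    have h1 := (ih (n - k)).1.G ha hU k (ih (n - k)).2
    simp only [Finset.sum_insert hk]
    exact ⟨h1.1.add ihS.1, h1.2.add hU h1.1 ihS.1 ihS.2⟩

/-- Each of the `h` integrations pays for the two derivatives of the operator under it, and for fixed `r`
every part solves the homogeneous equation in `(t,x)`. -/
lemma part_rep (hU : ha.heat.Profile T U) (h : ℕ) : ∀ n,
    HeatData.Rep T U 0 h (a.part T U n h) ∧ ha.heat.Solves T (a.part T U n h) := by
  induction h with
  | zero =>
    rintro (_ | n)
    · have h1 : a.part T U 0 0 = fun t _ => U t :=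
        funext fun t => funext fun r => part_zero_zero t r
      rw [h1]
      refine ⟨?_, fun t ht _ x => hU.pde t ht x⟩
      simpa using HeatData.Rep.term (T := T) (U := U) (q := 0) (e₀ := 0) (e := 0) (K := 1) (L := [])
        (HomPoly.const 1) (c := fun _ _ => 1) continuous_const (by simp) le_rfl (by simp)
    · have h1 : a.part T U (n + 1) 0 = fun _ _ _ => 0 :=
        funext fun t => funext fun r => part_succ_zero n t r
      rw [h1]
      exact ⟨.zero, .zero⟩
  | succ h ih =>
    intro n
    have h1 : a.part T U n (h + 1) = fun t r x =>
        ∫ s in r..T, ∑ k ∈ Finset.Icc 1 n, a.G k t s (a.part T U (n - k) h t s) x :=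
      funext fun t => funext fun r => funext fun x => part_succ ha (hU.smooth t) n h r x
    obtain ⟨h2, h3⟩ := part_integrand ha hU n ih
    rw [h1]
    exact ⟨h2.integral, h3.integral hU h2⟩

end Coeffs

/-! ### The terms of the expansion solve the nested Cauchy problems -/

lemma pow_norm_le_exp (n : ℕ) (x : Rd d) : ‖x‖ ^ n ≤ n.factorial * Real.exp ‖x‖ := by
  have := Real.pow_div_factorial_le_exp ‖x‖ (norm_nonneg x) n
  rwa [div_le_iff₀ (by positivity), mul_comm] at this

namespace HeatData

variable {H : HeatData d} {T : ℝ} {U : ℝ → Rd d → ℝ} {q e₀ : ℕ} {f : ℝ → ℝ → Rd d → ℝ}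

lemma sqrt_pow_two_mul {t : ℝ} (ht : t < T) {e l : ℕ} (hl : l ≤ 2 * e) :
    (T - t) ^ e = √(T - t) ^ (2 * e - l) * √(T - t) ^ l := by
  rw [← pow_add, Nat.sub_add_cancel hl, pow_mul, Real.sq_sqrt (sub_pos.2 ht).le]

/-- With `q = 0` the factors `(T - t)^e` compensate the singularities of the derivatives of `U`. The
polynomial factors cost one more exponential. -/
lemma Rep.growth {κ : ℝ} (hG : ∀ L : List (Fin d), ∃ K : ℝ, 0 ≤ K ∧ ∀ t ∈ Ico 0 T, ∀ x,
      |GaussianExpansion.pdL L (U t) x| * √(T - t) ^ L.length ≤ K * Real.exp (κ * ‖x‖))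
    (hf : Rep T U 0 e₀ f) :
    ∃ K κ' : ℝ, 0 ≤ K ∧ ∀ t ∈ Ico 0 T, ∀ x, |f t t x| ≤ K * Real.exp (κ' * ‖x‖) := by
  induction hf with
  | @term n e p c K L hp hc hb h1 h2 =>
    obtain ⟨K₁, hK₁, h3⟩ := hG L
    obtain ⟨K₂, hK₂, h4⟩ := hp.bound
    refine ⟨|K| * √T ^ (2 * e - L.length) * (K₂ * n.factorial) * K₁, κ + 1, by positivity,
      fun t ht x => ?_⟩
    have h5 : |c t t| ≤ |K| * √T ^ (2 * e - L.length) * √(T - t) ^ L.length := by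
      refine (hb t t ht.1 le_rfl ht.2.le).trans ?_
      rw [sqrt_pow_two_mul ht.2 (by omega : L.length ≤ 2 * e), ← mul_assoc]
      have : √(T - t) ≤ √T := Real.sqrt_le_sqrt (by linarith [ht.1])
      gcongr
      exact le_abs_self K
    have h6 : |p x| ≤ K₂ * n.factorial * Real.exp ‖x‖ := by
      refine (h4 x).trans ?_
      rw [mul_assoc]
      exact mul_le_mul_of_nonneg_left (pow_norm_le_exp n x) hK₂
    calc |c t t * p x * GaussianExpansion.pdL L (U t) x|
        = |c t t| * |p x| * |GaussianExpansion.pdL L (U t) x| := by rw [abs_mul, abs_mul]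
      _ ≤ (|K| * √T ^ (2 * e - L.length) * √(T - t) ^ L.length) *
          (K₂ * n.factorial * Real.exp ‖x‖) * |GaussianExpansion.pdL L (U t) x| := by gcongr
      _ = (|K| * √T ^ (2 * e - L.length) * (K₂ * n.factorial) * Real.exp ‖x‖) *
          (|GaussianExpansion.pdL L (U t) x| * √(T - t) ^ L.length) := by ring
      _ ≤ (|K| * √T ^ (2 * e - L.length) * (K₂ * n.factorial) * Real.exp ‖x‖) *
          (K₁ * Real.exp (κ * ‖x‖)) := mul_le_mul_of_nonneg_left (h3 t ht x) (by positivity)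
      _ = _ := by rw [add_mul, one_mul, Real.exp_add]; ring
  | add _ _ ih ih' =>
    obtain ⟨K, κ₁, hK, h⟩ := ih
    obtain ⟨K', κ₂, hK', h'⟩ := ih'
    refine ⟨K + K', max κ₁ κ₂, by positivity, fun t ht x => ?_⟩
    refine (abs_add_le _ _).trans ((add_le_add (h t ht x) (h' t ht x)).trans ?_)
    rw [add_mul]
    gcongr
    · exact le_max_left _ _
    · exact le_max_right _ _
  | zero => exact ⟨0, 0, le_rfl, by simp⟩

/-- With `q = 0` and `e₀ ≥ 1`, the terms without derivatives of `U` carry a positive power of `T - t`,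
and the others vanish in the limit by `hL`. -/
lemma Rep.tendsto_zero (hT : 0 < T) {x : Rd d} {y : ℝ}
    (h0 : Tendsto (fun t => U t x) (𝓝[<] T) (𝓝 y))
    (hL : ∀ L : List (Fin d), L ≠ [] → Tendsto
      (fun t => √(T - t) ^ L.length * GaussianExpansion.pdL L (U t) x) (𝓝[<] T) (𝓝 0))
    (hf : Rep T U 0 (e₀ + 1) f) : Tendsto (fun t => f t t x) (𝓝[<] T) (𝓝 0) := by
  induction hf with
  | @term n e p c K L hp hc hb h1 h2 =>
    have h3 : Tendsto (fun t => √(T - t)) (𝓝[<] T) (𝓝 0) := by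
      have : Continuous fun t => √(T - t) := by fun_prop
      simpa using (this.tendsto T).mono_left nhdsWithin_le_nhds
    have h4 : Tendsto (fun t => √(T - t) ^ (2 * e - L.length) *
        |√(T - t) ^ L.length * GaussianExpansion.pdL L (U t) x|) (𝓝[<] T) (𝓝 0) := by
      rcases eq_or_ne L [] with rfl | hne
      · have h5 := (h3.pow (2 * e)).mul h0.abs
        rw [zero_pow (by omega), zero_mul] at h5
        simpa using h5
      · simpa using (h3.pow (2 * e - L.length)).mul (hL L hne).abs
    have h5 := h4.const_mul (|K| * |p x|)
    rw [mul_zero] at h5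
    refine squeeze_zero_norm' ?_ h5
    filter_upwards [Ico_mem_nhdsLT hT] with t ht
    rw [Real.norm_eq_abs, abs_mul, abs_mul, abs_mul, abs_of_nonneg
      (by positivity : 0 ≤ √(T - t) ^ L.length)]
    have h6 : |c t t| ≤ |K| * (√(T - t) ^ (2 * e - L.length) * √(T - t) ^ L.length) := by
      rw [← sqrt_pow_two_mul ht.2 (by omega : L.length ≤ 2 * e)]
      refine (hb t t ht.1 le_rfl ht.2.le).trans ?_
      exact mul_le_mul_of_nonneg_right (le_abs_self K) (pow_nonneg (sub_pos.2 ht.2).le _)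
    calc |c t t| * |p x| * |GaussianExpansion.pdL L (U t) x|
        ≤ |K| * (√(T - t) ^ (2 * e - L.length) * √(T - t) ^ L.length) * |p x| *
          |GaussianExpansion.pdL L (U t) x| := by gcongr
      _ = _ := by ring
  | add _ _ ih ih' => simpa using ih.add ih'
  | zero => exact tendsto_const_nhds

variable (H T) in
/-- The Gaussian solution, extended by zero to `t ≥ T`. -/
noncomputable def solExt (φ : Rd d → ℝ) (t : ℝ) : Rd d → ℝ :=
  if t < T then H.sol T φ t else fun _ => 0

lemma solExt_of_lt {φ : Rd d → ℝ} {t : ℝ} (ht : t < T) : H.solExt T φ t = H.sol T φ t := if_pos ht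

lemma profile_solExt {φ : Rd d → ℝ} {Kφ κ : ℝ} (hφm : Measurable φ)
    (hφ : ∀ y, |φ y| ≤ Kφ * Real.exp (κ * ‖y‖)) : H.Profile T (H.solExt T φ) where
  smooth t := by
    unfold solExt
    split_ifs with ht
    · exact contDiff_sol hφm hφ ht
    · exact contDiff_const
  cont L := (continuousOn_pdL_sol (H := H) hφm hφ L).congr fun p hp => by rw [solExt_of_lt hp.1]
  pde t ht x := by
    rw [solExt_of_lt ht]
    refine (hasDerivAt_sol hφm hφ ht x).congr_of_eventuallyEq ?_
    filter_upwards [Iio_mem_nhds ht] with s hs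
    rw [solExt_of_lt hs]

end HeatData

namespace Coeffs

variable {a : Coeffs d} {T : ℝ} {U : ℝ → Rd d → ℝ} (ha : a.Regular)
include ha

lemma op_sum {J : Type*} (S : Finset J) {f : J → Rd d → ℝ} (hf : ∀ j, ContDiff ℝ ∞ (f j)) (k : ℕ)
    (t : ℝ) (x : Rd d) : a.op k t (fun x => ∑ j ∈ S, f j x) x = ∑ j ∈ S, a.op k t (f j) x := by
  simp only [← Regular.G_self]
  exact ha.G_sum S hf k t t x

lemma contDiff_part (hU : ha.heat.Profile T U) (n h : ℕ) (t r : ℝ) :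
    ContDiff ℝ ∞ (a.part T U n h t r) :=
  (part_rep ha hU h n).1.contDiff ha.heat hU t r

lemma expansion_rep (hU : ha.heat.Profile T U) {n : ℕ} (hn : 1 ≤ n) :
    HeatData.Rep T U 0 1 fun t r x => ∑ h ∈ Finset.range (n + 1), a.part T U n h t r x := by
  refine HeatData.Rep.sum _ fun h _ => ?_
  rcases h with _ | h
  · obtain ⟨n, rfl⟩ : ∃ m, n = m + 1 := ⟨n - 1, by omega⟩
    have h1 : a.part T U (n + 1) 0 = fun _ _ _ => 0 :=
      funext fun t => funext fun r => part_succ_zero n t r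
    rw [h1]
    exact .zero
  · exact (part_rep ha hU (h + 1) n).1.mono le_rfl (by omega)

/-- The boundary term of the outermost integral in `part_succ` contains `𝓖_k(t,t) = 𝓐_k`, which yields
the right-hand side of the equation for the `n`-th term. -/
lemma hasDerivAt_expansion (hU : ha.heat.Profile T U) {n : ℕ} (hn : 1 ≤ n) {t : ℝ} (ht : t < T)
    (x : Rd d) : HasDerivAt (fun t => a.expansion T U n t x)
      (-(∑ k ∈ Finset.Icc 1 n, a.op k t (a.expansion T U (n - k) t) x) -
        ha.heat.gen t (a.expansion T U n t) x) t := by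
  obtain ⟨m, rfl⟩ : ∃ m, n = m + 1 := ⟨n - 1, by omega⟩
  set n := m + 1 with hnm
  have h1 : ∀ t, a.expansion T U n t = fun x => ∑ h ∈ Finset.range n, a.part T U n (h + 1) t t x := by
    intro t
    ext x
    rw [expansion, Finset.sum_range_succ', hnm, part_succ_zero, add_zero]
  have h2 : ∀ h, HasDerivAt (fun t => a.part T U n (h + 1) t t x)
      (-(∑ k ∈ Finset.Icc 1 n, a.op k t (a.part T U (n - k) h t t) x) -
        ha.heat.gen t (a.part T U n (h + 1) t t) x) t := by
    intro h
    obtain ⟨h3, h4⟩ := part_integrand ha hU n fun n => part_rep ha hU h n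
    have h5 := h4.hasDerivAt_integral_diag hU h3 ht x
    have h6 : ∀ t, a.part T U n (h + 1) t t = fun x =>
        ∫ s in t..T, ∑ k ∈ Finset.Icc 1 n, a.G k t s (a.part T U (n - k) h t s) x :=
      fun t => funext fun x => part_succ ha (hU.smooth t) n h t x
    simp only [h6]
    simpa only [Regular.G_self] using h5
  have h7 := HasDerivAt.fun_sum (u := Finset.range n) fun h _ => h2 h
  have h8 : ∀ k ∈ Finset.Icc 1 n, a.op k t (a.expansion T U (n - k) t) x =
      ∑ h ∈ Finset.range n, a.op k t (a.part T U (n - k) h t t) x := by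
    intro k hk
    rw [Finset.mem_Icc] at hk
    have h9 : a.expansion T U (n - k) t = fun x =>
        ∑ h ∈ Finset.range n, a.part T U (n - k) h t t x := by
      ext x
      refine Finset.sum_subset (Finset.range_subset_range.2 (by omega)) fun h _ hh => ?_
      rw [Finset.mem_range] at hh
      rw [part_eq_zero (by omega)]
    rw [h9, op_sum ha _ fun h => contDiff_part ha hU _ _ _ _]
  rw [Finset.sum_congr rfl h8, Finset.sum_comm]
  simp only [h1]
  rw [ha.heat.gen_sum _ fun h => contDiff_part ha hU _ _ _ _]
  refine h7.congr_deriv ?_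
  rw [Finset.sum_sub_distrib, Finset.sum_neg_distrib]

/-- A function that is represented by derivatives of the base function inherits its regularity. -/
lemma isSolution_of_rep (hU : ha.heat.Profile T U) {κ : ℝ}
    (hG : ∀ L : List (Fin d), ∃ K : ℝ, 0 ≤ K ∧ ∀ t ∈ Ico 0 T, ∀ x,
      |pdL L (U t) x| * √(T - t) ^ L.length ≤ K * Real.exp (κ * ‖x‖))
    {e₀ : ℕ} {f : ℝ → ℝ → Rd d → ℝ} {v g : ℝ → Rd d → ℝ} {ψ : Rd d → ℝ}
    (hf : HeatData.Rep T U 0 e₀ f) (hv : ∀ t, v t = f t t)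
    (hd : ∀ t < T, ∀ x, HasDerivAt (fun t => v t x) (-g t x - ha.heat.gen t (v t) x) t)
    (hterm : ∀ᵐ x, Tendsto (fun t => v t x) (𝓝[<] T) (𝓝 (ψ x))) : IsSolution a T g ψ v where
  contDiff t _ := by
    rw [hv]
    exact contDiff_infty.1 (hf.contDiff ha.heat hU t t) 2
  continuousOn α _ := by
    obtain ⟨L, -, hL⟩ := exists_list_D α
    simp only [hL, hv]
    exact ((hf.pdL ha.heat hU L).continuousOn_diag ha.heat hU).mono
      (prod_mono (fun t ht => ht.2) Subset.rfl)
  pde t ht x := by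
    rw [ha.op_zero (by rw [hv]; exact contDiff_infty.1 (hf.contDiff ha.heat hU t t) 2)]
    exact (hd t ht.2 x).hasDerivWithinAt
  growth := by
    obtain ⟨K, κ', -, h⟩ := hf.growth hG
    exact ⟨K, κ', fun t ht x => by rw [hv]; exact h t ht x⟩
  terminal := hterm

theorem isFormalExpansion_expansion (hT : 0 < T) {φ : Rd d → ℝ} (hφm : Measurable φ)
    (hφ : ExpGrowth φ) : IsFormalExpansion a T φ (a.expansion T (ha.heat.solExt T φ)) := by
  obtain ⟨Kφ, κ, hφ⟩ := hφ
  have hU := HeatData.profile_solExt (H := ha.heat) (T := T) hφm hφ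
  have hG : ∀ L : List (Fin d), ∃ K : ℝ, 0 ≤ K ∧ ∀ t ∈ Ico 0 T, ∀ x,
      |pdL L (ha.heat.solExt T φ t) x| * √(T - t) ^ L.length ≤ K * Real.exp (κ * ‖x‖) := by
    intro L
    obtain ⟨K, hK, h⟩ := HeatData.growth_pdL_sol (H := ha.heat) (T := T) hφm hφ L T
    refine ⟨K, hK, fun t ht x => ?_⟩
    rw [HeatData.solExt_of_lt ht.2]
    exact h t ht.2 (by linarith [ht.1]) x
  have hlim : ∀ x, LebPt φ x →
      Tendsto (fun t => ha.heat.solExt T φ t x) (𝓝[<] T) (𝓝 (φ x)) := fun x hx =>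
    (HeatData.tendsto_sol hφm hφ hx).congr' (by
      filter_upwards [self_mem_nhdsWithin] with t ht
      rw [HeatData.solExt_of_lt ht])
  refine ⟨?_, fun n hn => ?_⟩
  · refine isSolution_of_rep ha hU hG (part_rep ha hU 0 0).1
      (fun t => by rw [expansion_zero, part_zero_zero]) (fun t ht x => ?_) ?_
    · simpa only [expansion_zero, neg_zero, zero_sub] using hU.pde t ht x
    · simp only [expansion_zero]
      exact (ae_lebPt hφm hφ).mono hlim
  · refine isSolution_of_rep ha hU hG (expansion_rep ha hU hn) (fun t => rfl)
      (fun t ht x => hasDerivAt_expansion ha hU hn ht x) ?_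
    filter_upwards [ae_lebPt hφm hφ] with x hx
    refine HeatData.Rep.tendsto_zero (f := fun t r x => ∑ h ∈ Finset.range (n + 1),
      a.part T (ha.heat.solExt T φ) n h t r x) hT (hlim x hx) (fun L hL => ?_)
      (expansion_rep ha hU hn)
    refine (HeatData.tendsto_pdL_sol (H := ha.heat) hφm hφ hx hL).congr' ?_
    filter_upwards [self_mem_nhdsWithin] with t ht
    rw [HeatData.solExt_of_lt ht]

end Coeffs

/-! ### Duality with the forward equation -/

lemma continuous_pd {f : Rd d → ℝ} (hf : ContDiff ℝ 1 f) (i : Fin d) : Continuous (pd i f) :=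
  (contDiff_pd (m := 0) hf (by norm_num) i).continuous

lemma _root_.HasCompactSupport.pd_compact {f : Rd d → ℝ} (hf : HasCompactSupport f) (i : Fin d) :
    HasCompactSupport (pd i f) :=
  (hf.fderiv (𝕜 := ℝ)).comp_left (g := fun A : Rd d →L[ℝ] ℝ => A (EuclideanSpace.single i 1)) rfl

lemma integrable_mul_compact {f g : Rd d → ℝ} (hf : Continuous f) (hg : Continuous g)
    (hgc : HasCompactSupport g) : Integrable fun x => f x * g x :=
  (hf.mul hg).integrable_of_hasCompactSupport hgc.mul_left

lemma integral_pd_mul {f η : Rd d → ℝ} (hf : ContDiff ℝ 1 f) (hη : ContDiff ℝ 1 η)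
    (hc : HasCompactSupport η) (i : Fin d) : ∫ x, pd i f x * η x = -∫ x, f x * pd i η x := by
  have h := integral_mul_fderiv_eq_neg_fderiv_mul_of_integrable (μ := (volume : Measure (Rd d)))
    (f := f) (g := η) (v := EuclideanSpace.single i (1 : ℝ))
    (integrable_mul_compact (continuous_pd hf i) hη.continuous hc)
    (integrable_mul_compact hf.continuous (continuous_pd hη i) (hc.pd_compact i))
    (integrable_mul_compact hf.continuous hη.continuous hc)
    (fun x _ => hf.differentiable (by norm_num) x) (fun x _ => hη.differentiable (by norm_num) x)
  simp only [pd] at h ⊢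
  rw [h, neg_neg]

namespace HeatData

variable (H : HeatData d)

/-- The coefficients of the formal adjoint, after reversing time. -/
noncomputable def rev : HeatData d where
  C t := H.C (-t)
  m t i := -H.m (-t) i
  γ t := H.γ (-t)
  l := H.l
  Λ := H.Λ
  contC i j := (H.contC i j).comp continuous_neg
  contm i := ((H.contm i).comp continuous_neg).neg
  contγ := H.contγ.comp continuous_neg
  symm t := H.symm (-t)
  l_pos := H.l_pos
  Λ_pos := H.Λ_pos
  boundC t := H.boundC (-t)
  boundm t i := by rw [abs_neg]; exact H.boundm (-t) i
  boundγ t := H.boundγ (-t)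
  elliptic t := H.elliptic (-t)

/-- Integration by parts: second-order terms keep their sign and first-order terms change it. -/
lemma integral_gen_mul {f η : Rd d → ℝ} (hf : ContDiff ℝ 2 f) (hη : ContDiff ℝ ∞ η)
    (hc : HasCompactSupport η) (t : ℝ) :
    ∫ x, H.gen t f x * η x = ∫ x, f x * H.rev.gen (-t) η x := by
  have hf1 : ContDiff ℝ 1 f := hf.of_le (by norm_num)
  have hp : ∀ j, ContDiff ℝ 1 (pd j f) := fun j => contDiff_pd hf (by norm_num) j
  have hη1 : ∀ {g : Rd d → ℝ}, ContDiff ℝ ∞ g → ContDiff ℝ 1 g := fun hg => contDiff_infty.1 hg 1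
  have i0 : Integrable fun x => f x * η x := integrable_mul_compact hf.continuous hη.continuous hc
  have i1 : ∀ i, Integrable fun x => pd i f x * η x := fun i =>
    integrable_mul_compact (hp i).continuous hη.continuous hc
  have i2 : ∀ i j, Integrable fun x => pd i (pd j f) x * η x := fun i j =>
    integrable_mul_compact (continuous_pd (hp j) i) hη.continuous hc
  have k1 : ∀ i, Integrable fun x => f x * pd i η x := fun i =>
    integrable_mul_compact hf.continuous (hη.pd_smooth i).continuous (hc.pd_compact i)
  have k2 : ∀ i j, Integrable fun x => f x * pd i (pd j η) x := fun i j =>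
    integrable_mul_compact hf.continuous ((hη.pd_smooth j).pd_smooth i).continuous
      ((hc.pd_compact j).pd_compact i)
  have e1 : ∀ x, H.gen t f x * η x = 1 / 2 * ∑ i, ∑ j, H.C t i j * (pd i (pd j f) x * η x) +
      ∑ i, H.m t i * (pd i f x * η x) + H.γ t * (f x * η x) := by
    intro x
    simp only [gen, ← mul_assoc, ← Finset.sum_mul]
    ring
  have e2 : ∀ x, f x * H.rev.gen (-t) η x = 1 / 2 * ∑ i, ∑ j, H.C t i j * (f x * pd i (pd j η) x) +
      ∑ i, -H.m t i * (f x * pd i η x) + H.γ t * (f x * η x) := by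
    intro x
    simp only [gen, rev, neg_neg, mul_left_comm _ (f x), ← Finset.mul_sum]
    ring
  have key : ∀ (c : Fin d → Fin d → ℝ) (b : Fin d → ℝ) (g : ℝ) (F : Fin d → Fin d → Rd d → ℝ)
      (B : Fin d → Rd d → ℝ) (Q : Rd d → ℝ), (∀ i j, Integrable (F i j)) → (∀ i, Integrable (B i)) →
      Integrable Q → ∫ x, (1 / 2 * ∑ i, ∑ j, c i j * F i j x + ∑ i, b i * B i x + g * Q x) =
        1 / 2 * (∑ i, ∑ j, c i j * ∫ x, F i j x) + (∑ i, b i * ∫ x, B i x) + g * ∫ x, Q x := by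
    intro c b g F B Q hF hB hQ
    have j1 : ∀ i, Integrable fun x => ∑ j, c i j * F i j x := fun i =>
      integrable_finsetSum _ fun j _ => (hF i j).const_mul _
    have j2 : Integrable fun x => 1 / 2 * ∑ i, ∑ j, c i j * F i j x :=
      (integrable_finsetSum _ fun i _ => j1 i).const_mul _
    have j3 : Integrable fun x => ∑ i, b i * B i x := integrable_finsetSum _ fun i _ =>
      (hB i).const_mul _
    have j4 : Integrable fun x => 1 / 2 * ∑ i, ∑ j, c i j * F i j x + ∑ i, b i * B i x := j2.add j3
    rw [integral_add j4 (hQ.const_mul g), integral_add j2 j3, integral_const_mul,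
      integral_const_mul, integral_finsetSum _ fun i _ => j1 i,
      integral_finsetSum _ fun i _ => (hB i).const_mul _]
    simp only [integral_const_mul]
    congr 3
    refine Finset.sum_congr rfl fun i _ => ?_
    rw [integral_finsetSum _ fun j _ => (hF i j).const_mul _]
    simp only [integral_const_mul]
  simp only [e1, e2]
  refine (key (fun i j => H.C t i j) (H.m t) (H.γ t) _ _ _ i2 i1 i0).trans (Eq.trans ?_
    (key (fun i j => H.C t i j) (fun i => -H.m t i) (H.γ t) _ _ _ k2 k1 i0).symm)
  congr 2
  · congr 1
    refine Finset.sum_congr rfl fun i _ => Finset.sum_congr rfl fun j _ => ?_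
    rw [integral_pd_mul (hp j) (hη1 hη) hc, integral_pd_mul hf1 (hη1 (hη.pd_smooth i))
      (hc.pd_compact i), neg_neg, pd_comm (contDiff_infty.1 hη 2)]
  · refine Finset.sum_congr rfl fun i _ => ?_
    rw [integral_pd_mul hf1 (hη1 hη) hc]
    ring

/-- The error made by commuting the operator with a cutoff function. -/
lemma abs_gen_mul_sub_le {χ g : Rd d → ℝ} (hχ : ContDiff ℝ ∞ χ) (hg : ContDiff ℝ ∞ g) {c : ℝ}
    {x : Rd d} (h1 : ∀ i, |pd i χ x| ≤ c) (h2 : ∀ i j, |pd i (pd j χ) x| ≤ c) (hc : 0 ≤ c) (t : ℝ) :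
    |H.gen t (fun x => χ x * g x) x - χ x * H.gen t g x| ≤
      c * ((2 * d ^ 2 + d) * H.Λ * (|g x| + ∑ j, |pd j g x|)) := by
  have hΛ := H.Λ_pos
  set B := |g x| + ∑ j, |pd j g x| with hB
  have hB0 : |g x| ≤ B := by
    have : 0 ≤ ∑ j, |pd j g x| := Finset.sum_nonneg fun _ _ => abs_nonneg _
    linarith
  have hB1 : ∀ j, |pd j g x| ≤ B := fun j => by
    have := Finset.single_le_sum (f := fun j => |pd j g x|) (fun _ _ => abs_nonneg _)
      (Finset.mem_univ j)
    have := abs_nonneg (g x)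
    linarith
  have hB' : 0 ≤ B := (abs_nonneg _).trans hB0
  have e1 : ∀ j, pd j (fun x => χ x * g x) = fun x => pd j χ x * g x + χ x * pd j g x := fun j =>
    pd_mul (smooth_differentiable hχ) (smooth_differentiable hg) j
  have e2 : ∀ i j, pd i (pd j fun x => χ x * g x) = fun x => (pd i (pd j χ) x * g x +
      pd j χ x * pd i g x) + (pd i χ x * pd j g x + χ x * pd i (pd j g) x) := fun i j => by
    rw [e1, pd_add (smooth_differentiable ((hχ.pd_smooth j).mul hg))
      (smooth_differentiable (hχ.mul (hg.pd_smooth j))), pd_mul (smooth_differentiable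
      (hχ.pd_smooth j)) (smooth_differentiable hg), pd_mul (smooth_differentiable hχ)
      (smooth_differentiable (hg.pd_smooth j))]
  have e3 : H.gen t (fun x => χ x * g x) x - χ x * H.gen t g x = 1 / 2 * ∑ i, ∑ j, H.C t i j *
      (pd i (pd j χ) x * g x + pd j χ x * pd i g x + pd i χ x * pd j g x) +
      ∑ i, H.m t i * (pd i χ x * g x) := by
    have e4 : ∑ i, ∑ j, H.C t i j * pd i (pd j fun x => χ x * g x) x = ∑ i, ∑ j, H.C t i j *
        (pd i (pd j χ) x * g x + pd j χ x * pd i g x + pd i χ x * pd j g x) +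
        χ x * ∑ i, ∑ j, H.C t i j * pd i (pd j g) x := by
      simp only [e2, Finset.mul_sum, ← Finset.sum_add_distrib]
      exact Finset.sum_congr rfl fun i _ => Finset.sum_congr rfl fun j _ => by ring
    have e5 : ∑ i, H.m t i * pd i (fun x => χ x * g x) x = ∑ i, H.m t i * (pd i χ x * g x) +
        χ x * ∑ i, H.m t i * pd i g x := by
      simp only [e1, Finset.mul_sum, ← Finset.sum_add_distrib]
      exact Finset.sum_congr rfl fun i _ => by ring
    rw [gen, gen, e4, e5]
    ring
  have e6 : |∑ i, ∑ j, H.C t i j * (pd i (pd j χ) x * g x + pd j χ x * pd i g x +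
      pd i χ x * pd j g x)| ≤ d * (d * (H.Λ * (3 * (c * B)))) := by
    refine (Finset.abs_sum_le_sum_abs _ _).trans ((Finset.sum_le_card_nsmul _ _
      (d * (H.Λ * (3 * (c * B)))) fun i _ => ?_).trans (by simp))
    refine (Finset.abs_sum_le_sum_abs _ _).trans ((Finset.sum_le_card_nsmul _ _
      (H.Λ * (3 * (c * B))) fun j _ => ?_).trans (by simp))
    rw [abs_mul]
    refine mul_le_mul (H.boundC t i j) ?_ (abs_nonneg _) hΛ.le
    refine (abs_add_le _ _).trans ((add_le_add_left (abs_add_le _ _) _).trans ?_)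
    simp only [abs_mul]
    have := mul_le_mul (h2 i j) hB0 (abs_nonneg _) hc
    have := mul_le_mul (h1 j) (hB1 i) (abs_nonneg _) hc
    have := mul_le_mul (h1 i) (hB1 j) (abs_nonneg _) hc
    linarith
  have e7 : |∑ i, H.m t i * (pd i χ x * g x)| ≤ d * (H.Λ * (c * B)) := by
    refine (Finset.abs_sum_le_sum_abs _ _).trans ((Finset.sum_le_card_nsmul _ _
      (H.Λ * (c * B)) fun i _ => ?_).trans (by simp))
    rw [abs_mul, abs_mul]
    exact mul_le_mul (H.boundm t i) (mul_le_mul (h1 i) hB0 (abs_nonneg _) hc)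
      (by positivity) hΛ.le
  rw [e3]
  refine (abs_add_le _ _).trans ?_
  rw [abs_mul, abs_of_nonneg (by norm_num : (0:ℝ) ≤ 1 / 2)]
  have : 0 ≤ (d : ℝ) * (d * (H.Λ * (c * B))) := by positivity
  nlinarith

end HeatData

/-! ### Cutoff functions -/

/-- Smooth cutoff functions equal to `1` on the ball of radius `1 / ε`, whose first and second
derivatives are `O(ε)`. -/
lemma exists_cutoff (d : ℕ) : ∃ (χ : ℝ → Rd d → ℝ) (c : ℝ), 0 ≤ c ∧
    (∀ ε, ContDiff ℝ ∞ (χ ε)) ∧ (∀ ε, 0 < ε → HasCompactSupport (χ ε)) ∧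
    (∀ ε x, |χ ε x| ≤ 1) ∧ (∀ ε x, 0 ≤ ε → ε * ‖x‖ ≤ 1 → χ ε x = 1) ∧
    (∀ ε, 0 ≤ ε → ε ≤ 1 → ∀ x i, |pd i (χ ε) x| ≤ c * ε) ∧
    ∀ ε, 0 ≤ ε → ε ≤ 1 → ∀ x i j, |pd i (pd j (χ ε)) x| ≤ c * ε := by
  let b : ContDiffBump (0 : Rd d) := ⟨1, 2, one_pos, one_lt_two⟩
  have hb : ContDiff ℝ ∞ b := b.contDiff
  have hbd : ∀ {f : Rd d → ℝ}, ContDiff ℝ ∞ f → HasCompactSupport f → ∃ K, 0 ≤ K ∧ ∀ x, |f x| ≤ K := by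
    intro f hf hc
    obtain ⟨K, hK⟩ := hf.continuous.bounded_above_of_compact_support hc
    exact ⟨K, (norm_nonneg _).trans (hK 0), hK⟩
  choose K₁ hK₁ h₁ using fun i => hbd (hb.pd_smooth i) (b.hasCompactSupport.pd_compact i)
  choose K₂ hK₂ h₂ using fun i j => hbd ((hb.pd_smooth j).pd_smooth i)
    ((b.hasCompactSupport.pd_compact j).pd_compact i)
  have hpd : ∀ {f : Rd d → ℝ}, ContDiff ℝ ∞ f → ∀ (ε : ℝ) i,
      pd i (fun x => f (ε • x)) = fun x => ε * pd i f (ε • x) := by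
    intro f hf ε i
    ext x
    simp only [pd]
    rw [fderiv_comp_smul]
    rfl
  have hs : ∀ {f : Rd d → ℝ}, ContDiff ℝ ∞ f → ∀ ε : ℝ, ContDiff ℝ ∞ fun x => f (ε • x) :=
    fun hf ε => hf.comp (contDiff_const_smul ε)
  refine ⟨fun ε x => b (ε • x), ∑ i, K₁ i + ∑ i, ∑ j, K₂ i j, ?_, fun ε => hs hb ε,
    fun ε hε => b.hasCompactSupport.comp_homeomorph (Homeomorph.smulOfNeZero ε hε.ne'),
    fun ε x => ?_, fun ε x hε hx => ?_, fun ε hε hε1 x i => ?_, fun ε hε hε1 x i j => ?_⟩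
  · exact add_nonneg (Finset.sum_nonneg fun i _ => hK₁ i)
      (Finset.sum_nonneg fun i _ => Finset.sum_nonneg fun j _ => hK₂ i j)
  · rw [abs_of_nonneg b.nonneg]; exact b.le_one
  · refine b.one_of_mem_closedBall ?_
    rw [mem_closedBall_zero_iff, norm_smul, Real.norm_of_nonneg hε]
    exact hx
  · rw [hpd hb, abs_mul, abs_of_nonneg hε, mul_comm]
    refine mul_le_mul_of_nonneg_right ((h₁ i _).trans ?_) hε
    have h3 := Finset.single_le_sum (fun i _ => hK₁ i) (Finset.mem_univ i)
    have h4 : 0 ≤ ∑ i, ∑ j, K₂ i j :=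
      Finset.sum_nonneg fun i _ => Finset.sum_nonneg fun j _ => hK₂ i j
    linarith
  · rw [hpd hb, pd_const_mul, hpd (hb.pd_smooth j), abs_mul, abs_mul, abs_of_nonneg hε]
    have h3 : 0 ≤ ∑ i, K₁ i := Finset.sum_nonneg fun i _ => hK₁ i
    have h4 : ∑ j, K₂ i j ≤ ∑ i, ∑ j, K₂ i j := Finset.single_le_sum (f := fun i => ∑ j, K₂ i j)
      (fun i _ => Finset.sum_nonneg fun j _ => hK₂ i j) (Finset.mem_univ i)
    have h5 := Finset.single_le_sum (fun j _ => hK₂ i j) (Finset.mem_univ j)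
    calc ε * (ε * |pd i (pd j b) (ε • x)|) ≤ ε * (1 * (∑ i, K₁ i + ∑ i, ∑ j, K₂ i j)) := by
          gcongr
          linarith [h₂ i j (ε • x)]
      _ = _ := by ring

lemma integrable_exp_neg_norm : Integrable fun x : Rd d => Real.exp (-‖x‖) := by
  have h := (integrable_one_add_norm (E := Rd d) (μ := volume) (r := (d + 1 : ℕ))
    (by simp)).const_mul ((d + 1).factorial * Real.exp 1)
  refine h.mono' (by fun_prop) (Eventually.of_forall fun x => ?_)
  have h1 := Real.pow_div_factorial_le_exp (1 + ‖x‖) (by positivity) (d + 1)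
  rw [Real.norm_eq_abs, Real.abs_exp, Real.rpow_neg (by positivity), Real.rpow_natCast, Real.exp_neg,
    ← div_eq_mul_inv, inv_eq_one_div, div_le_div_iff₀ (Real.exp_pos _) (by positivity), one_mul]
  rw [div_le_iff₀ (by positivity), Real.exp_add] at h1
  linarith

/-! ### Uniqueness for the homogeneous problem -/

lemma hasDerivAt_integral_of_compact {F F' : ℝ → Rd d → ℝ} {s : ℝ} {U : Set ℝ} (hU : U ∈ 𝓝 s)
    {S : Set (Rd d)} (hS : IsCompact S) (hF : ∀ r ∈ U, Continuous (F r))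
    (hF' : ContinuousOn (fun p : ℝ × Rd d => F' p.1 p.2) (U ×ˢ univ))
    (h0 : ∀ r, ∀ y ∉ S, F r y = 0) (h0' : ∀ r, ∀ y ∉ S, F' r y = 0)
    (hd : ∀ r ∈ U, ∀ y, HasDerivAt (fun r => F r y) (F' r y) r) :
    HasDerivAt (fun r => ∫ y, F r y) (∫ y, F' s y) s := by
  obtain ⟨ε, hε, hball⟩ := Metric.nhds_basis_closedBall.mem_iff.1 hU
  obtain ⟨K, hK⟩ := ((isCompact_closedBall s ε).prod hS).exists_bound_of_continuousOn
    (hF'.mono (prod_mono hball (subset_univ _)))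
  have hs : s ∈ U := mem_of_mem_nhds hU
  have hF's : Continuous (F' s) := by
    rw [← continuousOn_univ]
    exact hF'.comp (f := fun y : Rd d => (s, y)) (by fun_prop) fun y hy => ⟨hs, hy⟩
  refine (hasDerivAt_integral_of_dominated_loc_of_deriv_le (μ := volume)
    (bound := S.indicator fun _ => |K|) (Metric.closedBall_mem_nhds s hε) ?_ ?_
    hF's.aestronglyMeasurable (Eventually.of_forall fun y r hr => ?_) ?_
    (Eventually.of_forall fun y r hr => hd r (hball hr) y)).2
  · filter_upwards [hU] with r hr using (hF r hr).aestronglyMeasurable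
  · exact (hF s hs).integrable_of_hasCompactSupport (HasCompactSupport.intro hS (h0 s))
  · by_cases hy : y ∈ S
    · rw [indicator_of_mem hy]
      exact (hK (r, y) ⟨hr, hy⟩).trans (le_abs_self K)
    · rw [indicator_of_notMem hy, h0' r y hy, norm_zero]
  · exact (integrable_indicator_iff hS.measurableSet).2 (integrableOn_const hS.measure_lt_top.ne)

lemma tsupport_pd_subset (f : Rd d → ℝ) (i : Fin d) : tsupport (pd i f) ⊆ tsupport f := by
  refine closure_minimal (fun x hx => ?_) (isClosed_tsupport _)
  by_contra hx'
  refine hx ?_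
  simp only [pd]
  rw [image_eq_zero_of_notMem_tsupport fun h => hx' (tsupport_fderiv_subset ℝ h)]
  rfl

namespace HeatData

variable {H : HeatData d} {T t₀ : ℝ} {ρ : Rd d → ℝ}

variable (H t₀ ρ) in
/-- The solution of the forward (adjoint) equation with initial datum `ρ` at time `t₀`: the Gaussian
solution of a backward equation, read with time reversed. -/
noncomputable def dual (s : ℝ) : Rd d → ℝ := H.rev.sol (-t₀) ρ (-s)

section dual

variable (hρ : Continuous ρ) (hρc : HasCompactSupport ρ)
include hρ hρc

/-- A compactly supported function is dominated by every exponential. -/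
lemma exists_exp_bound (κ : ℝ) : ∃ K : ℝ, ∀ y, |ρ y| ≤ K * Real.exp (κ * ‖y‖) := by
  have h1 : Continuous fun y => ρ y * Real.exp (-(κ * ‖y‖)) := by fun_prop
  obtain ⟨K, hK⟩ := h1.bounded_above_of_compact_support hρc.mul_right
  refine ⟨K, fun y => ?_⟩
  have h2 := hK y
  rw [Real.norm_eq_abs, abs_mul, Real.abs_exp, Real.exp_neg, ← div_eq_mul_inv,
    div_le_iff₀ (Real.exp_pos _)] at h2
  exact h2

lemma contDiff_dual {s : ℝ} (hs : t₀ < s) : ContDiff ℝ ∞ (H.dual t₀ ρ s) := by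
  obtain ⟨K, hK⟩ := exists_exp_bound hρ hρc 0
  exact contDiff_sol hρ.measurable hK (neg_lt_neg hs)

lemma hasDerivAt_dual {s : ℝ} (hs : t₀ < s) (x : Rd d) :
    HasDerivAt (fun s => H.dual t₀ ρ s x) (H.rev.gen (-s) (H.dual t₀ ρ s) x) s := by
  obtain ⟨K, hK⟩ := exists_exp_bound hρ hρc 0
  have h := (hasDerivAt_sol (H := H.rev) hρ.measurable hK (neg_lt_neg hs) x).comp s (hasDerivAt_neg s)
  exact h.congr_deriv (by rw [mul_neg_one, neg_neg]; rfl)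

lemma continuousOn_pdL_dual (L : List (Fin d)) :
    ContinuousOn (fun p : ℝ × Rd d => pdL L (H.dual t₀ ρ p.1) p.2) (Ioi t₀ ×ˢ univ) := by
  obtain ⟨K, hK⟩ := exists_exp_bound hρ hρc 0
  exact (continuousOn_pdL_sol (H := H.rev) hρ.measurable hK L).comp
    (f := fun p : ℝ × Rd d => (-p.1, p.2)) (by fun_prop) fun p hp =>
      ⟨neg_lt_neg (show t₀ < p.1 from hp.1), hp.2⟩

/-- As `ρ` has compact support, `κ` is arbitrary here: the adjoint solution decays faster than any
exponential. -/
lemma growth_pdL_dual (κ : ℝ) (L : List (Fin d)) (S : ℝ) : ∃ K : ℝ, 0 ≤ K ∧ ∀ s, t₀ < s →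
    s - t₀ ≤ S → ∀ x, |pdL L (H.dual t₀ ρ s) x| * √(s - t₀) ^ L.length ≤ K * Real.exp (κ * ‖x‖) := by
  obtain ⟨K, hK⟩ := exists_exp_bound hρ hρc κ
  obtain ⟨K', hK', h⟩ := growth_pdL_sol (H := H.rev) (T := -t₀) hρ.measurable hK L S
  refine ⟨K', hK', fun s hs hS x => ?_⟩
  have := h (-s) (neg_lt_neg hs) (by linarith) x
  rwa [neg_sub_neg] at this

lemma tendsto_dual : ∀ᵐ x, Tendsto (fun s => H.dual t₀ ρ s x) (𝓝[>] t₀) (𝓝 (ρ x)) := by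
  obtain ⟨K, hK⟩ := exists_exp_bound hρ hρc 0
  filter_upwards [ae_lebPt hρ.measurable hK] with x hx
  exact (tendsto_sol (H := H.rev) hρ.measurable hK hx).comp (tendsto_neg_nhdsGT)

end dual

/-- The properties of a classical solution of the homogeneous problem. -/
structure Classical (H : HeatData d) (T K κ : ℝ) (v : ℝ → Rd d → ℝ) : Prop where
  contDiff : ∀ t ∈ Ico 0 T, ContDiff ℝ 2 (v t)
  continuousOn : ∀ L : List (Fin d), L.length ≤ 2 →
    ContinuousOn (fun p : ℝ × Rd d => pdL L (v p.1) p.2) (Ico 0 T ×ˢ univ)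
  pde : ∀ t ∈ Ioo 0 T, ∀ x, HasDerivAt (fun s => v s x) (-H.gen t (v t) x) t
  growth : ∀ t ∈ Ico 0 T, ∀ x, |v t x| ≤ K * Real.exp (κ * ‖x‖)

lemma continuousOn_gen {V : Set ℝ} {w : ℝ → Rd d → ℝ} {e : ℝ → ℝ} (he : Continuous e)
    (hw : ∀ L : List (Fin d), L.length ≤ 2 →
      ContinuousOn (fun p : ℝ × Rd d => pdL L (w p.1) p.2) (V ×ˢ univ)) :
    ContinuousOn (fun p : ℝ × Rd d => H.gen (e p.1) (w p.1) p.2) (V ×ˢ univ) := by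
  have hc : ∀ {c : ℝ → ℝ}, Continuous c → Continuous fun p : ℝ × Rd d => c (e p.1) :=
    fun hc => hc.comp (he.comp continuous_fst)
  unfold gen
  refine ((continuousOn_const.mul (continuousOn_finsetSum _ fun i _ =>
    continuousOn_finsetSum _ fun j _ => (hc (H.contC i j)).continuousOn.mul ?_)).add
    (continuousOn_finsetSum _ fun i _ => (hc (H.contm i)).continuousOn.mul ?_)).add
    ((hc H.contγ).continuousOn.mul (hw [] (by simp)))
  · exact hw [i, j] (by simp)
  · exact hw [i] (by simp)

namespace Classical

variable {K κ : ℝ} {v : ℝ → Rd d → ℝ} (hv : H.Classical T K κ v) (ht₀ : 0 ≤ t₀)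
  (hρ : Continuous ρ) (hρc : HasCompactSupport ρ)
include hv ht₀ hρ hρc

/-- Testing against the solution of the adjoint equation, only the derivatives of the cutoff
contribute to the time derivative. -/
lemma hasDerivAt_pairing {χ : Rd d → ℝ} (hχ : ContDiff ℝ ∞ χ) (hχc : HasCompactSupport χ) {s : ℝ}
    (hs : s ∈ Ioo t₀ T) :
    HasDerivAt (fun s => ∫ y, v s y * (χ y * H.dual t₀ ρ s y))
      (-∫ y, v s y * (H.rev.gen (-s) (fun y => χ y * H.dual t₀ ρ s y) y -
        χ y * H.rev.gen (-s) (H.dual t₀ ρ s) y)) s := by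
  have hsub : Ioo t₀ T ⊆ Ico 0 T := fun r hr => ⟨ht₀.trans hr.1.le, hr.2⟩
  have hv0 : ∀ r ∈ Ioo t₀ T, Continuous (v r) := fun r hr => (hv.contDiff r (hsub hr)).continuous
  have hΨ : ∀ r ∈ Ioo t₀ T, ContDiff ℝ ∞ (H.dual t₀ ρ r) := fun r hr => contDiff_dual hρ hρc hr.1
  have cv : ∀ L : List (Fin d), L.length ≤ 2 →
      ContinuousOn (fun p : ℝ × Rd d => pdL L (v p.1) p.2) (Ioo t₀ T ×ˢ univ) := fun L hL =>
    (hv.continuousOn L hL).mono (prod_mono hsub Subset.rfl)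
  have cΨ : ∀ L : List (Fin d),
      ContinuousOn (fun p : ℝ × Rd d => pdL L (H.dual t₀ ρ p.1) p.2) (Ioo t₀ T ×ˢ univ) := fun L =>
    (continuousOn_pdL_dual hρ hρc L).mono (prod_mono (fun r hr => hr.1) Subset.rfl)
  have cχ : ContinuousOn (fun p : ℝ × Rd d => χ p.2) (Ioo t₀ T ×ˢ univ) :=
    (hχ.continuous.comp continuous_snd).continuousOn
  have key := hasDerivAt_integral_of_compact (s := s) (U := Ioo t₀ T) (Ioo_mem_nhds hs.1 hs.2) hχc
    (F := fun s y => v s y * (χ y * H.dual t₀ ρ s y))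
    (F' := fun s y => -H.gen s (v s) y * (χ y * H.dual t₀ ρ s y) +
      v s y * (χ y * H.rev.gen (-s) (H.dual t₀ ρ s) y))
    (fun r hr => (hv0 r hr).mul (hχ.continuous.mul (hΨ r hr).continuous))
    ((((continuousOn_gen continuous_id cv).neg).mul (cχ.mul (cΨ []))).add
      ((cv [] (by simp)).mul (cχ.mul (continuousOn_gen (H := H.rev) continuous_neg fun L _ => cΨ L))))
    (fun r y hy => by simp [image_eq_zero_of_notMem_tsupport hy])
    (fun r y hy => by simp [image_eq_zero_of_notMem_tsupport hy])
    (fun r hr y => (hv.pde r ⟨ht₀.trans_lt hr.1, hr.2⟩ y).mul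
      ((hasDerivAt_dual hρ hρc hr.1 y).const_mul (χ y)))
  refine key.congr_deriv ?_
  have hχΨ : ContDiff ℝ ∞ fun y => χ y * H.dual t₀ ρ s y := hχ.mul (hΨ s hs)
  have hχΨc : HasCompactSupport fun y => χ y * H.dual t₀ ρ s y := hχc.mul_right
  have hv2 := hv.contDiff s (hsub hs)
  have hslice : ∀ {F : ℝ × Rd d → ℝ}, ContinuousOn F (Ioo t₀ T ×ˢ univ) →
      Continuous fun y => F (s, y) := fun hF => by
    rw [← continuousOn_univ]
    exact hF.comp (f := fun y : Rd d => (s, y)) (by fun_prop) fun y hy => ⟨hs, hy⟩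
  have i1 : Integrable fun y => -H.gen s (v s) y * (χ y * H.dual t₀ ρ s y) :=
    integrable_mul_compact (hslice (continuousOn_gen continuous_id cv).neg) hχΨ.continuous hχΨc
  have i2 : Integrable fun y => v s y * (χ y * H.rev.gen (-s) (H.dual t₀ ρ s) y) :=
    integrable_mul_compact hv2.continuous
      (hχ.continuous.mul (H.rev.contDiff_gen (hΨ s hs) _).continuous) hχc.mul_right
  have i3 : Integrable fun y => v s y * H.rev.gen (-s) (fun y => χ y * H.dual t₀ ρ s y) y := by
    refine (hv2.continuous.mul (H.rev.contDiff_gen hχΨ _).continuous).integrable_of_hasCompactSupport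
      (HasCompactSupport.mul_left (HasCompactSupport.intro hχΨc fun y hy => ?_))
    have h0 := image_eq_zero_of_notMem_tsupport hy
    have h1 := fun i => image_eq_zero_of_notMem_tsupport fun h => hy (tsupport_pd_subset _ i h)
    have h2 := fun i j => image_eq_zero_of_notMem_tsupport fun h =>
      hy (tsupport_pd_subset _ j (tsupport_pd_subset _ i h))
    simp [gen, h0, h1, h2]
  rw [integral_add i1 i2]
  simp only [neg_mul, mul_sub]
  rw [integral_neg, H.integral_gen_mul hv2 hχΨ hχΨc, integral_sub i3 i2]
  ring

end Classical

end HeatData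

namespace HeatData.Classical

variable {H : HeatData d} {T t₀ : ℝ} {ρ : Rd d → ℝ}

variable {K κ : ℝ} {v : ℝ → Rd d → ℝ} (hv : H.Classical T K κ v) (ht₀ : 0 ≤ t₀)
  (hρ : Continuous ρ) (hρc : HasCompactSupport ρ)
include hv ht₀ hρ hρc

omit ht₀ in
/-- The adjoint solution decays fast enough to compensate the growth of `v`. -/
lemma exists_dual_bound : ∃ K₁ : ℝ, 0 ≤ K₁ ∧ ∀ t ∈ Ico 0 T, ∀ s ∈ Ioo t₀ T, ∀ y,
    |v t y| * |H.dual t₀ ρ s y| ≤ K₁ * Real.exp (-‖y‖) := by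
  -- the exponent `-(κ + 1)` beats the growth rate `κ` of `v` by one
  obtain ⟨K₁, hK₁, h⟩ := growth_pdL_dual (H := H) hρ hρc (-(κ + 1)) [] (T - t₀)
  refine ⟨|K| * K₁, by positivity, fun t ht s hs y => ?_⟩
  have h1 := h s hs.1 (by linarith [hs.2]) y
  simp only [pdL_nil, List.length_nil, pow_zero, mul_one] at h1
  have h2 : |v t y| ≤ |K| * Real.exp (κ * ‖y‖) := (hv.growth t ht y).trans
    (mul_le_mul_of_nonneg_right (le_abs_self K) (Real.exp_pos _).le)
  refine (mul_le_mul h2 h1 (abs_nonneg _) (by positivity)).trans (le_of_eq ?_)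
  rw [mul_mul_mul_comm, ← Real.exp_add]
  ring_nf

/-- The derivatives of the adjoint solution are singular at `t₀`, so `s` stays away from it. -/
lemma exists_dual_pd_bound {s₁ : ℝ} (hs₁ : t₀ < s₁) : ∃ K₁ : ℝ, 0 ≤ K₁ ∧ ∀ s ∈ Ico s₁ T, ∀ y,
    |v s y| * (|H.dual t₀ ρ s y| + ∑ j, |pd j (H.dual t₀ ρ s) y|) ≤ K₁ * Real.exp (-‖y‖) := by
  obtain ⟨K₀, hK₀, h0⟩ := hv.exists_dual_bound hρ hρc
  choose K₁ hK₁ h1 using fun j => growth_pdL_dual (H := H) hρ hρc (-(κ + 1)) [j] (T - t₀)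
  have hr : 0 < √(s₁ - t₀) := Real.sqrt_pos.2 (sub_pos.2 hs₁)
  refine ⟨K₀ + ∑ j, |K| * (K₁ j / √(s₁ - t₀)), add_nonneg hK₀ (Finset.sum_nonneg fun j _ =>
    mul_nonneg (abs_nonneg _) (div_nonneg (hK₁ j) hr.le)), fun s hs y => ?_⟩
  have hs0 : t₀ < s := hs₁.trans_le hs.1
  have ht : s ∈ Ico 0 T := ⟨ht₀.trans hs0.le, hs.2⟩
  have h2 : |v s y| ≤ |K| * Real.exp (κ * ‖y‖) := (hv.growth s ht y).trans
    (mul_le_mul_of_nonneg_right (le_abs_self K) (Real.exp_pos _).le)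
  rw [mul_add, add_mul, Finset.mul_sum, Finset.sum_mul]
  refine add_le_add (h0 s ht s ⟨hs0, hs.2⟩ y) (Finset.sum_le_sum fun j _ => ?_)
  have h3 := h1 j s hs0 (by linarith [hs.2]) y
  simp only [pdL_cons, pdL_nil, List.length_singleton, pow_one] at h3
  have h4 : |pd j (H.dual t₀ ρ s) y| ≤ K₁ j / √(s₁ - t₀) * Real.exp (-(κ + 1) * ‖y‖) := by
    rw [div_mul_eq_mul_div, le_div_iff₀ hr]
    refine (mul_le_mul_of_nonneg_left (Real.sqrt_le_sqrt ?_) (abs_nonneg _)).trans h3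
    linarith [hs.1]
  refine (mul_le_mul h2 h4 (abs_nonneg _) (by positivity)).trans (le_of_eq ?_)
  rw [mul_mul_mul_comm, ← Real.exp_add]
  ring_nf

/-- The pairing of a solution with an adjoint solution is constant in time: with a cutoff `χ_ε` its
derivative is `O(ε)` by `hasDerivAt_pairing` and `abs_gen_mul_sub_le`, and then `ε → 0`. -/
lemma integral_mul_dual_const {s₁ s₂ : ℝ} (h₁ : t₀ < s₁) (h₁₂ : s₁ ≤ s₂) (h₂ : s₂ < T) :
    ∫ y, v s₁ y * H.dual t₀ ρ s₁ y = ∫ y, v s₂ y * H.dual t₀ ρ s₂ y := by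
  obtain ⟨χ, c, hc, hχ, hχc, hχ1, hχe, hd1, hd2⟩ := exists_cutoff d
  obtain ⟨K₀, hK₀, hb0⟩ := hv.exists_dual_bound hρ hρc
  obtain ⟨K₁, hK₁, hb1⟩ := hv.exists_dual_pd_bound ht₀ hρ hρc h₁
  have hint : Integrable fun y : Rd d => Real.exp (-‖y‖) := integrable_exp_neg_norm
  have hmem : ∀ s, s₁ ≤ s → s ≤ s₂ → s ∈ Ioo t₀ T := fun s h h' =>
    ⟨h₁.trans_le h, h'.trans_lt h₂⟩
  let ε : ℕ → ℝ := fun n => 1 / ((n : ℝ) + 1)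
  have hε0 : ∀ n, 0 < ε n := fun n => by positivity
  have hε1 : ∀ n, ε n ≤ 1 := fun n => by
    simp only [ε]
    rw [div_le_one (by positivity)]
    linarith [(Nat.cast_nonneg n : (0:ℝ) ≤ n)]
  have hεlim : Tendsto ε atTop (𝓝 0) := tendsto_one_div_add_atTop_nhds_zero_nat
  -- removing the cutoff
  have hlim : ∀ s, s₁ ≤ s → s ≤ s₂ → Tendsto (fun n => ∫ y, v s y * (χ (ε n) y * H.dual t₀ ρ s y))
      atTop (𝓝 (∫ y, v s y * H.dual t₀ ρ s y)) := by
    intro s h h'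
    have hs := hmem s h h'
    have ht : s ∈ Ico 0 T := ⟨ht₀.trans hs.1.le, hs.2⟩
    refine tendsto_integral_of_dominated_convergence (fun y => K₀ * Real.exp (-‖y‖)) (fun n => ?_)
      (hint.const_mul K₀) (fun n => Eventually.of_forall fun y => ?_)
      (Eventually.of_forall fun y => ?_)
    · exact ((hv.contDiff s ht).continuous.mul ((hχ _).continuous.mul
        (contDiff_dual hρ hρc hs.1).continuous)).aestronglyMeasurable
    · rw [Real.norm_eq_abs, abs_mul, abs_mul, mul_left_comm]
      exact (mul_le_of_le_one_left (by positivity) (hχ1 _ _)).trans (hb0 s ht s hs y)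
    · refine tendsto_const_nhds.congr' ?_
      have h3 := hεlim.mul_const ‖y‖
      rw [zero_mul] at h3
      filter_upwards [h3.eventually (gt_mem_nhds one_pos)] with n hn
      rw [hχe _ y (hε0 n).le hn.le, one_mul]
  have hdiff : ∀ n, |(∫ y, v s₂ y * (χ (ε n) y * H.dual t₀ ρ s₂ y)) -
      ∫ y, v s₁ y * (χ (ε n) y * H.dual t₀ ρ s₁ y)| ≤
      (c * ε n) * ((2 * d ^ 2 + d) * H.Λ * K₁ * ∫ y : Rd d, Real.exp (-‖y‖)) * (s₂ - s₁) := by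
    intro n
    have hcε : 0 ≤ c * ε n := mul_nonneg hc (hε0 n).le
    have h4 := (convex_Icc s₁ s₂).norm_image_sub_le_of_norm_hasDerivWithin_le
      (f := fun s => ∫ y, v s y * (χ (ε n) y * H.dual t₀ ρ s y))
      (C := (c * ε n) * ((2 * d ^ 2 + d) * H.Λ * K₁ * ∫ y : Rd d, Real.exp (-‖y‖)))
      (fun s hs => (hv.hasDerivAt_pairing ht₀ hρ hρc (hχ (ε n)) (hχc _ (hε0 n))
        (hmem s hs.1 hs.2)).hasDerivWithinAt) (fun s hs => ?_) (left_mem_Icc.2 h₁₂)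
      (right_mem_Icc.2 h₁₂)
    · rwa [Real.norm_eq_abs, Real.norm_eq_abs, abs_of_nonneg (sub_nonneg.2 h₁₂)] at h4
    · have hs' := hmem s hs.1 hs.2
      rw [norm_neg, ← mul_assoc, ← integral_const_mul]
      refine norm_integral_le_of_norm_le (hint.const_mul _) (Eventually.of_forall fun y => ?_)
      rw [Real.norm_eq_abs, abs_mul]
      have h5 := H.rev.abs_gen_mul_sub_le (hχ (ε n)) (contDiff_dual (H := H) hρ hρc hs'.1)
        (x := y) (c := c * ε n) (hd1 _ (hε0 n).le (hε1 n) y) (hd2 _ (hε0 n).le (hε1 n) y) hcε (-s)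
      refine (mul_le_mul_of_nonneg_left h5 (abs_nonneg _)).trans ?_
      have h6 := hb1 s ⟨hs.1, hs'.2⟩ y
      have hΛ := H.Λ_pos
      calc _ = c * ε n * ((2 * d ^ 2 + d) * H.Λ) *
            (|v s y| * (|H.dual t₀ ρ s y| + ∑ j, |pd j (H.dual t₀ ρ s) y|)) := by
              simp only [rev]; ring
        _ ≤ c * ε n * ((2 * d ^ 2 + d) * H.Λ) * (K₁ * Real.exp (-‖y‖)) := by gcongr
        _ = _ := by ring
  have h7 := ((hlim s₂ h₁₂ le_rfl).sub (hlim s₁ le_rfl h₁₂)).abs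
  have h8 : Tendsto (fun n => (c * ε n) * ((2 * d ^ 2 + d) * H.Λ * K₁ *
      ∫ y : Rd d, Real.exp (-‖y‖)) * (s₂ - s₁)) atTop (𝓝 0) := by
    simpa using ((hεlim.const_mul c).mul_const
      ((2 * d ^ 2 + d) * H.Λ * K₁ * ∫ y : Rd d, Real.exp (-‖y‖))).mul_const (s₂ - s₁)
  have h9 := le_of_tendsto_of_tendsto' h7 h8 hdiff
  linarith [abs_nonpos_iff.1 h9]

/-- The pairing is constant on `(t₀,T)`; it tends to `∫ v(t₀) ρ` at the left end and to `0` at the right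
end. -/
lemma integral_mul_eq_zero (htT : t₀ < T)
    (hterm : ∀ᵐ x, Tendsto (fun t => v t x) (𝓝[<] T) (𝓝 0)) : ∫ y, v t₀ y * ρ y = 0 := by
  obtain ⟨K₀, hK₀, hb0⟩ := hv.exists_dual_bound hρ hρc
  have hint : Integrable fun y : Rd d => Real.exp (-‖y‖) := integrable_exp_neg_norm
  obtain ⟨m, hm1, hm2⟩ := exists_between htT
  have hmeas : ∀ s ∈ Ioo t₀ T, AEStronglyMeasurable (fun y => v s y * H.dual t₀ ρ s y) volume :=
    fun s hs => ((hv.contDiff s ⟨ht₀.trans hs.1.le, hs.2⟩).continuous.mul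
      (contDiff_dual hρ hρc hs.1).continuous).aestronglyMeasurable
  have hbound : ∀ s ∈ Ioo t₀ T, ∀ y, ‖v s y * H.dual t₀ ρ s y‖ ≤ K₀ * Real.exp (-‖y‖) :=
    fun s hs y => by
      rw [Real.norm_eq_abs, abs_mul]
      exact hb0 s ⟨ht₀.trans hs.1.le, hs.2⟩ s hs y
  have hconst : ∀ s ∈ Ioo t₀ T, ∫ y, v s y * H.dual t₀ ρ s y = ∫ y, v m y * H.dual t₀ ρ m y := by
    intro s hs
    rcases le_total s m with h | h
    · exact hv.integral_mul_dual_const ht₀ hρ hρc hs.1 h hm2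
    · exact (hv.integral_mul_dual_const ht₀ hρ hρc hm1 h hs.2).symm
  have hT : Tendsto (fun s => ∫ y, v s y * H.dual t₀ ρ s y) (𝓝[<] T) (𝓝 (∫ _ : Rd d, (0:ℝ))) := by
    have hev : ∀ᶠ s in 𝓝[<] T, s ∈ Ioo m T := Ioo_mem_nhdsLT hm2
    refine tendsto_integral_filter_of_dominated_convergence (fun y => K₀ * Real.exp (-‖y‖))
      (hev.mono fun s hs => hmeas s ⟨hm1.trans hs.1, hs.2⟩)
      (hev.mono fun s hs => Eventually.of_forall (hbound s ⟨hm1.trans hs.1, hs.2⟩))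
      (hint.const_mul K₀) ?_
    -- away from `t₀` the adjoint solution is bounded
    obtain ⟨K₁, -, h1⟩ := growth_pdL_dual (H := H) hρ hρc 0 [] (T - t₀)
    filter_upwards [hterm] with y hy
    have h2 := hy.abs.mul_const K₁
    rw [abs_zero, zero_mul] at h2
    refine squeeze_zero_norm' (hev.mono fun s hs => ?_) h2
    rw [Real.norm_eq_abs, abs_mul]
    have := h1 s (hm1.trans hs.1) (by linarith [hs.2]) y
    simp only [pdL_nil, List.length_nil, pow_zero, mul_one, zero_mul, Real.exp_zero] at this
    exact mul_le_mul_of_nonneg_left this (abs_nonneg _)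
  have ht : Tendsto (fun s => ∫ y, v s y * H.dual t₀ ρ s y) (𝓝[>] t₀)
      (𝓝 (∫ y, v t₀ y * ρ y)) := by
    have hev : ∀ᶠ s in 𝓝[>] t₀, s ∈ Ioo t₀ T := Ioo_mem_nhdsGT htT
    refine tendsto_integral_filter_of_dominated_convergence (fun y => K₀ * Real.exp (-‖y‖))
      (hev.mono fun s hs => hmeas s hs)
      (hev.mono fun s hs => Eventually.of_forall (hbound s hs)) (hint.const_mul K₀) ?_
    filter_upwards [tendsto_dual (H := H) hρ hρc] with y hy
    refine Tendsto.mul ?_ hy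
    have h1 : ContinuousOn (fun s => v s y) (Ico 0 T) :=
      (hv.continuousOn [] (by simp)).comp (f := fun s : ℝ => (s, y)) (by fun_prop)
        fun s hs => ⟨hs, mem_univ _⟩
    refine (h1 t₀ ⟨ht₀, htT⟩).mono_left (nhdsWithin_le_iff.2 ?_)
    filter_upwards [hev] with s hs using ⟨ht₀.trans hs.1.le, hs.2⟩
  rw [integral_zero] at hT
  have h1 := hT.congr' (mem_of_superset (Ioo_mem_nhdsLT htT) hconst)
  have h2 := ht.congr' (mem_of_superset (Ioo_mem_nhdsGT htT) hconst)
  rw [tendsto_nhds_unique h2 tendsto_const_nhds, ← tendsto_nhds_unique h1 tendsto_const_nhds]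

omit hρ hρc in
/-- The test function `ρ` in `integral_mul_eq_zero` is arbitrary. -/
theorem eq_zero (htT : t₀ < T) (hterm : ∀ᵐ x, Tendsto (fun t => v t x) (𝓝[<] T) (𝓝 0)) :
    v t₀ = fun _ => 0 := by
  have hc := (hv.contDiff t₀ ⟨ht₀, htT⟩).continuous
  have h1 := ae_eq_zero_of_integral_contDiff_smul_eq_zero (μ := (volume : Measure (Rd d)))
    hc.locallyIntegrable fun g hg hgc => by
      simpa only [smul_eq_mul, mul_comm] using
        hv.integral_mul_eq_zero ht₀ hg.continuous hgc htT hterm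
  exact Measure.eq_of_ae_eq h1 hc continuous_const

end HeatData.Classical

/-! ### Uniqueness for the Cauchy problems -/

namespace IsSolution

variable {a : Coeffs d} {T : ℝ} {g g' : ℝ → Rd d → ℝ} {ψ : Rd d → ℝ} {v v' : ℝ → Rd d → ℝ}

lemma continuousOn_pdL (h : IsSolution a T g ψ v) {L : List (Fin d)} (hL : L.length ≤ 2) :
    ContinuousOn (fun p : ℝ × Rd d => pdL L (v p.1) p.2) (Ico 0 T ×ˢ univ) := by
  match L, hL with
  | [], _ => simpa only [D_zero, pdL_nil] using h.continuousOn 0 Coeffs.zero_mem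
  | [i], _ => simpa only [D_single, pdL_cons, pdL_nil] using h.continuousOn _ (Coeffs.single_mem i)
  | [i, j], _ =>
    refine (h.continuousOn _ (Coeffs.pair_mem i j)).congr fun p hp => ?_
    exact (congrFun (D_pair (h.contDiff p.1 hp.1) i j) p.2).symm

lemma pdL_sub {f g : Rd d → ℝ} (hf : ContDiff ℝ 2 f) (hg : ContDiff ℝ 2 g) {L : List (Fin d)}
    (hL : L.length ≤ 2) : pdL L (fun x => f x - g x) = fun x => pdL L f x - pdL L g x := by
  have h1 : ∀ {f : Rd d → ℝ}, ContDiff ℝ 2 f → ∀ i, Differentiable ℝ (pd i f) := fun hf i =>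
    (contDiff_pd (m := 1) hf (by norm_num) i).differentiable (by norm_num)
  have h0 : ∀ {f : Rd d → ℝ}, ContDiff ℝ 2 f → Differentiable ℝ f := fun hf =>
    hf.differentiable (by norm_num)
  match L, hL with
  | [], _ => rfl
  | [i], _ => exact pd_sub (h0 hf) (h0 hg) i
  | [i, j], _ =>
    simp only [pdL_cons, pdL_nil]
    rw [pd_sub (h0 hf) (h0 hg) j, pd_sub (h1 hf j) (h1 hg j) i]

/-- The difference of two solutions is a solution of the homogeneous problem with zero datum. -/
theorem unique (ha : a.Regular) (h : IsSolution a T g ψ v) (h' : IsSolution a T g' ψ v')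
    (hg : ∀ t ∈ Ico 0 T, ∀ x, g t x = g' t x) {t : ℝ} (ht : t ∈ Ico 0 T) : v t = v' t := by
  obtain ⟨K, κ, hK⟩ := h.growth
  obtain ⟨K', κ', hK'⟩ := h'.growth
  have hw : ha.heat.Classical T (|K| + |K'|) (max κ κ') fun t x => v t x - v' t x :=
    { contDiff := fun t ht => (h.contDiff t ht).sub (h'.contDiff t ht)
      continuousOn := fun L hL => ((h.continuousOn_pdL hL).sub (h'.continuousOn_pdL hL)).congr
        fun p hp => congrFun (pdL_sub (h.contDiff p.1 hp.1) (h'.contDiff p.1 hp.1) hL) p.2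
      pde := fun t ht x => by
        have ht' : t ∈ Ico 0 T := Ioo_subset_Ico_self ht
        have hn : Ico 0 T ∈ 𝓝 t := Ico_mem_nhds ht.1 ht.2
        have h1 := ((h.pde t ht' x).hasDerivAt hn).sub ((h'.pde t ht' x).hasDerivAt hn)
        refine h1.congr_deriv ?_
        rw [hg t ht' x, ha.op_zero (h.contDiff t ht'), ha.op_zero (h'.contDiff t ht')]
        have e1 := fun i => pdL_sub (h.contDiff t ht') (h'.contDiff t ht') (L := [i]) (by simp)
        have e2 := fun i j => pdL_sub (h.contDiff t ht') (h'.contDiff t ht') (L := [i, j]) (by simp)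
        simp only [pdL_cons, pdL_nil] at e1 e2
        simp only [HeatData.gen, e2]
        simp only [e1, mul_sub, Finset.sum_sub_distrib]
        ring
      growth := fun t ht x => by
        have h1 : Real.exp (κ * ‖x‖) ≤ Real.exp (max κ κ' * ‖x‖) := by
          gcongr; exact le_max_left _ _
        have h2 : Real.exp (κ' * ‖x‖) ≤ Real.exp (max κ κ' * ‖x‖) := by
          gcongr; exact le_max_right _ _
        refine (abs_sub _ _).trans ((add_le_add (hK t ht x) (hK' t ht x)).trans ?_)
        rw [add_mul]
        exact add_le_add (mul_le_mul (le_abs_self K) h1 (Real.exp_pos _).le (abs_nonneg _))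
          (mul_le_mul (le_abs_self K') h2 (Real.exp_pos _).le (abs_nonneg _)) }
  have hterm : ∀ᵐ x, Tendsto (fun t => v t x - v' t x) (𝓝[<] T) (𝓝 0) := by
    filter_upwards [h.terminal, h'.terminal] with x h1 h2
    simpa using h1.sub h2
  have h0 := hw.eq_zero ht.1 ht.2 hterm
  ext x
  exact sub_eq_zero.1 (congrFun h0 x)

/-- Being a solution depends only on the restrictions to `[0,T)`. -/
lemma congr {a' : Coeffs d} (hT : 0 < T) (h : IsSolution a T g ψ v)
    (ha : ∀ t ∈ Ico 0 T, ∀ f x, a.op 0 t f x = a'.op 0 t f x)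
    (hg : ∀ t ∈ Ico 0 T, ∀ x, g t x = g' t x) (hv : ∀ t ∈ Ico 0 T, v t = v' t) :
    IsSolution a' T g' ψ v' where
  contDiff t ht := hv t ht ▸ h.contDiff t ht
  continuousOn α hα := (h.continuousOn α hα).congr fun p hp => by
    beta_reduce
    rw [hv _ hp.1]
  pde t ht x := by
    rw [← hg t ht, ← ha t ht, ← hv t ht]
    exact (h.pde t ht x).congr (fun s hs => by rw [hv s hs]) (by rw [hv t ht])
  growth := by
    obtain ⟨K, κ, hK⟩ := h.growth
    exact ⟨K, κ, fun t ht x => hv t ht ▸ hK t ht x⟩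
  terminal := h.terminal.mono fun x hx => hx.congr' (by
    filter_upwards [Ico_mem_nhdsLT hT] with t ht
    rw [hv t ht])

end IsSolution

namespace IsFormalExpansion

variable {a : Coeffs d} {T : ℝ} {φ : Rd d → ℝ} {u u' : ℕ → ℝ → Rd d → ℝ}

/-- The right-hand side of the `n`-th problem only involves the earlier terms, so the uniqueness for a
single problem applies inductively. -/
theorem unique (ha : a.Regular) (h : IsFormalExpansion a T φ u) (h' : IsFormalExpansion a T φ u')
    (n : ℕ) : ∀ t ∈ Ico 0 T, u n t = u' n t := by
  induction n using Nat.strong_induction_on with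
  | _ n ih =>
    intro t ht
    rcases Nat.eq_zero_or_pos n with rfl | hn
    · exact h.1.unique ha h'.1 (fun _ _ _ => rfl) ht
    · refine (h.2 n hn).unique ha (h'.2 n hn) (fun s hs x => ?_) ht
      refine Finset.sum_congr rfl fun k hk => ?_
      rw [Finset.mem_Icc] at hk
      rw [ih (n - k) (by omega) s hs]

lemma congr {a' : Coeffs d} (hT : 0 < T) (h : IsFormalExpansion a T φ u)
    (ha : ∀ t ∈ Ico 0 T, ∀ n f x, a.op n t f x = a'.op n t f x)
    (hu : ∀ n, ∀ t ∈ Ico 0 T, u n t = u' n t) : IsFormalExpansion a' T φ u' :=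
  ⟨h.1.congr hT (fun t ht => ha t ht 0) (fun _ _ _ => rfl) (hu 0), fun n hn =>
    (h.2 n hn).congr hT (fun t ht => ha t ht 0) (fun t ht x => Finset.sum_congr rfl fun k _ => by
      rw [ha t ht, hu _ t ht]) (hu n)⟩

end IsFormalExpansion

/-! ### Dependence on the coefficients -/

lemma iterInt_congr {T : ℝ} : ∀ {h : ℕ} {r : ℝ} {F F' : (Fin h → ℝ) → ℝ}, r ≤ T →
    (∀ v, (∀ k, v k ∈ Icc r T) → F v = F' v) → iterInt T h r F = iterInt T h r F'
  | 0, _, _, _, _, hF => hF _ fun k => k.elim0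
  | h + 1, r, F, F', hr, hF => by
    refine intervalIntegral.integral_congr fun s hs => ?_
    rw [uIcc_of_le hr] at hs
    refine iterInt_congr hs.2 fun v hv => hF _ fun k => ?_
    refine Fin.cases ?_ (fun k => ?_) k
    · simpa using hs
    · simpa using ⟨hs.1.trans (hv k).1, (hv k).2⟩

namespace Coeffs

variable {a a' : Coeffs d} {T : ℝ} (h : ∀ t ∈ Icc 0 T, ∀ α n, a α n t = a' α n t)
include h

lemma op_congr {t : ℝ} (ht : t ∈ Icc 0 T) (n : ℕ) (f : Rd d → ℝ) (x : Rd d) :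
    a.op n t f x = a'.op n t f x := by
  simp only [op, val, h t ht]

lemma mean_congr {t s : ℝ} (ht : t ∈ Icc 0 T) (hs : s ∈ Icc 0 T) : a.mean t s = a'.mean t s := by
  ext i
  refine intervalIntegral.integral_congr fun r hr => ?_
  simp only [drift, zeroth, val, h r (uIcc_subset_Icc ht hs hr)]

lemma cov_congr {t s : ℝ} (ht : t ∈ Icc 0 T) (hs : s ∈ Icc 0 T) : a.cov t s = a'.cov t s := by
  ext i j
  refine intervalIntegral.integral_congr fun r hr => ?_
  simp only [diffusion, zeroth, val, h r (uIcc_subset_Icc ht hs hr)]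

lemma G_congr {t s : ℝ} (ht : t ∈ Icc 0 T) (hs : s ∈ Icc 0 T) (n : ℕ) : a.G n t s = a'.G n t s := by
  have hM : a.M t s = a'.M t s := by
    ext i f x
    simp only [M, mean_congr h ht hs, cov_congr h ht hs]
  ext f x
  simp only [G, hM, h s hs]

lemma L_congr {t : ℝ} (ht : t ∈ Icc 0 T) (n : ℕ) : a.L n t T = a'.L n t T := by
  ext f x
  refine Finset.sum_congr rfl fun k _ => iterInt_congr ht.2 fun v hv => ?_
  refine Finset.sum_congr rfl fun i _ => ?_
  have : ∀ k, a.G (i k) t (v k) = a'.G (i k) t (v k) := fun k =>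
    G_congr h ht ⟨ht.1.trans (hv k).1, (hv k).2⟩ _
  simp only [prodG, this]

lemma u₀_congr {t : ℝ} (ht : t ∈ Icc 0 T) (φ : Rd d → ℝ) : a.u₀ T φ t = a'.u₀ T φ t := by
  have hT : T ∈ Icc 0 T := ⟨ht.1.trans ht.2, le_rfl⟩
  have hγ : ∫ s in t..T, a.potential s = ∫ s in t..T, a'.potential s :=
    intervalIntegral.integral_congr fun r hr => by
      simp only [potential, zeroth, val, h r (uIcc_subset_Icc ht hT hr)]
  ext x
  simp only [u₀, gauss, hγ, mean_congr h ht hT, cov_congr h ht hT]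

end Coeffs

end GaussianExpansion

theorem theorem3p1 (d : ℕ) (T : ℝ) (hT : 0 < T) (a : Coeffs d)
    (ha : IsPolynomialExpansion a T) (φ : Rd d → ℝ) (hφm : Measurable φ) (hφ : ExpGrowth φ)
    (u : ℕ → ℝ → Rd d → ℝ) :
    IsFormalExpansion a T φ u ↔
      ∀ t ∈ Ico 0 T, ∀ x : Rd d,
        u 0 t x = a.u₀ T φ t x ∧ ∀ n : ℕ, 1 ≤ n → u n t x = a.L n t T (a.u₀ T φ t) x := by
  -- freezing the coefficients outside `[0,T]` changes neither the problems nor the operators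
  have hreg := Coeffs.regular_clamp hT.le ha
  set b := a.clamp hT.le
  have hba : ∀ t ∈ Icc 0 T, ∀ α n, b α n t = a α n t := fun t ht α n =>
    a.clamp_apply hT.le ht α n
  have hab : ∀ t ∈ Icc 0 T, ∀ α n, a α n t = b α n t := fun t ht α n => (hba t ht α n).symm
  set w := b.expansion T (hreg.heat.solExt T φ)
  have hw : IsFormalExpansion b T φ w := Coeffs.isFormalExpansion_expansion hreg hT hφm hφ
  have hu₀ : ∀ t ∈ Ico 0 T, hreg.heat.solExt T φ t = a.u₀ T φ t := fun t ht => by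
    rw [HeatData.solExt_of_lt ht.2, ← hreg.u₀_eq, Coeffs.u₀_congr hba (Ico_subset_Icc_self ht)]
  have hw0 : ∀ t ∈ Ico 0 T, w 0 t = a.u₀ T φ t := fun t ht =>
    (Coeffs.expansion_zero t).trans (hu₀ t ht)
  have hwn : ∀ n, 1 ≤ n → ∀ t ∈ Ico 0 T, w n t = a.L n t T (a.u₀ T φ t) := fun n hn t ht => by
    ext x
    rw [← hu₀ t ht, Coeffs.L_congr hab (Ico_subset_Icc_self ht)]
    exact Coeffs.expansion_eq_L hn t x
  constructor
  · intro h t ht x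
    have h1 := IsFormalExpansion.unique hreg
      (h.congr hT (fun t ht n => Coeffs.op_congr hab (Ico_subset_Icc_self ht) n) fun _ _ _ => rfl) hw
    exact ⟨by rw [h1 0 t ht, hw0 t ht], fun n hn => by rw [h1 n t ht, hwn n hn t ht]⟩
  · intro h
    refine hw.congr hT (fun t ht n => Coeffs.op_congr hba (Ico_subset_Icc_self ht) n)
      fun n t ht => ?_
    rcases Nat.eq_zero_or_pos n with rfl | hn
    · rw [hw0 t ht]
      exact funext fun x => (h t ht x).1.symm
    · rw [hwn n hn t ht]
      exact funext fun x => ((h t ht x).2 n hn).symm
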